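/- **Setting.** Let $\{\varepsilon(\boldsymbol s),\boldsymbol s\in\mathbb Z^2\}$ be i.i.d. random variables with mean $0$ and variance $1$. Let $q>0$ satisfy $1<2/q<2$ (that is, $1<q<2$), let $B=(b_{ij})_{i,j=1,2}$ be a real nondegenerate matrix, and let $L_\pm$ be continuous functions on $[-1,1]$ with $L_+(1)=L_-(1)$ and $L_+(-1)=L_-(-1)$. For $\boldsymbol u\in\mathbb R^2\setminus\{\boldsymbol 0\}$ put $\rho(\boldsymbol u)=|u_1|^q+|u_2|^q$, $L(\boldsymbol u)=L_+(u_1/\rho(\boldsymbol u)^{1/q})$ if $u_2\ge 0$, $L(\boldsymbol u)=L_-(u_1/\rho(\boldsymbol u)^{1/q})$ if $u_2<0$, and $a_\infty(\boldsymbol u)=\rho(\boldsymbol u)^{-1}L(\boldsymbol u)$. Let $b:\mathbb Z^2\to\mathbb R$ satisfy $b(\boldsymbol t)=\rho(B\boldsymbol t)^{-1}(L(B\boldsymbol t)+o(1))$ as $|\boldsymbol t|\to\infty$. Consider the linear random field $X(\boldsymbol t)=\sum_{\boldsymbol s\in\mathbb Z^2}b(\boldsymbol t-\boldsymbol s)\varepsilon(\boldsymbol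 s)$ and, for $\gamma>0$, $\lambda>0$ and $\boldsymbol x\in\mathbb R^2_+=(0,\infty)^2$, the partial sums $$S_{\lambda,\gamma}(\boldsymbol x)=\sum_{\boldsymbol t\in\mathbb Z^2:\,0<t_1\le\lambda x_1,\;0<t_2\le\lambda^\gamma x_2}X(\boldsymbol t).$$ Let $W$ be Gaussian white noise on $\mathbb R^2$ with zero mean and variance $\mathrm E\,W(d\boldsymbol u)^2=d\boldsymbol u$. Put $(\boldsymbol 0,\boldsymbol x]=(0,x_1]\times(0,x_2]$ and, for a $2\times2$ matrix $D$, $$\tilde V_D(\boldsymbol x)=|\det B|^{-1/2}\int_{\mathbb R^2}\Big\{\int_{(\boldsymbol 0,\boldsymbol x]}a_\infty(D\boldsymbol t-\boldsymbol u)\,d\boldsymbol t\Big\}W(d\boldsymbol u),$$ $$V_D(\boldsymbol x)=|\det B|^{-1}\int_{\mathbb R^2}\Big\{\int_{\mathbb R^2}a_\infty(\boldsymbol t)\,\mathbf 1(D\boldsymbol t+\boldsymbol u\in(\boldsymbol 0,\boldsymbol x])\,d\boldsymbol t\Big\}W(d\boldsymbol u).$$ Let $$\tilde B_{01}=\begin{bmatrix}b_{11}&0\\b_{21}&0\end{bmatrix},\quad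 \tilde B_{02}=\begin{bmatrix}0&b_{12}\\0&b_{22}\end{bmatrix},\quad B_{10}=\frac1{\det B}\begin{bmatrix}b_{22}&-b_{12}\\0&0\end{bmatrix},\quad B_{20}=\frac1{\det B}\begin{bmatrix}0&0\\-b_{21}&b_{11}\end{bmatrix},$$ and $\tilde V_{01}=\tilde V_{\tilde B_{01}}$, $\tilde V_{02}=\tilde V_{\tilde B_{02}}$, $\tilde V_0=\tilde V_B$, $V_{10}=V_{B_{10}}$, $V_{20}=V_{B_{20}}$, $V_0=V_{B^{-1}}$. A fractional Brownian sheet $B_{\mathcal H_1,\mathcal H_2}$, $0<\mathcal H_i\le1$, is a centered Gaussian random field on $\mathbb R^2_+$ with covariance $\frac14\prod_{i=1}^2(x_i^{2\mathcal H_i}+y_i^{2\mathcal H_i}-|x_i-y_i|^{2\mathcal H_i})$. Convergence and equality of random fields on $\mathbb R^2_+$ are understood in the sense of finite-dimensional distributions. **Theorem.** The series defining $X(\boldsymbol t)$ converges in mean square for every $\boldsymbol t$. Moreover: (i) Let $1<q<3/2$ and $\tilde H=2-q$. The fields $\tilde V_{02},\tilde V_{01},\tilde V_0$ are well defined (the inner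 integrals converge for a.e. $\boldsymbol u$ and the kernels are in $L^2(\mathbb R^2)$), and as $\lambda\to\infty$ $$\lambda^{-H(\gamma)}S_{\lambda,\gamma}\to\begin{cases}\tilde V_{02},&\gamma>1,\quad H(\gamma)=1+\gamma\tilde H,\\ \tilde V_{01},&0<\gamma<1,\quad H(\gamma)=\tilde H+\gamma,\\ \tilde V_0,&\gamma=1,\quad H(1)=3-q.\end{cases}$$ Moreover $\tilde V_{02}=\tilde\sigma_{02}B_{1,\tilde H}$ and $\tilde V_{01}=\tilde\sigma_{01}B_{\tilde H,1}$ in distribution, where $\tilde\sigma_{ij}^2=\mathrm E|\tilde V_{ij}(1,1)|^2$; and, unless $\tilde\sigma_{02}=\tilde\sigma_{01}=0$, for no $c>0$ do $\tilde V_{02}$ and $c\tilde V_{01}$ have the same finite-dimensional distributions. (ii) Let $3/2<q<2$ and $H=\frac52-q$. The fields $V_{10},V_{20},V_0$ are well defined (in the same sense), and as $\lambda\to\infty$ $$\lambda^{-H(\gamma)}S_{\lambda,\gamma}\to\begin{cases}V_{10},&\gamma>1,\quad H(\gamma)=H+\gamma/2,\\ V_{20},&0<\gamma<1,\quad H(\gamma)=\frac12+\gamma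 H,\\ V_0,&\gamma=1,\quad H(1)=3-q.\end{cases}$$ Moreover $V_{10}=\sigma_{10}B_{H,1/2}$ and $V_{20}=\sigma_{20}B_{1/2,H}$ in distribution, where $\sigma_{ij}^2=\mathrm E|V_{ij}(1,1)|^2$; and, unless $\sigma_{10}=\sigma_{20}=0$, for no $c>0$ do $V_{10}$ and $cV_{20}$ have the same finite-dimensional distributions. In other words, in both cases the scaling transition occurs at $\gamma_0=1$. -/

import Mathlib

open MeasureTheory ProbabilityTheory Filter Topology Matrix

noncomputable section

namespace ScalingLimits

/-! ### The linear random field and its partial sums -/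

/-- Standardized i.i.d. innovations on `ℤ²`. -/
structure StandardIID {Ω : Type*} [MeasurableSpace Ω] (ε : (Fin 2 → ℤ) → Ω → ℝ)
    (P : Measure Ω) : Prop where
  memLp : ∀ s, MemLp (ε s) 2 P
  indep : iIndepFun ε P
  ident : ∀ s, IdentDistrib (ε s) (ε 0) P P
  mean : ∫ ω, ε 0 ω ∂P = 0
  var : ∫ ω, (ε 0 ω) ^ 2 ∂P = 1

/-- The radial function `ρ(u) = |u₁|^{q₁} + |u₂|^{q₂}`. -/
def rho (q₁ q₂ : ℝ) (u : Fin 2 → ℝ) : ℝ := |u 0| ^ q₁ + |u 1| ^ q₂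

/-- The angular function: `L₊(u₁/ρ(u)^{1/q₁})` if `u₂ ≥ 0` and `L₋(u₁/ρ(u)^{1/q₁})` if `u₂ < 0`. -/
def angular (q₁ q₂ : ℝ) (Lplus Lminus : ℝ → ℝ) (u : Fin 2 → ℝ) : ℝ :=
  if 0 ≤ u 1 then Lplus (u 0 / rho q₁ q₂ u ^ (1 / q₁)) else Lminus (u 0 / rho q₁ q₂ u ^ (1 / q₁))

/-- `a_∞(u) = ρ(u)⁻¹ L(u)`. -/
def aInfty (q₁ q₂ : ℝ) (Lplus Lminus : ℝ → ℝ) (u : Fin 2 → ℝ) : ℝ :=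
  (rho q₁ q₂ u)⁻¹ * angular q₁ q₂ Lplus Lminus u

/-- The assumptions on the moving-average coefficients:
`b(t) = ρ(Bt)⁻¹ (L(Bt) + o(1))` as `|t| → ∞`, `t ∈ ℤ²` (the filter `cofinite` on `ℤ²`). -/
structure CoeffAssumption (q₁ q₂ : ℝ) (B : Matrix (Fin 2) (Fin 2) ℝ) (Lplus Lminus : ℝ → ℝ)
    (b : (Fin 2 → ℤ) → ℝ) : Prop where
  q₁_pos : 0 < q₁
  q₂_pos : 0 < q₂
  one_lt_Q : 1 < 1 / q₁ + 1 / q₂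
  Q_lt_two : 1 / q₁ + 1 / q₂ < 2
  det_ne_zero : B.det ≠ 0
  continuousOn_Lplus : ContinuousOn Lplus (Set.Icc (-1) 1)
  continuousOn_Lminus : ContinuousOn Lminus (Set.Icc (-1) 1)
  L_one : Lplus 1 = Lminus 1
  L_neg_one : Lplus (-1) = Lminus (-1)
  asymp : ∃ r : (Fin 2 → ℤ) → ℝ, Tendsto r cofinite (𝓝 0) ∧
    ∀ᶠ t : Fin 2 → ℤ in cofinite,
      b t = (rho q₁ q₂ (B *ᵥ fun i => (t i : ℝ)))⁻¹ *
        (angular q₁ q₂ Lplus Lminus (B *ᵥ fun i => (t i : ℝ)) + r t)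

/-- The terms `b(t - s) ε(s)`, `s ∈ ℤ²`, of the moving average at `t`, as elements of `L²(P)`. -/
def maTerm {Ω : Type*} [MeasurableSpace Ω] {P : Measure Ω} {ε : (Fin 2 → ℤ) → Ω → ℝ}
    (hε : StandardIID ε P) (b : (Fin 2 → ℤ) → ℝ) (t s : Fin 2 → ℤ) : Lp ℝ 2 P :=
  b (t - s) • (hε.memLp s).toLp (ε s)

/-- The linear random field `X(t) = ∑ₛ b(t - s) ε(s)`, the series being taken in `L²(P)`. -/
def linearField {Ω : Type*} [MeasurableSpace Ω] {P : Measure Ω} {ε : (Fin 2 → ℤ) → Ω → ℝ}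
    (hε : StandardIID ε P) (b : (Fin 2 → ℤ) → ℝ) (t : Fin 2 → ℤ) : Lp ℝ 2 P :=
  ∑' s, maTerm hε b t s

/-- The partial sum of `X` over the `t ∈ ℤ²` with `0 < t₁ ≤ l x₁` and `0 < t₂ ≤ l^γ x₂`. -/
def partialSum {Ω : Type*} [MeasurableSpace Ω] {P : Measure Ω} (X : (Fin 2 → ℤ) → Lp ℝ 2 P)
    (γ l : ℝ) (x : Fin 2 → ℝ) : Lp ℝ 2 P :=
  ∑ t ∈ Fintype.piFinset ![Finset.Ioc 0 ⌊l * x 0⌋, Finset.Ioc 0 ⌊l ^ γ * x 1⌋], X t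

/-! ### Gaussian white noise and the limit fields -/

/-- Gaussian white noise on `ℝ²` with Lebesgue variance, given by its stochastic integral: a linear
map from `L²(ℝ²)` to random variables such that the integral of `h` is centered Gaussian with
variance `‖h‖²`.  In particular `W(A)` is the integral of the indicator function of `A`. -/
structure WhiteNoise {Ω : Type*} [MeasurableSpace Ω] (P : Measure Ω) where
  toLinearMap : Lp ℝ 2 (volume : Measure (Fin 2 → ℝ)) →ₗ[ℝ] Lp ℝ 2 P
  hasLaw : ∀ h, HasLaw (toLinearMap h) (gaussianReal 0 (‖h‖₊ ^ 2)) P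

/-- Gaussian white noise exists. -/
theorem exists_whiteNoise : ∃ (Ω : Type) (_ : MeasurableSpace Ω) (P : Measure Ω)
    (_ : IsProbabilityMeasure P), Nonempty (WhiteNoise P) := by
  classical
  obtain ⟨w, b, -⟩ := exists_hilbertBasis ℝ (Lp ℝ 2 (volume : Measure (Fin 2 → ℝ)))
  let P : Measure (w → ℝ) := Measure.infinitePi fun _ => gaussianReal 0 1
  have hev : ∀ i : w, HasLaw (fun ω : w → ℝ => ω i) (gaussianReal 0 1) P := fun i =>
    ⟨(measurable_pi_apply i).aemeasurable, Measure.infinitePi_map_eval _ i⟩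
  have hind : iIndepFun (fun (i : w) (ω : w → ℝ) => ω i) P :=
    iIndepFun_infinitePi (P := fun _ : w => gaussianReal 0 1) (X := fun _ => id)
      (fun _ => measurable_id)
  have hg : ∀ i : w, HasGaussianLaw (fun ω : w → ℝ => ω i) P := fun i =>
    ⟨by rw [(hev i).map_eq]; infer_instance⟩
  have hmem : ∀ i : w, MemLp (fun ω : w → ℝ => ω i) 2 P := fun i => (hg i).memLp_two
  have hmean : ∀ i : w, ∫ ω, ω i ∂P = 0 := fun i => by
    rw [(hev i).integral_eq]; simp
  have hvar : ∀ i : w, ∫ ω, ω i * ω i ∂P = 1 := fun i => by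
    have h1 := (hev i).variance_eq
    rw [variance_of_integral_eq_zero (hev i).aemeasurable (hmean i), variance_id_gaussianReal] at h1
    simpa [sq] using h1
  let e : w → Lp ℝ 2 P := fun i => (hmem i).toLp _
  have he : Orthonormal ℝ e := by
    rw [orthonormal_iff_ite]
    intro i j
    have : inner ℝ (e i) (e j) = ∫ ω, ω i * ω j ∂P := by
      rw [L2.inner_def]
      refine integral_congr_ae ?_
      filter_upwards [(hmem i).coeFn_toLp, (hmem j).coeFn_toLp] with ω h1 h2
      simp [e, h1, h2, mul_comm]
    rw [this]
    split_ifs with hij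
    · subst hij; exact hvar i
    · have := (hind.indepFun hij).integral_fun_mul_eq_mul_integral
        (hmem i).aestronglyMeasurable (hmem j).aestronglyMeasurable
      rw [this, hmean, zero_mul]
  let U : Lp ℝ 2 (volume : Measure (Fin 2 → ℝ)) →ₗᵢ[ℝ] Lp ℝ 2 P :=
    he.orthogonalFamily.linearIsometry.comp b.repr.toLinearIsometry
  have hU : ∀ i, U (b i) = e i := fun i => by
    simp [U, b.repr_self, LinearIsometry.toSpanSingleton_apply]
  have hspan : ∀ h ∈ Submodule.span ℝ (Set.range b), ∀ t : ℝ,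
      charFun (P.map (U h)) t = Complex.exp (-(‖h‖ ^ 2 * t ^ 2 / 2 : ℝ)) := by
    intro h hh t
    obtain ⟨c, rfl⟩ := Finsupp.mem_span_range_iff_exists_finsupp.1 hh
    have h1 : (U (c.sum fun i a => a • b i) : (w → ℝ) → ℝ) =ᵐ[P]
        fun ω => ∑ i ∈ c.support, c i * ω i := by
      have : U (c.sum fun i a => a • b i) = ∑ i ∈ c.support, c i • e i := by
        simp [Finsupp.sum, map_sum, hU]
      rw [this]
      refine (Lp.coeFn_finsetSum _ _).trans ?_
      have : ∀ᵐ ω ∂P, ∀ i ∈ c.support, (c i • e i : Lp ℝ 2 P) ω = c i * ω i := by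
        refine (Finset.eventually_all _).2 fun i _ => ?_
        filter_upwards [Lp.coeFn_smul (c i) (e i), (hmem i).coeFn_toLp] with ω h1 h2
        simp [h1, e, h2]
      filter_upwards [this] with ω h
      simp only [Finset.sum_apply]
      exact Finset.sum_congr rfl h
    have h2 : ‖c.sum fun i a => a • b i‖ ^ 2 = ∑ i ∈ c.support, c i ^ 2 := by
      rw [← real_inner_self_eq_norm_sq, Finsupp.sum, b.orthonormal.inner_sum]
      simp [sq]
    have h3 : iIndepFun (fun (i : w) (ω : w → ℝ) => c i * ω i) P :=
      hind.comp (fun i x => c i * x) (fun i => by fun_prop)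
    have h5 : ∀ i : w, Measurable (fun ω : w → ℝ => c i * ω i) := by
      intro i
      exact measurable_const.mul (measurable_pi_apply i)
    rw [Measure.map_congr h1, iIndepFun.charFun_map_fun_finsetSum_eq_prod
      (fun i _ => (h5 i).aemeasurable)
      (h3.restrict _), h2, Finset.prod_apply]
    have h4 : ∀ i, charFun (P.map fun ω : w → ℝ => c i * ω i) t
        = Complex.exp (-(c i ^ 2 * t ^ 2 / 2 : ℝ)) := by
      intro i
      have : P.map (fun ω : w → ℝ => c i * ω i) = gaussianReal 0 (NNReal.mk (c i ^ 2) (sq_nonneg _)) := by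
        have := gaussianReal_map_const_mul (μ := 0) (v := 1) (c i)
        rw [← (hev i).map_eq, Measure.map_map (by fun_prop) (by fun_prop)] at this
        simpa [Function.comp_def] using this
      rw [this, charFun_gaussianReal]
      congr 1
      push_cast
      simp
    simp only [h4]
    rw [← Complex.exp_sum]
    congr 1
    push_cast
    rw [Finset.sum_mul, Finset.sum_div, Finset.sum_neg_distrib]
  have hall : ∀ h, ∀ t : ℝ,
      charFun (P.map (U h)) t = Complex.exp (-(‖h‖ ^ 2 * t ^ 2 / 2 : ℝ)) := by
    intro h t
    have : h ∈ closure (Submodule.span ℝ (Set.range b) : Set _) := by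
      rw [← Submodule.topologicalClosure_coe, b.dense_span]; trivial
    obtain ⟨x, hx, hlim⟩ := mem_closure_iff_seq_limit.1 this
    have h1 := ((U.continuous.tendsto h).comp hlim)
    have h2 := (tendstoInMeasure_of_tendsto_Lp h1).tendstoInDistribution_of_aemeasurable
      (fun n => (Lp.stronglyMeasurable _).aemeasurable) (Lp.stronglyMeasurable _).aemeasurable
    have h3 := ProbabilityMeasure.tendsto_iff_tendsto_charFun.1 h2.tendsto t
    have h4 : Tendsto (fun n => Complex.exp (-(‖x n‖ ^ 2 * t ^ 2 / 2 : ℝ))) atTop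
        (𝓝 (Complex.exp (-(‖h‖ ^ 2 * t ^ 2 / 2 : ℝ)))) := by
      have hc : Continuous fun y : Lp ℝ 2 (volume : Measure (Fin 2 → ℝ)) =>
        Complex.exp (-(‖y‖ ^ 2 * t ^ 2 / 2 : ℝ)) := by fun_prop
      exact (hc.tendsto h).comp hlim
    refine tendsto_nhds_unique h3 (h4.congr fun n => ?_)
    exact (hspan _ (hx n) t).symm
  refine ⟨w → ℝ, inferInstance, P, inferInstance, ⟨U.toLinearMap, fun h => ?_⟩⟩
  refine ⟨(Lp.stronglyMeasurable _).aemeasurable, Measure.ext_of_charFun ?_⟩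
  ext t
  rw [LinearIsometry.coe_toLinearMap, hall, charFun_gaussianReal]
  congr 1
  push_cast
  simp

open Classical in
/-- The stochastic integral `∫ h(u) W(du)` of a square integrable function `h`
(and `0` for any other function). -/
def WhiteNoise.integral {Ω : Type*} [MeasurableSpace Ω] {P : Measure Ω} (W : WhiteNoise P)
    (h : (Fin 2 → ℝ) → ℝ) : Ω → ℝ :=
  if hh : MemLp h 2 volume then W.toLinearMap (hh.toLp h) else 0

/-- The rectangle `(0, x] = (0, x₁] × (0, x₂]`. -/
def box (x : Fin 2 → ℝ) : Set (Fin 2 → ℝ) := Set.univ.pi fun i => Set.Ioc 0 (x i)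

/-- The kernel `u ↦ |det B|^{-1/2} ∫_{(0,x]} a(Dt - u) dt`. -/
def kernelTilde (a : (Fin 2 → ℝ) → ℝ) (B D : Matrix (Fin 2) (Fin 2) ℝ) (x u : Fin 2 → ℝ) : ℝ :=
  |B.det| ^ (-(1 / 2) : ℝ) * ∫ t in box x, a (D *ᵥ t - u)

/-- The kernel `u ↦ |det B|^{-1} ∫_{ℝ²} a(t) 1(Dt + u ∈ (0,x]) dt`. -/
def kernel (a : (Fin 2 → ℝ) → ℝ) (B D : Matrix (Fin 2) (Fin 2) ℝ) (x u : Fin 2 → ℝ) : ℝ :=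
  |B.det|⁻¹ * ∫ t in {t | D *ᵥ t + u ∈ box x}, a t

/-- The random field `Ṽ_D`. -/
def VTilde {Ω : Type*} [MeasurableSpace Ω] {P : Measure Ω} (W : WhiteNoise P)
    (a : (Fin 2 → ℝ) → ℝ) (B D : Matrix (Fin 2) (Fin 2) ℝ) (x : Fin 2 → ℝ) : Ω → ℝ :=
  W.integral (kernelTilde a B D x)

/-- The random field `V_D`. -/
def V {Ω : Type*} [MeasurableSpace Ω] {P : Measure Ω} (W : WhiteNoise P)
    (a : (Fin 2 → ℝ) → ℝ) (B D : Matrix (Fin 2) (Fin 2) ℝ) (x : Fin 2 → ℝ) : Ω → ℝ :=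
  W.integral (kernel a B D x)

/-- `Ṽ_D` is well defined: the inner integrals converge for a.e. `u`, and the resulting kernels are
square integrable. -/
def VTildeWellDefined (a : (Fin 2 → ℝ) → ℝ) (B D : Matrix (Fin 2) (Fin 2) ℝ) : Prop :=
  ∀ x : Fin 2 → ℝ, (∀ i, 0 < x i) →
    (∀ᵐ u : Fin 2 → ℝ, IntegrableOn (fun t => a (D *ᵥ t - u)) (box x)) ∧
      MemLp (kernelTilde a B D x) 2 volume

/-- `V_D` is well defined: the inner integrals converge for a.e. `u`, and the resulting kernels are
square integrable. -/
def VWellDefined (a : (Fin 2 → ℝ) → ℝ) (B D : Matrix (Fin 2) (Fin 2) ℝ) : Prop :=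
  ∀ x : Fin 2 → ℝ, (∀ i, 0 < x i) →
    (∀ᵐ u : Fin 2 → ℝ, IntegrableOn a {t | D *ᵥ t + u ∈ box x}) ∧
      MemLp (kernel a B D x) 2 volume

/-- `B̃₀₁ = [b₁₁ 0; b₂₁ 0]`. -/
def Btilde01 (B : Matrix (Fin 2) (Fin 2) ℝ) : Matrix (Fin 2) (Fin 2) ℝ := !![B 0 0, 0; B 1 0, 0]

/-- `B̃₀₂ = [0 b₁₂; 0 b₂₂]`. -/
def Btilde02 (B : Matrix (Fin 2) (Fin 2) ℝ) : Matrix (Fin 2) (Fin 2) ℝ := !![0, B 0 1; 0, B 1 1]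

/-- `B₁₀ = det(B)⁻¹ [b₂₂ -b₁₂; 0 0]`. -/
def B10 (B : Matrix (Fin 2) (Fin 2) ℝ) : Matrix (Fin 2) (Fin 2) ℝ :=
  B.det⁻¹ • !![B 1 1, -B 0 1; 0, 0]

/-- `B₂₀ = det(B)⁻¹ [0 0; -b₂₁ b₁₁]`. -/
def B20 (B : Matrix (Fin 2) (Fin 2) ℝ) : Matrix (Fin 2) (Fin 2) ℝ :=
  B.det⁻¹ • !![0, 0; -B 1 0, B 0 0]

/-! ### Finite-dimensional distributions, fractional Brownian sheet -/

/-- Convergence, as `l → ∞`, of the finite-dimensional distributions of random fields on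
`ℝ²₊ = (0,∞)²`. -/
def TendstoFDD {Ω Ω' : Type*} [MeasurableSpace Ω] [MeasurableSpace Ω']
    (Y : ℝ → (Fin 2 → ℝ) → Ω → ℝ) (P : Measure Ω) [IsProbabilityMeasure P]
    (Z : (Fin 2 → ℝ) → Ω' → ℝ) (P' : Measure Ω') [IsProbabilityMeasure P'] : Prop :=
  ∀ (n : ℕ) (x : Fin n → Fin 2 → ℝ), (∀ k i, 0 < x k i) →
    TendstoInDistribution (fun (l : ℝ) (ω : Ω) (k : Fin n) => Y l (x k) ω) atTop
      (fun (ω : Ω') (k : Fin n) => Z (x k) ω) (fun _ => P) P'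

/-- Equality of the finite-dimensional distributions of random fields on `ℝ²₊ = (0,∞)²`. -/
def EqFDD {Ω : Type*} [MeasurableSpace Ω] (Y Z : (Fin 2 → ℝ) → Ω → ℝ) (P : Measure Ω) : Prop :=
  ∀ (n : ℕ) (x : Fin n → Fin 2 → ℝ), (∀ k i, 0 < x k i) →
    IdentDistrib (fun (ω : Ω) (k : Fin n) => Y (x k) ω) (fun (ω : Ω) (k : Fin n) => Z (x k) ω) P P

/-- Fractional Brownian sheet on `ℝ²₊` with Hurst parameters `H₁, H₂`. -/
structure IsFBS {Ω : Type*} [MeasurableSpace Ω] (H₁ H₂ : ℝ) (Z : (Fin 2 → ℝ) → Ω → ℝ)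
    (P : Measure Ω) : Prop where
  gaussian : IsGaussianProcess (fun x : {x : Fin 2 → ℝ // ∀ i, 0 < x i} => Z x) P
  mean : ∀ x : Fin 2 → ℝ, (∀ i, 0 < x i) → ∫ ω, Z x ω ∂P = 0
  cov : ∀ x y : Fin 2 → ℝ, (∀ i, 0 < x i) → (∀ i, 0 < y i) →
    ∫ ω, Z x ω * Z y ω ∂P =
      1 / 4 * ((x 0 ^ (2 * H₁) + y 0 ^ (2 * H₁) - |x 0 - y 0| ^ (2 * H₁)) *
        (x 1 ^ (2 * H₂) + y 1 ^ (2 * H₂) - |x 1 - y 1| ^ (2 * H₂)))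

/-- The standard deviation `(E |Z(1,1)|²)^{1/2}`. -/
def sd {Ω : Type*} [MeasurableSpace Ω] (Z : (Fin 2 → ℝ) → Ω → ℝ) (P : Measure Ω) : ℝ :=
  √(∫ ω, (Z 1 ω) ^ 2 ∂P)

/-- `Z` has the finite-dimensional distributions of `σ B_{H₁,H₂}`, where `σ² = E |Z(1,1)|²` and
`B_{H₁,H₂}` is a fractional Brownian sheet. -/
def EqScaledFBS {Ω : Type*} [MeasurableSpace Ω] (H₁ H₂ : ℝ) (Z : (Fin 2 → ℝ) → Ω → ℝ)
    (P : Measure Ω) : Prop :=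
  ∃ S : (Fin 2 → ℝ) → Ω → ℝ, IsFBS H₁ H₂ S P ∧ EqFDD Z (fun x ω => sd Z P * S x ω) P

/-- The unbalanced limits are not proportional (in law), unless both of them vanish. -/
def NotProportional {Ω : Type*} [MeasurableSpace Ω] (Y Z : (Fin 2 → ℝ) → Ω → ℝ)
    (P : Measure Ω) : Prop :=
  ¬ (sd Y P = 0 ∧ sd Z P = 0) → ∀ c : ℝ, 0 < c → ¬ EqFDD Y (fun x ω => c * Z x ω) P

end ScalingLimits

end

open ScalingLimits

/-! Each partial sum is a linear form `∑ c(s) ε(s)`, where `c(s)` sums `b(t - s)` over the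
rectangle, so the theorem is about these coefficients. Two facts reduce it to analysis. A linear
form with uniformly small coefficients and sum of squares tending to `v` is asymptotically `N(0, v)`
(`StandardIID.tendsto_charFun`). Rounding `σ ↦ ⌈nσ⌉` embeds `ℓ²(ℤ²)` isometrically in `L²(ℝ²)` as
step functions, and `L²` convergence of the rescaled coefficients to a kernel `h` yields both the
smallness and the limit variance. By Cramér–Wold the fields then converge to `∫ h dW`
(`StandardIID.tendstoFDD`). The grid `n` is free: it need not be the scale of the rectangle.

Put `A(v) = a_∞(Bv)`, homogeneous of degree `-q`. Then `M^q b(⌈Mv⌉)` tends to `A(v)` and is bounded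
by a multiple of `‖v‖^{-q}`, so rectangle sums are Riemann sums, and dominated convergence in `L²`
finishes once a square integrable majorant is known. Majorants come from `‖v‖^{-q} ≤ |v₁|^{-α}
|v₂|^{-β}` with `α + β = q`, the exponents being chosen region by region
(`smearedDomination_degenerate`, `exists_window_domination`).

For `γ = 1` the grid is isotropic and the even split works for `1 < q < 2`. Otherwise let `i` be the
short and `j` the long direction of the rectangle. Integrating `A` along direction `j` leaves a
profile of order at most `|σᵢ|^{1-q}`, for which `3/2` is the threshold of square integrability, at
zero from below and at infinity from above. If `q < 3/2`, the grid is isotropic at the long scale: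
the rectangle becomes a segment, its rows are translates by vanishing amounts, and averaging them
changes nothing in the limit (`LatticeApprox.tendsto_boxSum_degenerate`). If `q > 3/2`, the grid
follows both sides of the rectangle while `t - s` is measured at the short scale: the sum along `j`
extends to a whole line, and `σⱼ` survives only through the indicator of `(0, xⱼ]`
(`LatticeApprox.memLp_and_tendsto_boxSum_strip`).

The limits are fractional Brownian sheets because their kernels scale exactly and have stationary
increments. In the first case the kernel is linear in `xᵢ` (Hurst index 1); in the second it is cut
off to `0 < σⱼ ≤ xⱼ` (Hurst index 1/2). The remaining index is read off from homogeneity, and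
different indices in one direction exclude proportionality. -/

noncomputable section

namespace ScalingLimits

/-! ### A central limit theorem for linear forms in i.i.d. variables -/

section LinearForms

variable {Ω : Type*} [MeasurableSpace Ω] {P : Measure Ω} {ε : (Fin 2 → ℤ) → Ω → ℝ}

/-- The innovation `ε(s)` as an element of `L²(P)`. -/
def StandardIID.toL2 (hε : StandardIID ε P) (s : Fin 2 → ℤ) : Lp ℝ 2 P :=
  (hε.memLp s).toLp (ε s)

theorem StandardIID.orthonormal [IsProbabilityMeasure P] (hε : StandardIID ε P) :
    Orthonormal ℝ hε.toL2 := by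
  have hmean : ∀ s, ∫ ω, ε s ω ∂P = 0 := fun s => by
    rw [(hε.ident s).integral_eq]; exact hε.mean
  rw [orthonormal_iff_ite]
  intro i j
  have : inner ℝ (hε.toL2 i) (hε.toL2 j) = ∫ ω, ε i ω * ε j ω ∂P := by
    rw [L2.inner_def]
    refine integral_congr_ae ?_
    filter_upwards [(hε.memLp i).coeFn_toLp, (hε.memLp j).coeFn_toLp] with ω h1 h2
    simp [StandardIID.toL2, h1, h2, mul_comm]
  rw [this]
  split_ifs with hij
  · subst hij
    have := ((hε.ident i).comp (u := fun x => x ^ 2) (by fun_prop)).integral_eq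
    simp only [Function.comp_def, hε.var] at this
    rw [← this]
    simp [sq]
  · rw [(hε.indep.indepFun hij).integral_fun_mul_eq_mul_integral
      (hε.memLp i).aestronglyMeasurable (hε.memLp j).aestronglyMeasurable, hmean, zero_mul]

/-- Both characteristic functions equal `1 - u²/2 + o(u²)` at zero, so their difference is `o(u²)`.
Only second moments enter, which is why no Lindeberg condition is needed later. -/
theorem StandardIID.charFun_bound [IsProbabilityMeasure P] (hε : StandardIID ε P) {κ : ℝ}
    (hκ : 0 < κ) : ∃ δ > 0, ∀ u : ℝ, |u| ≤ δ →
      ‖charFun (P.map (ε 0)) u - Complex.exp (-(u ^ 2 / 2 : ℝ))‖ ≤ κ * u ^ 2 := by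
  have h1 := taylor_charFun_two (hε.memLp 0).aemeasurable hε.mean hε.var
  have h2 := taylor_charFun_two (X := id) (P := gaussianReal 0 1) (by fun_prop) (by simp)
    (by have := variance_of_integral_eq_zero (X := id) (μ := gaussianReal 0 1) (by fun_prop)
          (by simp)
        rw [variance_id_gaussianReal] at this
        simpa using this.symm)
  have h3 := (h1.sub h2).def hκ
  obtain ⟨δ, hδ, h⟩ := Metric.eventually_nhds_iff.1 h3
  refine ⟨δ / 2, by positivity, fun u hu => ?_⟩
  have := h (y := u) (by rw [Real.dist_eq, sub_zero]; linarith)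
  rw [Measure.map_id, charFun_gaussianReal] at this
  rw [sub_sub_sub_cancel_right, Real.norm_of_nonneg (sq_nonneg u)] at this
  have he : ((u : ℂ) * (0 : ℝ) * Complex.I - ((1 : NNReal) : ℝ) * (u : ℂ) ^ 2 / 2)
      = -(u ^ 2 / 2 : ℝ) := by
    push_cast
    simp
  rwa [he] at this

/-- Telescoping: the factors are exchanged one at a time while all others have modulus at most one.
-/
theorem norm_prod_sub_prod_le {ι : Type*} (s : Finset ι) (f g : ι → ℂ) (hf : ∀ i ∈ s, ‖f i‖ ≤ 1)
    (hg : ∀ i ∈ s, ‖g i‖ ≤ 1) :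
    ‖∏ i ∈ s, f i - ∏ i ∈ s, g i‖ ≤ ∑ i ∈ s, ‖f i - g i‖ := by
  classical
  induction s using Finset.induction_on with
  | empty => simp
  | insert a s ha ih =>
    rw [Finset.prod_insert ha, Finset.prod_insert ha, Finset.sum_insert ha]
    have h1 := ih (fun i hi => hf i (Finset.mem_insert_of_mem hi))
      (fun i hi => hg i (Finset.mem_insert_of_mem hi))
    have h2 : ‖∏ i ∈ s, g i‖ ≤ 1 := by
      rw [norm_prod]
      exact Finset.prod_le_one (fun _ _ => norm_nonneg _)
        fun i hi => hg i (Finset.mem_insert_of_mem hi)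
    have h3 := hf a (Finset.mem_insert_self _ _)
    calc ‖f a * ∏ i ∈ s, f i - g a * ∏ i ∈ s, g i‖
        = ‖f a * (∏ i ∈ s, f i - ∏ i ∈ s, g i) + (f a - g a) * ∏ i ∈ s, g i‖ := by ring_nf
      _ ≤ ‖f a‖ * ‖∏ i ∈ s, f i - ∏ i ∈ s, g i‖ + ‖f a - g a‖ * ‖∏ i ∈ s, g i‖ := by
        refine (norm_add_le _ _).trans ?_
        rw [norm_mul, norm_mul]
      _ ≤ 1 * ‖∏ i ∈ s, f i - ∏ i ∈ s, g i‖ + ‖f a - g a‖ * 1 := by gcongr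
      _ ≤ _ := by linarith

/-- By independence the characteristic function is a product of values at the `c s`; exchanging each
factor for its Gaussian counterpart costs `κ (c s)²`. Evaluation at `1` is enough, since the
argument can be absorbed into the coefficients. -/
theorem StandardIID.norm_charFun_sub_le_of_finset [IsProbabilityMeasure P] (hε : StandardIID ε P)
    {κ δ : ℝ} (h : ∀ u : ℝ, |u| ≤ δ →
      ‖charFun (P.map (ε 0)) u - Complex.exp (-(u ^ 2 / 2 : ℝ))‖ ≤ κ * u ^ 2)
    (c : (Fin 2 → ℤ) → ℝ) (hc : ∀ s, |c s| ≤ δ) (F : Finset (Fin 2 → ℤ)) :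
    ‖charFun (P.map (∑ s ∈ F, c s • hε.toL2 s : Lp ℝ 2 P)) 1
      - Complex.exp (-((∑ s ∈ F, c s ^ 2) / 2 : ℝ))‖ ≤ κ * ∑ s ∈ F, c s ^ 2 := by
  have h1 : (∑ s ∈ F, c s • hε.toL2 s : Lp ℝ 2 P) =ᵐ[P] fun ω => ∑ i ∈ F, c i * ε i ω := by
    refine (Lp.coeFn_finsetSum _ _).trans ?_
    have : ∀ᵐ ω ∂P, ∀ i ∈ F, (c i • hε.toL2 i : Lp ℝ 2 P) ω = c i * ε i ω := by
      refine (Finset.eventually_all _).2 fun i _ => ?_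
      filter_upwards [Lp.coeFn_smul (c i) (hε.toL2 i), (hε.memLp i).coeFn_toLp] with ω h1 h2
      rw [h1, Pi.smul_apply, smul_eq_mul, StandardIID.toL2, h2]
    filter_upwards [this] with ω h
    simp only [Finset.sum_apply]
    exact Finset.sum_congr rfl h
  have h3 : iIndepFun (fun (i : Fin 2 → ℤ) (ω : Ω) => c i * ε i ω) P :=
    hε.indep.comp (fun i x => c i * x) (fun i => by fun_prop)
  rw [Measure.map_congr h1, iIndepFun.charFun_map_fun_finsetSum_eq_prod
    (fun i _ => (hε.memLp i).aemeasurable.const_mul _) (h3.restrict _), Finset.prod_apply]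
  have h4 : ∀ i, charFun (P.map fun ω => c i * ε i ω) 1 = charFun (P.map (ε 0)) (c i) := by
    intro i
    rw [charFun_map_mul_comp (hε.memLp i).aemeasurable, (hε.ident i).map_eq, mul_one]
  have h5 : Complex.exp (-((∑ s ∈ F, c s ^ 2) / 2 : ℝ))
      = ∏ i ∈ F, Complex.exp (-(c i ^ 2 / 2 : ℝ)) := by
    rw [← Complex.exp_sum]
    congr 1
    push_cast
    rw [Finset.sum_div, Finset.sum_neg_distrib]
  have := Measure.isProbabilityMeasure_map (μ := P) (hε.memLp 0).aemeasurable
  simp only [h4]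
  rw [h5, Finset.mul_sum]
  refine (norm_prod_sub_prod_le _ _ _ (fun i _ => norm_charFun_le_one _) fun i _ => ?_).trans
    (Finset.sum_le_sum fun i _ => h _ (hc i))
  rw [← Complex.ofReal_neg, Complex.norm_exp_ofReal, Real.exp_le_one_iff]
  have := sq_nonneg (c i)
  linarith

/-- `L²` convergence implies convergence in measure, hence in law. This carries the estimate for
finite forms over to infinite series. -/
theorem continuous_charFun_map_Lp [IsProbabilityMeasure P] (t : ℝ) :
    Continuous fun X : Lp ℝ 2 P => charFun (P.map X) t := by
  refine continuous_iff_seqContinuous.2 fun x X hx => ?_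
  have h2 := (tendstoInMeasure_of_tendsto_Lp hx).tendstoInDistribution_of_aemeasurable
    (fun n => (Lp.stronglyMeasurable _).aemeasurable) (Lp.stronglyMeasurable _).aemeasurable
  exact ProbabilityMeasure.tendsto_iff_tendsto_charFun.1 h2.tendsto t

theorem StandardIID.hasSum_sq [IsProbabilityMeasure P] (hε : StandardIID ε P)
    {c : (Fin 2 → ℤ) → ℝ} {Y : Lp ℝ 2 P} (hY : HasSum (fun s => c s • hε.toL2 s) Y) :
    Summable fun s => c s ^ 2 := by
  have := (hε.orthonormal.orthogonalFamily.summable_iff_norm_sq_summable c).1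
    (by simpa [LinearIsometry.toSpanSingleton_apply] using hY.summable)
  simpa using this

theorem StandardIID.summable_smul [IsProbabilityMeasure P] (hε : StandardIID ε P)
    {c : (Fin 2 → ℤ) → ℝ} (hc : Summable fun s => c s ^ 2) :
    Summable fun s => c s • hε.toL2 s := by
  have := (hε.orthonormal.orthogonalFamily.summable_iff_norm_sq_summable c).2 (by simpa using hc)
  simpa [LinearIsometry.toSpanSingleton_apply] using this

theorem StandardIID.norm_charFun_sub_le [IsProbabilityMeasure P] (hε : StandardIID ε P)
    {κ δ : ℝ} (h : ∀ u : ℝ, |u| ≤ δ →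
      ‖charFun (P.map (ε 0)) u - Complex.exp (-(u ^ 2 / 2 : ℝ))‖ ≤ κ * u ^ 2)
    {c : (Fin 2 → ℤ) → ℝ} (hc : ∀ s, |c s| ≤ δ) {Y : Lp ℝ 2 P}
    (hY : HasSum (fun s => c s • hε.toL2 s) Y) :
    ‖charFun (P.map Y) 1 - Complex.exp (-((∑' s, c s ^ 2) / 2 : ℝ))‖ ≤ κ * ∑' s, c s ^ 2 := by
  have h1 : Tendsto (fun F : Finset (Fin 2 → ℤ) => ∑ s ∈ F, c s ^ 2) atTop
      (𝓝 (∑' s, c s ^ 2)) := (hε.hasSum_sq hY).hasSum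
  have h2 := ((continuous_charFun_map_Lp (P := P) 1).tendsto Y).comp hY
  have h3 : Continuous fun x : ℝ => Complex.exp (-(x / 2 : ℝ)) := by fun_prop
  exact le_of_tendsto_of_tendsto' (h2.sub ((h3.tendsto _).comp h1)).norm (h1.const_mul κ)
    (hε.norm_charFun_sub_le_of_finset h c hc)

/-- Linear forms whose coefficients are asymptotically negligible are asymptotically Gaussian. -/
theorem StandardIID.tendsto_charFun [IsProbabilityMeasure P] (hε : StandardIID ε P)
    {ι : Type*} {𝓕 : Filter ι}
    {c : ι → (Fin 2 → ℤ) → ℝ} {Y : ι → Lp ℝ 2 P}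
    (hY : ∀ i, HasSum (fun s => c i s • hε.toL2 s) (Y i))
    (hc : ∀ δ > 0, ∀ᶠ i in 𝓕, ∀ s, |c i s| ≤ δ) {v : ℝ}
    (hv : Tendsto (fun i => ∑' s, c i s ^ 2) 𝓕 (𝓝 v)) :
    Tendsto (fun i => charFun (P.map (Y i)) 1) 𝓕 (𝓝 (Complex.exp (-(v / 2 : ℝ)))) := by
  have h3 : Continuous fun x : ℝ => Complex.exp (-(x / 2 : ℝ)) := by fun_prop
  have h4 := (h3.tendsto _).comp hv
  suffices h : Tendsto (fun i => charFun (P.map (Y i)) 1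
      - Complex.exp (-((∑' s, c i s ^ 2) / 2 : ℝ))) 𝓕 (𝓝 0) by
    simpa using h.add h4
  rw [Metric.tendsto_nhds]
  intro η hη
  have hpos : 0 < |v| + 1 := by positivity
  -- The sums of squares are eventually below `|v| + 1`, so this `κ` makes the total error at most
  -- `η / 2`.
  obtain ⟨δ, hδ, h⟩ := hε.charFun_bound (κ := η / (2 * (|v| + 1))) (by positivity)
  filter_upwards [hc δ hδ, hv.eventually_lt_const (show v < |v| + 1 by
    linarith [le_abs_self v])] with i hi hvi
  rw [dist_zero_right]
  refine (hε.norm_charFun_sub_le h hi (hY i)).trans_lt ?_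
  calc η / (2 * (|v| + 1)) * ∑' s, c i s ^ 2 ≤ η / (2 * (|v| + 1)) * (|v| + 1) := by gcongr
    _ = η / 2 := by field_simp
    _ < η := by linarith

end LinearForms

/-! ### Discretization of the plane -/

/-- The lattice point `(⌈n₁ σ₁⌉, ⌈n₂ σ₂⌉)`. -/
def ceilMap (n σ : Fin 2 → ℝ) : Fin 2 → ℤ := fun i => ⌈n i * σ i⌉

theorem measurable_ceilMap (n : Fin 2 → ℝ) : Measurable (ceilMap n) := by
  unfold ceilMap
  fun_prop

theorem ceilMap_preimage_singleton {n : Fin 2 → ℝ} (hn : ∀ i, 0 < n i) (s : Fin 2 → ℤ) :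
    ceilMap n ⁻¹' {s} = Set.univ.pi fun i => Set.Ioc ((s i - 1) / n i) (s i / n i) := by
  ext σ
  simp only [Set.mem_preimage, Set.mem_singleton_iff, funext_iff, ceilMap, Set.mem_univ_pi,
    Int.ceil_eq_iff, Set.mem_Ioc]
  refine forall_congr' fun i => ?_
  rw [div_lt_iff₀ (hn i), le_div_iff₀ (hn i), mul_comm (σ i)]

theorem volume_ceilMap_preimage_singleton {n : Fin 2 → ℝ} (hn : ∀ i, 0 < n i) (s : Fin 2 → ℤ) :
    volume (ceilMap n ⁻¹' {s}) = ENNReal.ofReal (n 0 * n 1)⁻¹ := by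
  rw [ceilMap_preimage_singleton hn, Real.volume_pi_Ioc, Fin.prod_univ_two,
    ← ENNReal.ofReal_mul (by
      rw [← sub_div]; exact div_nonneg (by norm_num) (hn 0).le)]
  congr 1
  have h0 := (hn 0).ne'
  have h1 := (hn 1).ne'
  field_simp
  ring

/-- The cell of every lattice point has area `(n₀ n₁)⁻¹`. This single identity converts between
lattice sums and plane integrals. -/
theorem map_ceilMap {n : Fin 2 → ℝ} (hn : ∀ i, 0 < n i) :
    (volume : Measure (Fin 2 → ℝ)).map (ceilMap n)
      = ENNReal.ofReal (n 0 * n 1)⁻¹ • Measure.count := by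
  refine Measure.ext_of_singleton fun s => ?_
  rw [Measure.map_apply (measurable_ceilMap n) (measurableSet_singleton s),
    volume_ceilMap_preimage_singleton hn, Measure.smul_apply, Measure.count_singleton, smul_eq_mul,
    mul_one]

/-- The factor `√(n₀ n₁)` compensates the area of the cells and makes passing to step functions an
isometry. -/
theorem eLpNorm_comp_ceilMap {n : Fin 2 → ℝ} (hn : ∀ i, 0 < n i) (c : (Fin 2 → ℤ) → ℝ) :
    eLpNorm (fun σ => √(n 0 * n 1) * c (ceilMap n σ)) 2 volume = eLpNorm c 2 Measure.count := by
  have hN : 0 < n 0 * n 1 := mul_pos (hn 0) (hn 1)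
  have h1 : (fun σ => √(n 0 * n 1) * c (ceilMap n σ)) = √(n 0 * n 1) • (c ∘ ceilMap n) := rfl
  rw [h1, eLpNorm_const_smul, ← eLpNorm_map_measure (measurable_of_countable c).aestronglyMeasurable
    (measurable_ceilMap n).aemeasurable, map_ceilMap hn, eLpNorm_smul_measure_of_ne_top (by simp),
    smul_eq_mul, ← mul_assoc, Real.enorm_eq_ofReal (Real.sqrt_nonneg _), ENNReal.toReal_div,
    ENNReal.ofReal_rpow_of_nonneg (by positivity) (by simp), ← ENNReal.ofReal_mul (by positivity)]
  have h2 : √(n 0 * n 1) * (n 0 * n 1)⁻¹ ^ (ENNReal.toReal 1 / ENNReal.toReal 2) = 1 := by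
    rw [Real.sqrt_eq_rpow, ENNReal.toReal_one, ENNReal.toReal_ofNat,
      ← Real.mul_rpow hN.le (by positivity), mul_inv_cancel₀ hN.ne', Real.one_rpow]
  rw [h2, ENNReal.ofReal_one, one_mul]

theorem eLpNorm_count_eq {c : (Fin 2 → ℤ) → ℝ} (hc : Summable fun s => c s ^ 2) :
    eLpNorm c 2 Measure.count = ENNReal.ofReal √(∑' s, c s ^ 2) := by
  rw [eLpNorm_eq_lintegral_rpow_enorm_toReal (by simp) (by simp), lintegral_count]
  have : ∀ s, ‖c s‖ₑ ^ (ENNReal.toReal 2) = ENNReal.ofReal (c s ^ 2) := fun s => by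
    rw [Real.enorm_eq_ofReal_abs, ENNReal.ofReal_rpow_of_nonneg (abs_nonneg _) (by simp)]
    simp
  simp only [this]
  rw [← ENNReal.ofReal_tsum_of_nonneg (fun s => sq_nonneg _) hc,
    ENNReal.ofReal_rpow_of_nonneg (tsum_nonneg fun s => sq_nonneg _) (by simp), Real.sqrt_eq_rpow]
  simp

/-! ### From `L²` convergence of kernels to convergence of random fields -/

section Limit

variable {Ω Ω' : Type*} [MeasurableSpace Ω] [MeasurableSpace Ω']
  {P : Measure Ω} [IsProbabilityMeasure P] {P' : Measure Ω'} [IsProbabilityMeasure P']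
  {ε : (Fin 2 → ℤ) → Ω → ℝ}

/-- The coefficients are asymptotically negligible if the rescaled kernels converge in `L²`. -/
theorem eventually_abs_le_of_tendsto_kernel {c : ℝ → (Fin 2 → ℤ) → ℝ} {n : ℝ → Fin 2 → ℝ}
    (hn : ∀ i, Tendsto (fun l => n l i) atTop atTop) {h : (Fin 2 → ℝ) → ℝ} (hh : MemLp h 2 volume)
    (hlim : Tendsto (fun l => eLpNorm
      (fun σ => √(n l 0 * n l 1) * c l (ceilMap (n l) σ) - h σ) 2 volume) atTop (𝓝 0)) :
    ∀ δ > 0, ∀ᶠ l in atTop, ∀ s, |c l s| ≤ δ := by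
  intro δ hδ
  -- `|c l s|` is the `L²` norm of the step function on the cell of `s`. There `h` contributes at
  -- most `δ / 2`, by absolute continuity of `∫ h²` and because cell areas tend to zero; the `L²`
  -- error contributes the other half.
  obtain ⟨η, hη, hunif⟩ := hh.eLpNorm_indicator_le (by norm_num) (by simp) (half_pos hδ)
  have hN : Tendsto (fun l => (n l 0 * n l 1)⁻¹) atTop (𝓝 0) :=
    ((hn 0).atTop_mul_atTop₀ (hn 1)).inv_tendsto_atTop
  have h1 := hlim.eventually_lt_const (show (0 : ENNReal) < ENNReal.ofReal (δ / 2) by simpa)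
  filter_upwards [h1, hN.eventually_lt_const hη, (hn 0).eventually_gt_atTop 0,
    (hn 1).eventually_gt_atTop 0] with l hl hNl h0 h1 s
  have hpos : ∀ i, 0 < n l i := by
    intro i; fin_cases i <;> assumption
  set S := ceilMap (n l) ⁻¹' {s} with hS
  have hSm : MeasurableSet S := measurable_ceilMap _ (measurableSet_singleton s)
  have hSv : volume S = ENNReal.ofReal (n l 0 * n l 1)⁻¹ :=
    volume_ceilMap_preimage_singleton hpos s
  have hcell : eLpNorm (S.indicator fun _ => √(n l 0 * n l 1) * c l s) 2 volume
      = ENNReal.ofReal |c l s| := by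
    rw [eLpNorm_indicator_const hSm (by simp) (by simp), hSv, Real.enorm_eq_ofReal_abs,
      ENNReal.ofReal_rpow_of_nonneg (by positivity) (by simp), ← ENNReal.ofReal_mul (by positivity),
      abs_mul, abs_of_nonneg (Real.sqrt_nonneg _), mul_right_comm]
    have : √(n l 0 * n l 1) * (n l 0 * n l 1)⁻¹ ^ (1 / ENNReal.toReal 2) = 1 := by
      rw [Real.sqrt_eq_rpow, ENNReal.toReal_ofNat,
        ← Real.mul_rpow (by positivity) (by positivity), mul_inv_cancel₀ (by positivity),
        Real.one_rpow]
    rw [this, one_mul]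
  have hdec : (S.indicator fun _ => √(n l 0 * n l 1) * c l s)
      = S.indicator (fun σ => √(n l 0 * n l 1) * c l (ceilMap (n l) σ) - h σ)
        + S.indicator h := by
    ext σ
    by_cases hσ : σ ∈ S
    · have : ceilMap (n l) σ = s := hσ
      simp [hσ, this]
    · simp [hσ]
  have hmeas : AEStronglyMeasurable
      (fun σ => √(n l 0 * n l 1) * c l (ceilMap (n l) σ) - h σ) volume :=
    (((measurable_of_countable (c l)).comp (measurable_ceilMap _)).const_mul _).aestronglyMeasurable.sub
      hh.aestronglyMeasurable
  have : ENNReal.ofReal |c l s| ≤ ENNReal.ofReal δ := by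
    rw [← hcell, hdec]
    calc _ ≤ _ := eLpNorm_add_le (hmeas.indicator hSm) (hh.aestronglyMeasurable.indicator hSm)
          (by norm_num)
      _ ≤ ENNReal.ofReal (δ / 2) + ENNReal.ofReal (δ / 2) := by
        gcongr
        · exact (eLpNorm_indicator_le _).trans hl.le
        · exact hunif S hSm (hSv.le.trans (ENNReal.ofReal_le_ofReal hNl.le))
      _ = ENNReal.ofReal δ := by
        rw [← ENNReal.ofReal_add (by positivity) (by positivity), add_halves]
  exact (ENNReal.ofReal_le_ofReal_iff hδ.le).1 this

/-- The sums of squares converge if the rescaled kernels converge in `L²`. -/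
theorem tendsto_tsum_sq_of_tendsto_kernel {c : ℝ → (Fin 2 → ℤ) → ℝ}
    (hc : ∀ l, Summable fun s => c l s ^ 2) {n : ℝ → Fin 2 → ℝ}
    (hn : ∀ i, Tendsto (fun l => n l i) atTop atTop) {h : (Fin 2 → ℝ) → ℝ} (hh : MemLp h 2 volume)
    (hlim : Tendsto (fun l => eLpNorm
      (fun σ => √(n l 0 * n l 1) * c l (ceilMap (n l) σ) - h σ) 2 volume) atTop (𝓝 0)) :
    Tendsto (fun l => ∑' s, c l s ^ 2) atTop (𝓝 (∫ σ, h σ ^ 2)) := by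
  have hf : ∀ l, AEStronglyMeasurable (fun σ => √(n l 0 * n l 1) * c l (ceilMap (n l) σ)) volume :=
    fun l => (((measurable_of_countable (c l)).comp
      (measurable_ceilMap _)).const_mul _).aestronglyMeasurable
  have h1 : Tendsto (fun l => eLpNorm (fun σ => √(n l 0 * n l 1) * c l (ceilMap (n l) σ)) 2 volume)
      atTop (𝓝 (eLpNorm h 2 volume)) := by
    have hlo : Tendsto (fun l => eLpNorm h 2 volume - eLpNorm
      (fun σ => √(n l 0 * n l 1) * c l (ceilMap (n l) σ) - h σ) 2 volume) atTop
        (𝓝 (eLpNorm h 2 volume - 0)) :=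
      ENNReal.Tendsto.sub tendsto_const_nhds hlim (Or.inl hh.eLpNorm_ne_top)
    have hup : Tendsto (fun l => eLpNorm h 2 volume + eLpNorm
      (fun σ => √(n l 0 * n l 1) * c l (ceilMap (n l) σ) - h σ) 2 volume) atTop
        (𝓝 (eLpNorm h 2 volume + 0)) := tendsto_const_nhds.add hlim
    rw [tsub_zero] at hlo
    rw [add_zero] at hup
    refine tendsto_of_tendsto_of_tendsto_of_le_of_le hlo hup (fun l => ?_) fun l => ?_
    · rw [tsub_le_iff_right]
      have := eLpNorm_sub_le (hf l) ((hf l).sub hh.aestronglyMeasurable) (p := 2) (by norm_num)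
      refine le_trans (le_of_eq ?_) this
      congr 1
      ext σ
      simp
    · have := eLpNorm_add_le hh.aestronglyMeasurable ((hf l).sub hh.aestronglyMeasurable) (p := 2)
        (by norm_num)
      refine le_trans (le_of_eq ?_) this
      congr 1
      ext σ
      simp
  have h2 : Tendsto (fun l => (eLpNorm (c l) 2 Measure.count).toReal ^ 2) atTop
      (𝓝 ((eLpNorm h 2 volume).toReal ^ 2)) := by
    refine (((ENNReal.tendsto_toReal hh.eLpNorm_ne_top).comp h1).pow 2).congr' ?_
    filter_upwards [(hn 0).eventually_gt_atTop 0, (hn 1).eventually_gt_atTop 0] with l h0 h1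
    have hpos : ∀ i, 0 < n l i := by
      intro i; fin_cases i <;> assumption
    rw [Function.comp_apply, eLpNorm_comp_ceilMap hpos]
  have h3 : (eLpNorm h 2 volume).toReal ^ 2 = ∫ σ, h σ ^ 2 := by
    rw [← Lp.norm_toLp h hh, ← real_inner_self_eq_norm_sq, L2.inner_def]
    refine integral_congr_ae ?_
    filter_upwards [hh.coeFn_toLp] with σ hσ
    simp [hσ, sq]
  rw [h3] at h2
  refine h2.congr fun l => ?_
  rw [eLpNorm_count_eq (hc l), ENNReal.toReal_ofReal (Real.sqrt_nonneg _),
    Real.sq_sqrt (tsum_nonneg fun s => sq_nonneg _)]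

theorem charFun_map_toLp {Ω₁ : Type*} [MeasurableSpace Ω₁] {P₁ : Measure Ω₁} {N : ℕ}
    {X : Fin N → Ω₁ → ℝ} (hX : ∀ k, AEMeasurable (X k) P₁) (t : EuclideanSpace ℝ (Fin N)) :
    charFun (P₁.map fun ω => (WithLp.toLp 2 fun k => X k ω : EuclideanSpace ℝ (Fin N))) t
      = charFun (P₁.map fun ω => ∑ k, t k * X k ω) 1 := by
  have hm : AEMeasurable (fun ω => (WithLp.toLp 2 fun k => X k ω : EuclideanSpace ℝ (Fin N))) P₁ :=
    (PiLp.continuous_toLp 2 _).measurable.comp_aemeasurable (aemeasurable_pi_lambda _ hX)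
  rw [charFun_apply, charFun_apply, integral_map hm (by fun_prop),
    integral_map (Finset.aemeasurable_fun_sum _ fun k _ => (hX k).const_mul _) (by fun_prop)]
  refine integral_congr_ae (ae_of_all _ fun ω => ?_)
  simp [PiLp.inner_apply]

/-- Convergence of random fields to a Gaussian field can be checked on characteristic functions of
linear combinations. -/
theorem tendstoFDD_of_charFun {Y : ℝ → (Fin 2 → ℝ) → Ω → ℝ} (hY : ∀ l x, AEMeasurable (Y l x) P)
    {Z : (Fin 2 → ℝ) → Ω' → ℝ} (hZ : ∀ x, AEMeasurable (Z x) P')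
    (h : ∀ (N : ℕ) (x : Fin N → Fin 2 → ℝ), (∀ k i, 0 < x k i) → ∀ θ : Fin N → ℝ,
      Tendsto (fun l => charFun (P.map fun ω => ∑ k, θ k * Y l (x k) ω) 1) atTop
        (𝓝 (charFun (P'.map fun ω => ∑ k, θ k * Z (x k) ω) 1))) :
    TendstoFDD Y P Z P' := by
  intro N x hx
  -- Characteristic functions need an inner product, so convergence is proved in `EuclideanSpace`
  -- and then pushed forward to plain functions.
  have key : TendstoInDistribution
      (fun (l : ℝ) (ω : Ω) => (WithLp.toLp 2 fun k => Y l (x k) ω : EuclideanSpace ℝ (Fin N))) atTop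
      (fun ω => WithLp.toLp 2 fun k => Z (x k) ω) (fun _ => P) P' := by
    have m1 : ∀ l, AEMeasurable
        (fun ω => (WithLp.toLp 2 fun k => Y l (x k) ω : EuclideanSpace ℝ (Fin N))) P := fun l =>
      (PiLp.continuous_toLp 2 _).measurable.comp_aemeasurable
        (aemeasurable_pi_lambda _ fun k => hY l (x k))
    have m2 : AEMeasurable
        (fun ω => (WithLp.toLp 2 fun k => Z (x k) ω : EuclideanSpace ℝ (Fin N))) P' :=
      (PiLp.continuous_toLp 2 _).measurable.comp_aemeasurable
        (aemeasurable_pi_lambda _ fun k => hZ (x k))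
    refine ⟨m1, m2, ?_⟩
    -- Lévy's continuity theorem is applied along sequences, to which the real parameter is reduced.
    refine tendsto_iff_seq_tendsto.2 fun u hu => ?_
    refine ProbabilityMeasure.tendsto_of_tendsto_charFun fun t => ?_
    have := (h N x hx t).comp hu
    refine Tendsto.congr (fun k => ?_) (this.trans (le_of_eq ?_))
    · exact (charFun_map_toLp (fun k => hY _ _) t).symm
    · exact congrArg 𝓝 (charFun_map_toLp (fun k => hZ _) t).symm
  exact key.continuous_comp (PiLp.continuous_ofLp 2 _)

/-- A central limit theorem for fields of linear forms whose rescaled kernels converge in `L²`. -/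
theorem StandardIID.tendstoFDD (hε : StandardIID ε P)
    {C : ℝ → (Fin 2 → ℝ) → (Fin 2 → ℤ) → ℝ} {Y : ℝ → (Fin 2 → ℝ) → Lp ℝ 2 P}
    (hY : ∀ l x, HasSum (fun s => C l x s • hε.toL2 s) (Y l x))
    {n : ℝ → Fin 2 → ℝ} (hn : ∀ i, Tendsto (fun l => n l i) atTop atTop)
    {h : (Fin 2 → ℝ) → (Fin 2 → ℝ) → ℝ} (hh : ∀ x, (∀ i, 0 < x i) → MemLp (h x) 2 volume)
    (hlim : ∀ x, (∀ i, 0 < x i) → Tendsto (fun l => eLpNorm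
      (fun σ => √(n l 0 * n l 1) * C l x (ceilMap (n l) σ) - h x σ) 2 volume) atTop (𝓝 0))
    {Y' : ℝ → (Fin 2 → ℝ) → Ω → ℝ} (hY' : ∀ l x, Y' l x =ᵐ[P] Y l x)
    {Z : (Fin 2 → ℝ) → Ω' → ℝ} (hZ : ∀ x, AEMeasurable (Z x) P')
    (hlaw : ∀ (N : ℕ) (x : Fin N → Fin 2 → ℝ), (∀ k i, 0 < x k i) → ∀ θ : Fin N → ℝ,
      HasLaw (fun ω => ∑ k, θ k * Z (x k) ω)
        (gaussianReal 0 (∫ σ, (∑ k, θ k * h (x k) σ) ^ 2).toNNReal) P') :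
    TendstoFDD Y' P Z P' := by
  refine tendstoFDD_of_charFun
    (fun l x => (Lp.stronglyMeasurable (Y l x)).aemeasurable.congr (hY' l x).symm) hZ ?_
  intro N x hx θ
  -- A linear combination of the field at several points is again a linear form in the innovations,
  -- so the one-dimensional limit theorem applies to it.
  have hsum : ∀ l, HasSum (fun s => (∑ k, θ k * C l (x k) s) • hε.toL2 s)
      (∑ k, θ k • Y l (x k)) := by
    intro l
    have := hasSum_sum (s := Finset.univ) fun k _ => (hY l (x k)).const_smul (θ k)
    refine this.congr_fun fun s => ?_
    rw [Finset.sum_smul]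
    simp [smul_smul]
  have hhθ : MemLp (fun σ => ∑ k, θ k * h (x k) σ) 2 volume :=
    memLp_finsetSum _ fun k _ => (hh _ (hx k)).const_mul _
  have hlimθ : Tendsto (fun l => eLpNorm (fun σ => √(n l 0 * n l 1) *
      (∑ k, θ k * C l (x k) (ceilMap (n l) σ)) - ∑ k, θ k * h (x k) σ) 2 volume) atTop (𝓝 0) := by
    have hz : Tendsto (fun l => ∑ k, ‖θ k‖ₑ * eLpNorm (fun σ => √(n l 0 * n l 1) *
        C l (x k) (ceilMap (n l) σ) - h (x k) σ) 2 volume) atTop (𝓝 (∑ k : Fin N, ‖θ k‖ₑ * 0)) :=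
      tendsto_finsetSum _ fun k _ => ENNReal.Tendsto.const_mul (hlim _ (hx k)) (Or.inr (by simp))
    simp only [mul_zero, Finset.sum_const_zero] at hz
    refine tendsto_of_tendsto_of_tendsto_of_le_of_le tendsto_const_nhds hz (fun _ => zero_le) ?_
    intro l
    have e : (fun σ => √(n l 0 * n l 1) * (∑ k, θ k * C l (x k) (ceilMap (n l) σ))
        - ∑ k, θ k * h (x k) σ) = ∑ k, θ k • fun σ => √(n l 0 * n l 1) *
        C l (x k) (ceilMap (n l) σ) - h (x k) σ := by
      ext σ
      simp only [Finset.sum_apply, Pi.smul_apply, smul_eq_mul, mul_sub, Finset.sum_sub_distrib,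
        Finset.mul_sum]
      congr 1
      exact Finset.sum_congr rfl fun k _ => by ring
    simp only [e]
    refine (eLpNorm_sum_le (fun k _ => ?_) (by norm_num)).trans (le_of_eq ?_)
    · exact ((((measurable_of_countable (C l (x k))).comp
        (measurable_ceilMap _)).const_mul _).aestronglyMeasurable.sub
          (hh _ (hx k)).aestronglyMeasurable).const_smul _
    · exact Finset.sum_congr rfl fun k _ => eLpNorm_const_smul _ _ _ _
  have key := hε.tendsto_charFun hsum (eventually_abs_le_of_tendsto_kernel hn hhθ hlimθ)
    (tendsto_tsum_sq_of_tendsto_kernel (fun l => hε.hasSum_sq (hsum l)) hn hhθ hlimθ)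
  rw [(hlaw N x hx θ).map_eq, charFun_gaussianReal]
  refine (key.congr fun l => ?_).trans (le_of_eq ?_)
  · congr 1
    refine Measure.map_congr ?_
    refine (Lp.coeFn_finsetSum _ _).trans ?_
    have : ∀ᵐ ω ∂P, ∀ k ∈ Finset.univ, (θ k • Y l (x k) : Lp ℝ 2 P) ω = θ k * Y' l (x k) ω := by
      refine (Finset.eventually_all _).2 fun k _ => ?_
      filter_upwards [Lp.coeFn_smul (θ k) (Y l (x k)), hY' l (x k)] with ω h1 h2
      rw [h1, Pi.smul_apply, smul_eq_mul, h2]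
    filter_upwards [this] with ω h
    rw [Finset.sum_apply]
    exact Finset.sum_congr rfl h
  · congr 2
    rw [Real.coe_toNNReal _ (integral_nonneg fun σ => sq_nonneg _)]
    push_cast
    simp

end Limit

/-! ### Lattice sums as integrals -/

theorem sum_eq_setIntegral_ceilMap {n : Fin 2 → ℝ} (hn : ∀ i, 0 < n i)
    (F : Finset (Fin 2 → ℤ)) (g : (Fin 2 → ℤ) → ℝ) :
    ∑ t ∈ F, g t = n 0 * n 1 * ∫ τ in ceilMap n ⁻¹' F, g (ceilMap n τ) := by
  have hN : 0 < n 0 * n 1 := mul_pos (hn 0) (hn 1)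
  have hcell : ∀ t, MeasurableSet (ceilMap n ⁻¹' {t}) := fun t =>
    measurable_ceilMap _ (measurableSet_singleton t)
  have h1 : ∫ τ in ceilMap n ⁻¹' F, g (ceilMap n τ)
      = ∑ t ∈ F, ∫ τ in ceilMap n ⁻¹' {t}, g t := by
    have : ceilMap n ⁻¹' (F : Set (Fin 2 → ℤ)) = ⋃ t ∈ F, ceilMap n ⁻¹' {t} := by
      ext τ; simp
    rw [this, integral_biUnion_finset _ (fun t _ => hcell t)]
    · refine Finset.sum_congr rfl fun t _ => setIntegral_congr_fun (hcell t) ?_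
      intro τ hτ
      have : ceilMap n τ = t := hτ
      simp [this]
    · intro s _ t _ hst
      refine Set.disjoint_left.2 fun τ h1 h2 => hst ?_
      exact (show ceilMap n τ = s from h1).symm.trans h2
    · intro t _
      refine (integrableOn_const (s := ceilMap n ⁻¹' {t}) (C := g t) (μ := volume) ?_).congr_fun
        ?_ (hcell t)
      · rw [volume_ceilMap_preimage_singleton hn]; exact ENNReal.ofReal_ne_top
      · intro τ hτ
        have : ceilMap n τ = t := hτ
        simp [this]
  rw [h1, Finset.mul_sum]
  refine Finset.sum_congr rfl fun t _ => ?_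
  rw [setIntegral_const, measureReal_def, volume_ceilMap_preimage_singleton hn,
    ENNReal.toReal_ofReal (by positivity), smul_eq_mul, ← mul_assoc, mul_inv_cancel₀ hN.ne', one_mul]

/-- The lattice points of `(0, N]`. -/
def latticeBox (N : Fin 2 → ℤ) : Finset (Fin 2 → ℤ) :=
  Fintype.piFinset fun i => Finset.Ioc 0 (N i)

theorem mem_latticeBox {N t : Fin 2 → ℤ} : t ∈ latticeBox N ↔ ∀ i, 0 < t i ∧ t i ≤ N i := by
  simp [latticeBox]

theorem mem_box {x u : Fin 2 → ℝ} : u ∈ box x ↔ ∀ i, 0 < u i ∧ u i ≤ x i := by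
  simp [box]

theorem measurableSet_box (x : Fin 2 → ℝ) : MeasurableSet (box x) :=
  MeasurableSet.univ_pi fun _ => measurableSet_Ioc

/-- Rounding up makes the cells closed on the right, so `(0, N]` pulls back to a half-open rectangle
exactly, with no boundary correction. -/
theorem ceilMap_preimage_latticeBox {n : Fin 2 → ℝ} (hn : ∀ i, 0 < n i) (N : Fin 2 → ℤ) :
    ceilMap n ⁻¹' (latticeBox N : Set (Fin 2 → ℤ)) = box fun i => N i / n i := by
  ext τ
  simp only [Set.mem_preimage, Finset.mem_coe, mem_latticeBox, mem_box, ceilMap, Int.ceil_pos,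
    Int.ceil_le]
  refine forall_congr' fun i => ?_
  rw [le_div_iff₀ (hn i), mul_comm (τ i)]
  simp [hn i]

/-- Each rounding error lies in `[0, 1)`, so a difference of two moves by less than one, which the
`1 + ‖·‖` in the bound on `b` absorbs. The two scales differ because `n` may vanish in a degenerate
direction. -/
theorem norm_le_one_add_norm_ceilMap_sub (n n' τ σ : Fin 2 → ℝ) :
    ‖fun i => n i * τ i - n' i * σ i‖ ≤ 1 + ‖ceilMap n τ - ceilMap n' σ‖ := by
  refine (pi_norm_le_iff_of_nonneg (by positivity)).2 fun i => ?_
  have h := norm_le_pi_norm (ceilMap n τ - ceilMap n' σ) i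
  rw [Int.norm_eq_abs] at h
  simp only [Pi.sub_apply, ceilMap] at h
  have e1 := Int.le_ceil (n i * τ i)
  have e2 := Int.ceil_lt_add_one (n i * τ i)
  have e3 := Int.le_ceil (n' i * σ i)
  have e4 := Int.ceil_lt_add_one (n' i * σ i)
  push_cast at h
  rw [Real.norm_eq_abs]
  refine le_trans ?_ (add_le_add_right h 1)
  rw [abs_le]
  have h1 := neg_abs_le ((⌈n i * τ i⌉ : ℝ) - ⌈n' i * σ i⌉)
  have h2 := le_abs_self ((⌈n i * τ i⌉ : ℝ) - ⌈n' i * σ i⌉)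
  constructor <;> linarith

theorem norm_le_one_add_norm_ceilMap (n τ : Fin 2 → ℝ) :
    ‖fun i => n i * τ i‖ ≤ 1 + ‖ceilMap n τ‖ := by
  have := norm_le_one_add_norm_ceilMap_sub n n τ 0
  have h0 : ceilMap n 0 = 0 := by ext i; simp [ceilMap]
  simpa [h0] using this

/-! ### Homogeneous kernels and their lattice approximations -/

/-- `A` is homogeneous of degree `-q` and continuous away from the origin. -/
structure HomogeneousKernel (q : ℝ) (A : (Fin 2 → ℝ) → ℝ) : Prop where
  measurable : Measurable A
  continuousAt : ∀ v, v ≠ 0 → ContinuousAt A v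
  homogeneous : ∀ c : ℝ, 0 < c → ∀ v, A (c • v) = c ^ (-q) * A v
  bound : ∃ C : ℝ, 0 ≤ C ∧ ∀ v, |A v| ≤ C * ‖v‖ ^ (-q)

/-- `b` behaves at infinity like the homogeneous kernel `A`. -/
structure LatticeApprox (q : ℝ) (A : (Fin 2 → ℝ) → ℝ) (b : (Fin 2 → ℤ) → ℝ) : Prop where
  bound : ∃ C : ℝ, 0 ≤ C ∧ ∀ t, |b t| ≤ C * (1 + ‖t‖) ^ (-q)
  tendsto : ∀ (M : ℝ → ℝ) (z : ℝ → Fin 2 → ℤ) (r : Fin 2 → ℝ), r ≠ 0 → Tendsto M atTop atTop →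
    (∀ i, Tendsto (fun l => (z l i : ℝ) / M l) atTop (𝓝 (r i))) →
      Tendsto (fun l => M l ^ q * b (z l)) atTop (𝓝 (A r))

/-! ### The radial function -/

section Rho

variable {q : ℝ}

theorem rho_nonneg (u : Fin 2 → ℝ) : 0 ≤ rho q q u := by
  unfold rho; positivity

theorem norm_rpow_le_rho (u : Fin 2 → ℝ) : ‖u‖ ^ q ≤ rho q q u := by
  have h0 : |u 0| ^ q ≤ rho q q u := by
    unfold rho; have : 0 ≤ |u 1| ^ q := by positivity
    linarith
  have h1 : |u 1| ^ q ≤ rho q q u := by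
    unfold rho; have : 0 ≤ |u 0| ^ q := by positivity
    linarith
  have : ‖u‖ = max |u 0| |u 1| := by
    refine le_antisymm ((pi_norm_le_iff_of_nonneg (by positivity)).2 ?_)
      (max_le (norm_le_pi_norm u 0) (norm_le_pi_norm u 1))
    intro i; fin_cases i
    · exact le_max_left _ _
    · exact le_max_right _ _
  rw [this]
  rcases max_choice |u 0| |u 1| with h | h <;> rw [h] <;> assumption

theorem rho_pos {u : Fin 2 → ℝ} (hu : u ≠ 0) : 0 < rho q q u :=
  (Real.rpow_pos_of_pos (norm_pos_iff.2 hu) q).trans_le (norm_rpow_le_rho u)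

theorem rho_smul {c : ℝ} (hc : 0 < c) (u : Fin 2 → ℝ) :
    rho q q (c • u) = c ^ q * rho q q u := by
  unfold rho
  simp only [Pi.smul_apply, smul_eq_mul, abs_mul, abs_of_pos hc]
  rw [Real.mul_rpow hc.le (abs_nonneg _), Real.mul_rpow hc.le (abs_nonneg _)]
  ring

theorem continuous_rho (hq : 0 < q) : Continuous (rho q q) := by
  unfold rho
  have : ∀ i : Fin 2, Continuous fun u : Fin 2 → ℝ => |u i| ^ q := fun i =>
    (continuous_apply i).abs.rpow_const fun _ => Or.inr hq.le
  exact (this 0).add (this 1)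

theorem direction_mem_Icc (hq : 0 < q) (u : Fin 2 → ℝ) :
    u 0 / rho q q u ^ (1 / q) ∈ Set.Icc (-1 : ℝ) 1 := by
  have h : |u 0| ≤ rho q q u ^ (1 / q) := by
    have h1 : |u 0| ^ q ≤ rho q q u := by
      unfold rho; have : 0 ≤ |u 1| ^ q := by positivity
      linarith
    calc |u 0| = (|u 0| ^ q) ^ (1 / q) := by
          rw [← Real.rpow_mul (abs_nonneg _), mul_one_div_cancel hq.ne', Real.rpow_one]
      _ ≤ _ := by gcongr
  rw [Set.mem_Icc, ← abs_le, abs_div, abs_of_nonneg (Real.rpow_nonneg (rho_nonneg u) _)]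
  exact div_le_one_of_le₀ h (Real.rpow_nonneg (rho_nonneg u) _)

theorem rho_rpow_of_apply_one_eq_zero (hq : 0 < q) {u : Fin 2 → ℝ} (h : u 1 = 0) :
    rho q q u ^ (1 / q) = |u 0| := by
  rw [rho, h, abs_zero, Real.zero_rpow hq.ne', add_zero, ← Real.rpow_mul (abs_nonneg _),
    mul_one_div_cancel hq.ne', Real.rpow_one]

theorem angular_smul (hq : 0 < q) {Lplus Lminus : ℝ → ℝ} {c : ℝ} (hc : 0 < c) (u : Fin 2 → ℝ) :
    angular q q Lplus Lminus (c • u) = angular q q Lplus Lminus u := by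
  have h : (c • u) 0 / rho q q (c • u) ^ (1 / q) = u 0 / rho q q u ^ (1 / q) := by
    rw [rho_smul hc, Real.mul_rpow (by positivity) (rho_nonneg u), ← Real.rpow_mul hc.le,
      mul_one_div_cancel hq.ne', Real.rpow_one, Pi.smul_apply, smul_eq_mul,
      mul_div_mul_left _ _ hc.ne']
  unfold angular
  rw [h]
  simp [hc]

end Rho

/-! ### The angular function -/

section Angular

variable {q : ℝ} {Lplus Lminus : ℝ → ℝ}

theorem angular_congr (hq : 0 < q) {Lplus' Lminus' : ℝ → ℝ}
    (h1 : ∀ y ∈ Set.Icc (-1 : ℝ) 1, Lplus y = Lplus' y)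
    (h2 : ∀ y ∈ Set.Icc (-1 : ℝ) 1, Lminus y = Lminus' y) :
    angular q q Lplus Lminus = angular q q Lplus' Lminus' := by
  ext u
  unfold angular
  rw [h1 _ (direction_mem_Icc hq u), h2 _ (direction_mem_Icc hq u)]

/-- Directions always lie in `[-1, 1]`, so `L±` may be replaced by their constant extensions, which
are continuous on the whole line. -/
theorem exists_continuous_angular (hq : 0 < q) (h1 : ContinuousOn Lplus (Set.Icc (-1) 1))
    (h2 : ContinuousOn Lminus (Set.Icc (-1) 1)) :
    ∃ Lplus' Lminus' : ℝ → ℝ, Continuous Lplus' ∧ Continuous Lminus' ∧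
      Lplus' 1 = Lplus 1 ∧ Lplus' (-1) = Lplus (-1) ∧ Lminus' 1 = Lminus 1 ∧
      Lminus' (-1) = Lminus (-1) ∧ angular q q Lplus Lminus = angular q q Lplus' Lminus' := by
  have hle : (-1 : ℝ) ≤ 1 := by norm_num
  have key : ∀ (L : ℝ → ℝ), ∀ y ∈ Set.Icc (-1 : ℝ) 1,
      L y = Set.IccExtend hle (fun z : Set.Icc (-1 : ℝ) 1 => L z) y := fun L y hy =>
    (Set.IccExtend_of_mem hle (fun z : Set.Icc (-1 : ℝ) 1 => L z) hy).symm
  refine ⟨Set.IccExtend hle (fun z : Set.Icc (-1 : ℝ) 1 => Lplus z),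
    Set.IccExtend hle (fun z : Set.Icc (-1 : ℝ) 1 => Lminus z),
    (continuousOn_iff_continuous_domRestrict.1 h1).Icc_extend',
    (continuousOn_iff_continuous_domRestrict.1 h2).Icc_extend', ?_, ?_, ?_, ?_,
    angular_congr hq (key Lplus) (key Lminus)⟩
  · exact (key Lplus 1 (by simp)).symm
  · exact (key Lplus (-1) (by simp)).symm
  · exact (key Lminus 1 (by simp)).symm
  · exact (key Lminus (-1) (by simp)).symm

theorem measurable_angular (hq : 0 < q) (h1 : ContinuousOn Lplus (Set.Icc (-1) 1))
    (h2 : ContinuousOn Lminus (Set.Icc (-1) 1)) : Measurable (angular q q Lplus Lminus) := by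
  obtain ⟨L1, L2, c1, c2, -, -, -, -, h⟩ := exists_continuous_angular hq h1 h2
  rw [h]
  have hr : Measurable fun u : Fin 2 → ℝ => u 0 / rho q q u ^ (1 / q) :=
    (measurable_pi_apply 0).div ((continuous_rho hq).measurable.pow_const _)
  exact Measurable.ite (measurableSet_le measurable_const (measurable_pi_apply 1))
    (c1.measurable.comp hr) (c2.measurable.comp hr)

/-- The two branches meet only where `u₂ = 0`. There the direction is `±1`, exactly the points at
which `L₊` and `L₋` agree. -/
theorem continuousAt_angular (hq : 0 < q) (h1 : ContinuousOn Lplus (Set.Icc (-1) 1))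
    (h2 : ContinuousOn Lminus (Set.Icc (-1) 1)) (h3 : Lplus 1 = Lminus 1)
    (h4 : Lplus (-1) = Lminus (-1)) {u : Fin 2 → ℝ} (hu : u ≠ 0) :
    ContinuousAt (angular q q Lplus Lminus) u := by
  obtain ⟨L1, L2, c1, c2, e1, e2, e3, e4, h⟩ := exists_continuous_angular hq h1 h2
  rw [h]
  have hr : ContinuousAt (fun u : Fin 2 → ℝ => u 0 / rho q q u ^ (1 / q)) u := by
    refine (continuous_apply 0).continuousAt.div ((continuous_rho hq).continuousAt.rpow_const
      (Or.inl (rho_pos hu).ne')) ?_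
    exact (Real.rpow_pos_of_pos (rho_pos hu) _).ne'
  have k1 : ContinuousAt (fun u : Fin 2 → ℝ => L1 (u 0 / rho q q u ^ (1 / q))) u :=
    c1.continuousAt.comp hr
  have k2 : ContinuousAt (fun u : Fin 2 → ℝ => L2 (u 0 / rho q q u ^ (1 / q))) u :=
    c2.continuousAt.comp hr
  rcases lt_trichotomy (u 1) 0 with hlt | heq | hgt
  · refine k2.congr ?_
    filter_upwards [(continuous_apply (1 : Fin 2)).continuousAt.eventually_lt_const hlt] with v hv
    simp [angular, not_le.2 hv]
  · have hu0 : u 0 ≠ 0 := fun h0 => hu (by ext i; fin_cases i <;> assumption)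
    have hdir : L1 (u 0 / rho q q u ^ (1 / q)) = L2 (u 0 / rho q q u ^ (1 / q)) := by
      rw [rho_rpow_of_apply_one_eq_zero hq heq]
      rcases lt_or_gt_of_ne hu0 with h | h
      · rw [abs_of_neg h, div_neg, div_self hu0, e2, e4, h4]
      · rw [abs_of_pos h, div_self hu0, e1, e3, h3]
    have hval : angular q q L1 L2 u = L1 (u 0 / rho q q u ^ (1 / q)) := by
      simp [angular, heq]
    rw [ContinuousAt, hval]
    have k2' := k2.tendsto
    rw [← hdir] at k2'
    exact Tendsto.if' k1.tendsto k2'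
  · refine k1.congr ?_
    filter_upwards [(continuous_apply (1 : Fin 2)).continuousAt.eventually_const_lt hgt] with v hv
    simp [angular, hv.le]

theorem exists_angular_bound (hq : 0 < q) (h1 : ContinuousOn Lplus (Set.Icc (-1) 1))
    (h2 : ContinuousOn Lminus (Set.Icc (-1) 1)) :
    ∃ C : ℝ, 0 ≤ C ∧ ∀ u, |angular q q Lplus Lminus u| ≤ C := by
  obtain ⟨C1, hC1⟩ := isCompact_Icc.exists_bound_of_continuousOn h1
  obtain ⟨C2, hC2⟩ := isCompact_Icc.exists_bound_of_continuousOn h2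
  refine ⟨max 0 (max C1 C2), le_max_left _ _, fun u => ?_⟩
  unfold angular
  split_ifs
  · exact (hC1 _ (direction_mem_Icc hq u)).trans ((le_max_left _ _).trans (le_max_right _ _))
  · exact (hC2 _ (direction_mem_Icc hq u)).trans ((le_max_right _ _).trans (le_max_right _ _))

theorem homogeneousKernel_aInfty (hq : 0 < q) (h1 : ContinuousOn Lplus (Set.Icc (-1) 1))
    (h2 : ContinuousOn Lminus (Set.Icc (-1) 1)) (h3 : Lplus 1 = Lminus 1)
    (h4 : Lplus (-1) = Lminus (-1)) : HomogeneousKernel q (aInfty q q Lplus Lminus) where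
  measurable := (continuous_rho hq).measurable.inv.mul (measurable_angular hq h1 h2)
  continuousAt v hv := ((continuous_rho hq).continuousAt.inv₀ (rho_pos hv).ne').mul
    (continuousAt_angular hq h1 h2 h3 h4 hv)
  homogeneous c hc v := by
    rw [aInfty, aInfty, angular_smul hq hc, rho_smul hc, mul_inv, Real.rpow_neg hc.le, mul_assoc]
  bound := by
    obtain ⟨C, hC, hb⟩ := exists_angular_bound hq h1 h2
    refine ⟨C, hC, fun v => ?_⟩
    rcases eq_or_ne v 0 with rfl | hv
    -- At the origin the convention `0⁻¹ = 0` gives `a_∞(0) = 0`, so the bound is trivial.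
    · have : rho q q 0 = 0 := by simp [rho, hq.ne']
      rw [aInfty, this]
      simp only [_root_.inv_zero, zero_mul, abs_zero]
      positivity
    · rw [aInfty, abs_mul, abs_inv, abs_of_pos (rho_pos hv), mul_comm,
        Real.rpow_neg (norm_nonneg _)]
      have : 0 < ‖v‖ ^ q := Real.rpow_pos_of_pos (norm_pos_iff.2 hv) q
      gcongr
      · exact inv_nonneg.2 (rho_nonneg v)
      · exact hb v
      · exact norm_rpow_le_rho v

end Angular

/-! ### Composition with a nondegenerate matrix -/

section Matrix

variable {q : ℝ} {B : Matrix (Fin 2) (Fin 2) ℝ}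

theorem mulVec_ne_zero (hB : B.det ≠ 0) {v : Fin 2 → ℝ} (hv : v ≠ 0) : B *ᵥ v ≠ 0 := by
  intro h
  exact hv (Matrix.eq_zero_of_mulVec_eq_zero hB h)

theorem continuous_mulVec (B : Matrix (Fin 2) (Fin 2) ℝ) : Continuous fun v => B *ᵥ v :=
  Continuous.matrix_mulVec continuous_const continuous_id

theorem exists_norm_le_norm_mulVec (hB : B.det ≠ 0) :
    ∃ K : ℝ, 0 < K ∧ ∀ v : Fin 2 → ℝ, ‖v‖ ≤ K * ‖B *ᵥ v‖ := by
  let T : (Fin 2 → ℝ) →L[ℝ] (Fin 2 → ℝ) := LinearMap.toContinuousLinearMap (Matrix.mulVecLin B⁻¹)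
  refine ⟨‖T‖ + 1, by positivity, fun v => ?_⟩
  have h : T (B *ᵥ v) = v := by
    change B⁻¹ *ᵥ (B *ᵥ v) = v
    rw [Matrix.mulVec_mulVec, Matrix.nonsing_inv_mul _ (isUnit_iff_ne_zero.2 hB),
      Matrix.one_mulVec]
  calc ‖v‖ = ‖T (B *ᵥ v)‖ := by rw [h]
    _ ≤ ‖T‖ * ‖B *ᵥ v‖ := T.le_opNorm _
    _ ≤ _ := by gcongr; linarith

theorem exists_norm_mulVec_rpow_le (hq : 0 < q) (hB : B.det ≠ 0) :
    ∃ K : ℝ, 0 < K ∧ ∀ v : Fin 2 → ℝ, ‖B *ᵥ v‖ ^ (-q) ≤ K * ‖v‖ ^ (-q) := by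
  obtain ⟨K, hK, h⟩ := exists_norm_le_norm_mulVec hB
  refine ⟨K ^ q, by positivity, fun v => ?_⟩
  rcases eq_or_ne v 0 with rfl | hv
  -- For `v = 0` both sides vanish, since `0 ^ (-q) = 0` by convention.
  · simp [Real.zero_rpow (neg_ne_zero.2 hq.ne')]
  · have hv' := norm_pos_iff.2 hv
    have hBv := norm_pos_iff.2 (mulVec_ne_zero hB hv)
    rw [Real.rpow_neg hBv.le, Real.rpow_neg hv'.le, ← div_eq_mul_inv, inv_eq_one_div,
      div_le_div_iff₀ (by positivity) (by positivity), one_mul, ← Real.mul_rpow hK.le hBv.le]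
    exact Real.rpow_le_rpow hv'.le (h v) hq.le

theorem HomogeneousKernel.comp_mulVec {a : (Fin 2 → ℝ) → ℝ} (ha : HomogeneousKernel q a)
    (hq : 0 < q) (hB : B.det ≠ 0) : HomogeneousKernel q fun v => a (B *ᵥ v) where
  measurable := ha.measurable.comp (continuous_mulVec B).measurable
  continuousAt v hv := (ha.continuousAt _ (mulVec_ne_zero hB hv)).comp
    (f := fun v => B *ᵥ v) (continuous_mulVec B).continuousAt
  homogeneous c hc v := by rw [Matrix.mulVec_smul, ha.homogeneous c hc]
  bound := by
    obtain ⟨C, hC, h⟩ := ha.bound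
    obtain ⟨K, hK, h'⟩ := exists_norm_mulVec_rpow_le hq hB
    refine ⟨C * K, by positivity, fun v => (h _).trans ?_⟩
    rw [mul_assoc]
    exact mul_le_mul_of_nonneg_left (h' v) hC

end Matrix

theorem norm_intCast_pi (t : Fin 2 → ℤ) : ‖fun i => (t i : ℝ)‖ = ‖t‖ := by
  simp [Pi.norm_def, nnnorm]
  rfl

/-- A nonzero coordinate of `r` forces the same coordinate of `z` to grow like `M`; the asymptotics
of `b` at infinity can then be used along `z`. -/
theorem tendsto_cofinite_of_tendsto_div {M : ℝ → ℝ} {z : ℝ → Fin 2 → ℤ} {r : Fin 2 → ℝ}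
    (hr : r ≠ 0) (hM : Tendsto M atTop atTop)
    (h : ∀ i, Tendsto (fun l => (z l i : ℝ) / M l) atTop (𝓝 (r i))) :
    Tendsto z atTop cofinite := by
  obtain ⟨i, hi⟩ := Function.ne_iff.1 hr
  have h1 : Tendsto (fun l => |(z l i : ℝ) / M l| * M l) atTop atTop :=
    ((h i).abs.pos_mul_atTop (abs_pos.2 hi) hM)
  have h2 : Tendsto (fun l => ‖z l‖) atTop atTop := by
    refine tendsto_atTop_mono' _ ?_ h1
    filter_upwards [hM.eventually_gt_atTop 0] with l hl
    rw [abs_div, abs_of_pos hl, div_mul_cancel₀ _ hl.ne', ← Int.norm_eq_abs]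
    exact norm_le_pi_norm (z l) i
  rw [← Filter.cocompact_eq_cofinite, ← Metric.cobounded_eq_cocompact, ← comap_norm_atTop]
  exact tendsto_comap_iff.2 h2

theorem CoeffAssumption.latticeApprox {q : ℝ} {B : Matrix (Fin 2) (Fin 2) ℝ}
    {Lplus Lminus : ℝ → ℝ} {b : (Fin 2 → ℤ) → ℝ} (hb : CoeffAssumption q q B Lplus Lminus b) :
    LatticeApprox q (fun v => aInfty q q Lplus Lminus (B *ᵥ v)) b := by
  have hq := hb.q₁_pos
  have ha := homogeneousKernel_aInfty hq hb.continuousOn_Lplus hb.continuousOn_Lminus hb.L_one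
    hb.L_neg_one
  obtain ⟨r, hr, hbr⟩ := hb.asymp
  obtain ⟨K, hK, hKB⟩ := exists_norm_mulVec_rpow_le hq hb.det_ne_zero
  constructor
  · obtain ⟨C, hC, hang⟩ := exists_angular_bound hq hb.continuousOn_Lplus hb.continuousOn_Lminus
    have hev : ∀ᶠ t : Fin 2 → ℤ in cofinite, |b t| ≤ (C + 1) * K * 2 ^ q * (1 + ‖t‖) ^ (-q) := by
      have h0 : ∀ᶠ t : Fin 2 → ℤ in cofinite, t ≠ 0 := by
        simp
      filter_upwards [hbr, (hr.abs).eventually_lt_const (show |(0 : ℝ)| < 1 by simp), h0]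
        with t h1 h2 h3
      have hne : (fun i => (t i : ℝ)) ≠ 0 := fun h => h3 (by
        ext i
        have := congrFun h i
        simpa using this)
      have hBne := mulVec_ne_zero hb.det_ne_zero hne
      have hpos := norm_pos_iff.2 hBne
      have ht1 : 1 ≤ ‖t‖ := by
        obtain ⟨i, hi⟩ := Function.ne_iff.1 h3
        refine le_trans ?_ (norm_le_pi_norm t i)
        rw [Int.norm_eq_abs]
        exact_mod_cast Int.one_le_abs hi
      rw [h1, abs_mul, abs_inv, abs_of_pos (rho_pos hBne)]
      have e1 : (rho q q (B *ᵥ fun i => (t i : ℝ)))⁻¹ ≤ K * ‖t‖ ^ (-q) := by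
        rw [← norm_intCast_pi t]
        refine le_trans ?_ (hKB _)
        rw [Real.rpow_neg hpos.le]
        exact inv_anti₀ (by positivity) (norm_rpow_le_rho _)
      have e2 : |angular q q Lplus Lminus (B *ᵥ fun i => (t i : ℝ)) + r t| ≤ C + 1 :=
        (abs_add_le _ _).trans (add_le_add (hang _) h2.le)
      have e3 : ‖t‖ ^ (-q) ≤ 2 ^ q * (1 + ‖t‖) ^ (-q) := by
        rw [Real.rpow_neg (by positivity), Real.rpow_neg (by positivity), ← div_eq_mul_inv,
          ← Real.div_rpow (by norm_num) (by positivity), ← Real.inv_rpow (by positivity)]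
        refine Real.rpow_le_rpow (by positivity) ?_ hq.le
        rw [inv_eq_one_div, div_le_div_iff₀ (by positivity) (by positivity)]
        linarith
      calc _ ≤ (K * ‖t‖ ^ (-q)) * (C + 1) := by
            have := rho_nonneg (q := q) (B *ᵥ fun i => (t i : ℝ))
            gcongr
        _ ≤ (K * (2 ^ q * (1 + ‖t‖) ^ (-q))) * (C + 1) := by gcongr
        _ = _ := by ring
    -- Only finitely many `t` violate the bound; they are absorbed by enlarging the constant.
    have hfin := Filter.eventually_cofinite.1 hev
    obtain ⟨C', hC'⟩ := (hfin.image fun t => |b t| * (1 + ‖t‖) ^ q).bddAbove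
    refine ⟨max ((C + 1) * K * 2 ^ q) C', le_max_of_le_left (by positivity), fun t => ?_⟩
    have hp : 0 < (1 + ‖t‖) ^ (-q) := by positivity
    by_cases ht : |b t| ≤ (C + 1) * K * 2 ^ q * (1 + ‖t‖) ^ (-q)
    · exact ht.trans (by gcongr; exact le_max_left _ _)
    · have := hC' ⟨t, ht, rfl⟩
      calc |b t| = |b t| * (1 + ‖t‖) ^ q * (1 + ‖t‖) ^ (-q) := by
            rw [mul_assoc, ← Real.rpow_add (by positivity), add_neg_cancel, Real.rpow_zero, mul_one]
        _ ≤ C' * (1 + ‖t‖) ^ (-q) := by gcongr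
        _ ≤ _ := by gcongr; exact le_max_right _ _
  · intro M z v hv hM hz
    have hcof := tendsto_cofinite_of_tendsto_div hv hM hz
    have hA := ha.comp_mulVec hq hb.det_ne_zero
    have hzv : Tendsto (fun l => (fun i => (z l i : ℝ) / M l)) atTop (𝓝 v) :=
      tendsto_pi_nhds.2 hz
    have h1 := (hA.continuousAt v hv).tendsto.comp hzv
    have hρ : Tendsto (fun l => (rho q q (B *ᵥ fun i => (z l i : ℝ) / M l))⁻¹) atTop
        (𝓝 (rho q q (B *ᵥ v))⁻¹) :=
      (((continuous_rho hq).comp (continuous_mulVec B)).tendsto v |>.comp hzv).inv₀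
        (rho_pos (mulVec_ne_zero hb.det_ne_zero hv)).ne'
    have h2 := h1.add (hρ.mul (hr.comp hcof))
    rw [mul_zero, add_zero] at h2
    refine h2.congr' ?_
    filter_upwards [hM.eventually_gt_atTop 0, hcof.eventually hbr] with l hl hbl
    -- Writing `z = M (z / M)`, homogeneity of `ρ` cancels `M^q`; what remains is `A(z / M)` plus
    -- `ρ⁻¹` times the vanishing error `r`.
    have e : (fun i => (z l i : ℝ)) = M l • fun i => (z l i : ℝ) / M l := by
      ext i
      simp only [Pi.smul_apply, smul_eq_mul]
      field_simp
    rw [hbl, e, Matrix.mulVec_smul, rho_smul hl, angular_smul hq hl]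
    have := (Real.rpow_pos_of_pos hl q).ne'
    simp only [Function.comp_apply, aInfty]
    field_simp

/-! ### One-dimensional power integrals -/

theorem locallyIntegrable_abs_rpow {β : ℝ} (hβ : β < 1) :
    LocallyIntegrable (fun t : ℝ => |t| ^ (-β)) := by
  refine locallyIntegrable_of_norm_le_rpow (C := 1) (α := β) (by simp) (by simpa using hβ)
    (ae_of_all _ fun t => ?_) (Measurable.aestronglyMeasurable (by fun_prop))
  rw [Real.norm_of_nonneg (by positivity), one_mul, Real.norm_eq_abs]

theorem integrableOn_abs_sub_rpow {β : ℝ} (hβ : β < 1) (x s : ℝ) :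
    IntegrableOn (fun t => |t - s| ^ (-β)) (Set.Ioc 0 x) := by
  have h := (locallyIntegrable_abs_rpow hβ).integrableOn_isCompact (isCompact_Icc (a := -s)
    (b := x - s))
  have h2 := (measurePreserving_sub_right volume s).integrableOn_comp_preimage
    (measurableEmbedding_subRight s) (f := fun t : ℝ => |t| ^ (-β)) (s := Set.Icc (-s) (x - s))
  refine (h2.2 h).mono_set fun t ht => ?_
  simp only [Set.mem_preimage, Set.mem_Icc]
  exact ⟨by linarith [ht.1], by linarith [ht.2]⟩

theorem rpow_neg_le_of_half_le {β y z : ℝ} (hβ : 0 ≤ β) (hz : 0 < z) {c : ℝ} (hc : 0 < c)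
    (h : z ≤ c * y) : y ^ (-β) ≤ c ^ β * z ^ (-β) := by
  have hy : 0 < y := by
    by_contra hy
    have : c * y ≤ 0 := mul_nonpos_of_nonneg_of_nonpos hc.le (not_lt.1 hy)
    linarith
  rw [Real.rpow_neg hy.le, Real.rpow_neg hz.le, ← div_eq_mul_inv, inv_eq_one_div,
    div_le_div_iff₀ (by positivity) (by positivity), one_mul, ← Real.mul_rpow hc.le hy.le]
  exact Real.rpow_le_rpow hz.le h hβ

/-- Smearing removes the singularity and keeps the decay. For `|s| ≤ 2x + 1` the variable `t - s`
stays in `[-R, R]`, where the power is integrable; for larger `|s|` it is comparable to `1 + |s|`.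
-/
theorem exists_setIntegral_abs_sub_rpow_le {β x : ℝ} (h0 : 0 ≤ β) (h1 : β < 1) (hx : 0 < x) :
    ∃ C : ℝ, 0 ≤ C ∧ ∀ s, ∫ t in Set.Ioc 0 x, |t - s| ^ (-β) ≤ C * (1 + |s|) ^ (-β) := by
  set R := 3 * x + 1 with hR
  set C0 := ∫ t in Set.Icc (-R) R, |t| ^ (-β) with hC0
  have hC0n : 0 ≤ C0 := integral_nonneg fun t => by positivity
  refine ⟨C0 * (2 * x + 2) ^ β + x * 4 ^ β, by positivity, fun s => ?_⟩
  have hp : 0 < (1 + |s|) ^ (-β) := by positivity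
  rcases le_or_gt |s| (2 * x + 1) with hs | hs
  · have e1 : ∫ t in Set.Ioc 0 x, |t - s| ^ (-β) ≤ C0 := by
      have e2 : ∫ t in Set.Ioc 0 x, |t - s| ^ (-β)
          ≤ ∫ t in (fun t => t - s) ⁻¹' Set.Icc (-R) R, |t - s| ^ (-β) := by
        refine setIntegral_mono_set ?_ (ae_of_all _ fun t => by positivity) ?_
        · exact ((measurePreserving_sub_right volume s).integrableOn_comp_preimage
            (measurableEmbedding_subRight s) (f := fun t : ℝ => |t| ^ (-β))).2
            ((locallyIntegrable_abs_rpow h1).integrableOn_isCompact isCompact_Icc)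
        · refine LE.le.eventuallyLE fun t (ht : t ∈ Set.Ioc 0 x) => ?_
          have := abs_le.1 hs
          simp only [Set.mem_preimage, Set.mem_Icc]
          exact ⟨by linarith [ht.1], by linarith [ht.2]⟩
      refine e2.trans (le_of_eq ?_)
      exact (measurePreserving_sub_right volume s).setIntegral_preimage_emb
        (measurableEmbedding_subRight s) (fun t : ℝ => |t| ^ (-β)) _
    have e3 : 1 ≤ (2 * x + 2) ^ β * (1 + |s|) ^ (-β) := by
      rw [Real.rpow_neg (by positivity), ← div_eq_mul_inv, one_le_div (by positivity)]
      exact Real.rpow_le_rpow (by positivity) (by linarith) h0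
    calc _ ≤ C0 * 1 := by rw [mul_one]; exact e1
      _ ≤ C0 * ((2 * x + 2) ^ β * (1 + |s|) ^ (-β)) := by gcongr
      _ ≤ _ := by
        have : 0 ≤ x * 4 ^ β * (1 + |s|) ^ (-β) := by positivity
        linarith
  · have e1 : ∫ t in Set.Ioc 0 x, |t - s| ^ (-β) ≤ ∫ t in Set.Ioc 0 x, 4 ^ β * (1 + |s|) ^ (-β) := by
      refine setIntegral_mono_on (integrableOn_abs_sub_rpow h1 x s) (integrableOn_const (by simp))
        measurableSet_Ioc fun t ht => ?_
      refine rpow_neg_le_of_half_le h0 (by positivity) (by norm_num) ?_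
      have : |s| ≤ |t - s| + |t| := by
        have := abs_sub_abs_le_abs_sub s t
        rw [abs_sub_comm] at this
        linarith
      have ht' : |t| ≤ x := by rw [abs_of_pos ht.1]; exact ht.2
      linarith
    rw [setIntegral_const] at e1
    simp only [measureReal_def, Real.volume_Ioc, sub_zero, ENNReal.toReal_ofReal hx.le,
      smul_eq_mul] at e1
    have : 0 ≤ C0 * (2 * x + 2) ^ β * (1 + |s|) ^ (-β) := by positivity
    linarith

theorem memLp_one_add_abs_rpow {β : ℝ} (hβ : 1 / 2 < β) :
    MemLp (fun s : ℝ => (1 + |s|) ^ (-β)) 2 volume := by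
  refine (memLp_two_iff_integrable_sq (Measurable.aestronglyMeasurable (by fun_prop))).2 ?_
  have := integrable_one_add_norm (E := ℝ) (μ := volume) (r := 2 * β)
    (by simp only [Module.finrank_self, Nat.cast_one]; linarith)
  refine this.congr (ae_of_all _ fun s => ?_)
  simp only [Real.norm_eq_abs]
  rw [← Real.rpow_natCast, ← Real.rpow_mul (by positivity)]
  congr 1
  push_cast
  ring

theorem memLp_indicator_abs_rpow {α : ℝ} (hα : α < 1 / 2) :
    MemLp ((Set.Icc (-1 : ℝ) 1).indicator fun s : ℝ => |s| ^ (-α)) 2 volume := by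
  rw [memLp_indicator_iff_restrict measurableSet_Icc]
  refine (memLp_two_iff_integrable_sq (Measurable.aestronglyMeasurable (by fun_prop))).2 ?_
  have := (locallyIntegrable_abs_rpow (β := 2 * α) (by linarith)).integrableOn_isCompact
    (isCompact_Icc (a := (-1 : ℝ)) (b := 1))
  refine this.congr_fun (fun s _ => ?_) measurableSet_Icc
  dsimp only
  rw [← Real.rpow_natCast, ← Real.rpow_mul (by positivity)]
  congr 1
  push_cast
  ring

theorem memLp_prod_apply {g : Fin 2 → ℝ → ℝ} (hg : ∀ k, MemLp (g k) 2 volume) :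
    MemLp (fun σ : Fin 2 → ℝ => ∏ k, g k (σ k)) 2 volume := by
  have hm : AEStronglyMeasurable (fun σ : Fin 2 → ℝ => ∏ k, g k (σ k)) volume := by
    refine Finset.aestronglyMeasurable_fun_prod _ fun k _ => ?_
    exact (hg k).aestronglyMeasurable.comp_quasiMeasurePreserving
      (Measure.quasiMeasurePreserving_eval _ k)
  refine (memLp_two_iff_integrable_sq hm).2 ?_
  have := Integrable.fintype_prod (μ := fun _ : Fin 2 => (volume : Measure ℝ))
    (f := fun k s => g k s ^ 2) fun k => (hg k).integrable_sq
  simp only [Finset.prod_pow] at this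
  exact this

/-! ### Square integrable domination of smeared power kernels -/

/-- The sup norm dominates every coordinate, so the exponent `q` can be distributed over the
coordinates at will; this freedom produces all the majorants. Coordinates must be nonzero because
`0` to a nonzero negative power is `0` by convention. -/
theorem norm_rpow_neg_le_prod {q : ℝ} {α : Fin 2 → ℝ} (hα : ∀ k, 0 ≤ α k) (hq : ∑ k, α k = q)
    {v : Fin 2 → ℝ} (hv : ∀ k, v k ≠ 0) : ‖v‖ ^ (-q) ≤ ∏ k, |v k| ^ (-α k) := by
  have hpos : 0 < ‖v‖ := (abs_pos.2 (hv 0)).trans_le (norm_le_pi_norm v 0)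
  have : ‖v‖ ^ (-q) = ∏ k, ‖v‖ ^ (-α k) := by
    rw [← Real.rpow_sum_of_pos hpos, Finset.sum_neg_distrib, hq]
  rw [this]
  refine Finset.prod_le_prod (fun k _ => by positivity) fun k _ => ?_
  exact Real.rpow_le_rpow_of_nonpos (abs_pos.2 (hv k)) (norm_le_pi_norm v k) (by
    linarith [hα k])

theorem ae_apply_ne (k : Fin 2) (c : ℝ) : ∀ᵐ t : Fin 2 → ℝ, t k ≠ c :=
  (Measure.quasiMeasurePreserving_eval (fun _ : Fin 2 => (volume : Measure ℝ)) k).ae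
    (Measure.ae_ne volume c)

theorem ae_mul_apply_ne (k : Fin 2) {m c : ℝ} (h : m ≠ 0 ∨ c ≠ 0) :
    ∀ᵐ t : Fin 2 → ℝ, m * t k ≠ c := by
  rcases eq_or_ne m 0 with rfl | hm
  · rcases h with h | h
    · exact absurd rfl h
    · exact ae_of_all _ fun t => by simpa using h.symm
  · filter_upwards [ae_apply_ne k (c / m)] with t ht h
    exact ht (by rw [← h]; field_simp)

/-- Fubini after splitting the exponent. The hypothesis `hne` makes the exceptional set `m k * t k =
σ k` null, also when `m k = 0`. -/
theorem integrableOn_norm_rpow_and_le {q : ℝ} {m x σ α : Fin 2 → ℝ} (hα : ∀ k, 0 ≤ α k)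
    (hq : ∑ k, α k = q) (hne : ∀ k, m k ≠ 0 ∨ σ k ≠ 0)
    (hint : ∀ k, IntegrableOn (fun t => |m k * t - σ k| ^ (-α k)) (Set.Ioc 0 (x k))) :
    IntegrableOn (fun t => ‖m * t - σ‖ ^ (-q)) (box x) ∧
      ∫ t in box x, ‖m * t - σ‖ ^ (-q)
        ≤ ∏ k, ∫ t in Set.Ioc 0 (x k), |m k * t - σ k| ^ (-α k) := by
  have hres : (volume : Measure (Fin 2 → ℝ)).restrict (box x)
      = Measure.pi fun k => (volume : Measure ℝ).restrict (Set.Ioc 0 (x k)) :=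
    Measure.restrict_pi_pi _ _
  have hI : Integrable (fun t : Fin 2 → ℝ => ∏ k, |m k * t k - σ k| ^ (-α k))
      (volume.restrict (box x)) := by
    rw [hres]
    exact Integrable.fintype_prod (f := fun k (t : ℝ) => |m k * t - σ k| ^ (-α k)) hint
  have hle : ∀ᵐ t : Fin 2 → ℝ ∂volume.restrict (box x),
      ‖m * t - σ‖ ^ (-q) ≤ ∏ k, |m k * t k - σ k| ^ (-α k) := by
    refine ae_restrict_of_ae ?_
    filter_upwards [ae_mul_apply_ne 0 (hne 0), ae_mul_apply_ne 1 (hne 1)] with t h0 h1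
    refine norm_rpow_neg_le_prod hα hq fun k => ?_
    fin_cases k
    · exact sub_ne_zero.2 h0
    · exact sub_ne_zero.2 h1
  have hI2 : IntegrableOn (fun t => ‖m * t - σ‖ ^ (-q)) (box x) := by
    refine hI.mono' (Measurable.aestronglyMeasurable (by fun_prop)) ?_
    filter_upwards [hle] with t ht
    rwa [Real.norm_of_nonneg (by positivity)]
  refine ⟨hI2, (integral_mono_ae hI2 hI hle).trans (le_of_eq ?_)⟩
  rw [hres]
  exact integral_fintype_prod_eq_prod (fun k (t : ℝ) => |m k * t - σ k| ^ (-α k))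

/-- The smeared power kernels `∫_{(0,x]} ‖mt - σ‖^{-q} dt` are dominated in `L²(dσ)`. -/
def SmearedDomination (q : ℝ) (m x : Fin 2 → ℝ) : Prop :=
  ∃ G : (Fin 2 → ℝ) → ℝ, MemLp G 2 volume ∧ ∀ᵐ σ : Fin 2 → ℝ,
    IntegrableOn (fun t => ‖m * t - σ‖ ^ (-q)) (box x) ∧
      ∫ t in box x, ‖m * t - σ‖ ^ (-q) ≤ G σ

/-- The even split `q/2` lies in `(1/2, 1)`: below `1` for local integrability, above `1/2` for
square integrability of the tail. -/
theorem smearedDomination_one {q : ℝ} (h1 : 1 < q) (h2 : q < 2) {x : Fin 2 → ℝ}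
    (hx : ∀ i, 0 < x i) : SmearedDomination q 1 x := by
  choose C hC hCb using fun k => exists_setIntegral_abs_sub_rpow_le (β := q / 2) (by linarith)
    (by linarith) (hx k)
  refine ⟨fun σ => ∏ k, (C k * (1 + |σ k|) ^ (-(q / 2))),
    memLp_prod_apply (g := fun k s => C k * (1 + |s|) ^ (-(q / 2)))
      fun k => (memLp_one_add_abs_rpow (by linarith)).const_mul _, ae_of_all _ fun σ => ?_⟩
  have := integrableOn_norm_rpow_and_le (q := q) (m := 1) (x := x) (σ := σ) (α := fun _ => q / 2)
    (fun _ => by linarith) (by rw [Fin.sum_univ_two]; ring) (fun _ => by simp)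
    (fun k => by simpa using integrableOn_abs_sub_rpow (by linarith) (x k) (σ k))
  refine ⟨this.1, this.2.trans (Finset.prod_le_prod (fun k _ => integral_nonneg fun t => by
    positivity) fun k _ => ?_)⟩
  simpa using hCb k (σ k)

/-- Nothing is smeared in direction `i`, so the factor `|σᵢ|^{-a}` itself must be square integrable:
`a < 1/2` near zero, `a > 1/2` at infinity. For `|σᵢ| ≤ 1` the split `(α, β)` works, since `q < 3/2`
gives both `α < 1/2` and `β < 1`; beyond, the even split does. The majorant is the sum of the two.
-/
theorem smearedDomination_degenerate {q : ℝ} (h1 : 1 < q) (h2 : q < 3 / 2) {m x : Fin 2 → ℝ}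
    (hx : ∀ i, 0 < x i) {i : Fin 2} (hi : m i = 0) (hm : ∀ k, k ≠ i → m k = 1) :
    SmearedDomination q m x := by
  -- exponents used near the line `σ i = 0`
  set α := q / 2 - 1 / 4 with hα
  set β := q / 2 + 1 / 4 with hβ
  have key : ∀ a b : ℝ, 0 ≤ a → 0 ≤ b → b < 1 → a + b = q →
      ∃ C : Fin 2 → ℝ, (∀ k, 0 ≤ C k) ∧ ∀ σ : Fin 2 → ℝ, σ i ≠ 0 →
        IntegrableOn (fun t => ‖m * t - σ‖ ^ (-q)) (box x) ∧
        ∫ t in box x, ‖m * t - σ‖ ^ (-q) ≤ ∏ k, if k = i then C k * |σ k| ^ (-a)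
          else C k * (1 + |σ k|) ^ (-b) := by
    intro a b ha hb hb1 hab
    choose C hC hCb using fun k => exists_setIntegral_abs_sub_rpow_le hb hb1 (hx k)
    refine ⟨fun k => if k = i then x k else C k, fun k => ?_, fun σ hσ => ?_⟩
    · dsimp only
      split_ifs
      · exact (hx k).le
      · exact hC k
    have := integrableOn_norm_rpow_and_le (q := q) (m := m) (x := x) (σ := σ)
      (α := fun k => if k = i then a else b) (fun k => by split_ifs <;> assumption)
      (by fin_cases i <;> simp [Fin.sum_univ_two, ← hab, add_comm])
      (fun k => by
        by_cases h : k = i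
        · subst h; exact Or.inr hσ
        · left; rw [hm k h]; norm_num)
      (fun k => by
        by_cases h : k = i
        · subst h
          simp [hi]
        · simp only [h, hm k h, if_false, one_mul]
          exact integrableOn_abs_sub_rpow hb1 (x k) (σ k))
    refine ⟨this.1, this.2.trans (Finset.prod_le_prod (fun k _ => integral_nonneg fun t => by
      positivity) fun k _ => ?_)⟩
    by_cases h : k = i
    · subst h
      simp [hi, (hx k).le, measureReal_def]
    · simp only [h, hm k h, if_false, one_mul]
      exact hCb k (σ k)
  obtain ⟨C, hC, hC'⟩ := key α β (by linarith) (by linarith) (by linarith) (by ring)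
  obtain ⟨D, hD, hD'⟩ := key (q / 2) (q / 2) (by linarith) (by linarith) (by linarith) (by ring)
  let g1 : Fin 2 → ℝ → ℝ := fun k => if k = i
    then fun s => C k * (Set.Icc (-1 : ℝ) 1).indicator (fun s : ℝ => |s| ^ (-α)) s
    else fun s => C k * (1 + |s|) ^ (-β)
  let g2 : Fin 2 → ℝ → ℝ := fun k => if k = i
    then fun s => D k * (2 ^ (q / 2) * (1 + |s|) ^ (-(q / 2)))
    else fun s => D k * (1 + |s|) ^ (-(q / 2))
  have m1 : ∀ k, MemLp (g1 k) 2 volume := by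
    intro k
    by_cases h : k = i
    · simp only [g1, h, if_true]
      exact (memLp_indicator_abs_rpow (by linarith)).const_mul _
    · simp only [g1, h, if_false]
      exact (memLp_one_add_abs_rpow (by linarith)).const_mul _
  have m2 : ∀ k, MemLp (g2 k) 2 volume := by
    intro k
    by_cases h : k = i
    · simp only [g2, h, if_true]
      exact ((memLp_one_add_abs_rpow (by linarith)).const_mul _).const_mul _
    · simp only [g2, h, if_false]
      exact (memLp_one_add_abs_rpow (by linarith)).const_mul _
  have p1 : ∀ k s, 0 ≤ g1 k s := by
    intro k s
    by_cases h : k = i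
    · simp only [g1, h, if_true]
      exact mul_nonneg (hC _) (Set.indicator_nonneg (fun _ _ => by positivity) _)
    · simp only [g1, h, if_false]
      exact mul_nonneg (hC _) (by positivity)
  have p2 : ∀ k s, 0 ≤ g2 k s := by
    intro k s
    have := hD k
    by_cases h : k = i
    · simp only [g2, h, if_true]
      rw [← h]; positivity
    · simp only [g2, h, if_false]
      positivity
  refine ⟨fun σ => ∏ k, g1 k (σ k) + ∏ k, g2 k (σ k),
    (memLp_prod_apply m1).add (memLp_prod_apply m2), ?_⟩
  filter_upwards [ae_apply_ne i 0] with σ hσ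
  refine ⟨(hC' σ hσ).1, ?_⟩
  rcases le_or_gt |σ i| 1 with h | h
  · refine (hC' σ hσ).2.trans (le_trans (le_of_eq ?_)
      (le_add_of_nonneg_right (Finset.prod_nonneg fun k _ => p2 k _)))
    refine Finset.prod_congr rfl fun k _ => ?_
    by_cases hk : k = i
    · simp only [g1, hk, if_true]
      rw [Set.indicator_of_mem (by rwa [Set.mem_Icc, ← abs_le])]
    · simp only [g1, hk, if_false]
  · refine (hD' σ hσ).2.trans (le_trans ?_
      (le_add_of_nonneg_left (Finset.prod_nonneg fun k _ => p1 k _)))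
    refine Finset.prod_le_prod (fun k _ => ?_) fun k _ => ?_
    · have := hD k
      split_ifs <;> positivity
    · by_cases hk : k = i
      · simp only [g2, hk, if_true]
        refine mul_le_mul_of_nonneg_left ?_ (hD i)
        exact rpow_neg_le_of_half_le (by linarith) (by positivity) (by norm_num) (by linarith)
      · simp only [g2, hk, if_false]
        exact le_rfl

/-! ### Dominated convergence in `L²` -/

theorem memLp_and_tendsto_eLpNorm_of_dominated {f : ℝ → (Fin 2 → ℝ) → ℝ} {h G : (Fin 2 → ℝ) → ℝ}
    (hf : ∀ l, AEStronglyMeasurable (f l) volume) (hG : MemLp G 2 volume)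
    (hb : ∀ᶠ l in atTop, ∀ᵐ σ, |f l σ| ≤ G σ)
    (hlim : ∀ᵐ σ, Tendsto (fun l => f l σ) atTop (𝓝 (h σ))) :
    MemLp h 2 volume ∧ Tendsto (fun l => eLpNorm (fun σ => f l σ - h σ) 2 volume) atTop (𝓝 0) := by
  have hm : AEStronglyMeasurable h volume := aestronglyMeasurable_of_tendsto_ae atTop hf hlim
  have hhG : ∀ᵐ σ, |h σ| ≤ G σ := by
    -- The bound holds off a null set depending on `l`, and only countably many such sets may be
    -- discarded; hence the passage to a sequence.
    obtain ⟨u, hu⟩ := exists_seq_tendsto (atTop : Filter ℝ)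
    have hb' := hu.eventually hb
    obtain ⟨N, hN⟩ := eventually_atTop.1 hb'
    have hall : ∀ᵐ σ, ∀ n, |f (u (n + N)) σ| ≤ G σ :=
      ae_all_iff.2 fun n => hN _ (Nat.le_add_left _ _)
    filter_upwards [hall, hlim] with σ h1 h2
    have h3 := (h2.comp hu).comp (tendsto_add_atTop_nat N)
    exact le_of_tendsto h3.abs (Eventually.of_forall h1)
  refine ⟨hG.mono' hm hhG, ?_⟩
  have key : Tendsto (fun l => ∫⁻ σ, ‖f l σ - h σ‖ₑ ^ (2 : ℝ)) atTop (𝓝 (∫⁻ _ : Fin 2 → ℝ, 0)) := by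
    refine tendsto_lintegral_filter_of_dominated_convergence'
      (fun σ => (2 * ‖G σ‖ₑ) ^ (2 : ℝ)) ?_ ?_ ?_ ?_
    · exact Eventually.of_forall fun l => ((hf l).sub hm).enorm.pow_const _
    · filter_upwards [hb] with l hl
      filter_upwards [hl, hhG] with σ h1 h2
      gcongr
      calc ‖f l σ - h σ‖ₑ ≤ ‖f l σ‖ₑ + ‖h σ‖ₑ := enorm_sub_le
        _ ≤ ‖G σ‖ₑ + ‖G σ‖ₑ := by
          gcongr
          · rw [enorm_le_iff_norm_le]; exact h1.trans (le_abs_self _)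
          · rw [enorm_le_iff_norm_le]; exact h2.trans (le_abs_self _)
        _ = _ := (two_mul _).symm
    · have := lintegral_rpow_enorm_lt_top_of_eLpNorm_lt_top (by simp) (by simp)
        (hG.const_mul 2).eLpNorm_lt_top
      simp only [ENNReal.toReal_ofNat, enorm_mul] at this
      refine ne_of_lt (lt_of_eq_of_lt ?_ this)
      congr with σ
      congr 2
      simp [← ofReal_norm]
    · filter_upwards [hlim] with σ hσ
      have : Tendsto (fun l => ‖f l σ - h σ‖ₑ) atTop (𝓝 0) := by
        have := (hσ.sub_const (h σ)).enorm
        simpa using this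
      have := this.ennrpow_const 2
      simpa using this
  rw [lintegral_zero] at key
  have := key.ennrpow_const (1 / 2)
  rw [ENNReal.zero_rpow_of_pos (by norm_num)] at this
  refine this.congr fun l => ?_
  rw [eLpNorm_eq_lintegral_rpow_enorm_toReal (by simp) (by simp)]
  simp

theorem tendsto_ceil_mul_div {M : ℝ → ℝ} (hM : Tendsto M atTop atTop) (a : ℝ) :
    Tendsto (fun l => (⌈M l * a⌉ : ℝ) / M l) atTop (𝓝 a) := by
  have h2 : Tendsto (fun l => a + (M l)⁻¹) atTop (𝓝 (a + 0)) :=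
    tendsto_const_nhds.add hM.inv_tendsto_atTop
  rw [add_zero] at h2
  refine tendsto_of_tendsto_of_tendsto_of_le_of_le' tendsto_const_nhds h2 ?_ ?_
  · filter_upwards [hM.eventually_gt_atTop 0] with l hl
    rw [le_div_iff₀ hl, mul_comm]
    exact Int.le_ceil _
  · filter_upwards [hM.eventually_gt_atTop 0] with l hl
    rw [div_le_iff₀ hl, add_mul, inv_mul_cancel₀ hl.ne', mul_comm a]
    exact (Int.ceil_lt_add_one _).le

theorem tendsto_floor_mul_div {M : ℝ → ℝ} (hM : Tendsto M atTop atTop) (a : ℝ) :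
    Tendsto (fun l => (⌊M l * a⌋ : ℝ) / M l) atTop (𝓝 a) := by
  have := (tendsto_ceil_mul_div hM (-a)).neg
  rw [neg_neg] at this
  refine this.congr fun l => ?_
  rw [mul_neg, Int.ceil_neg]
  push_cast
  ring

/-! ### Smeared homogeneous kernels -/

/-- The kernel `σ ↦ ∫_{(0,x]} A(mt - σ) dt`, where `mt` is the coordinatewise product. -/
def smearedKernel (A : (Fin 2 → ℝ) → ℝ) (m x σ : Fin 2 → ℝ) : ℝ := ∫ t in box x, A (m * t - σ)

/-- The sums `∑_{t ∈ (0,N]} b(t - s)`. -/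
def boxSum (b : (Fin 2 → ℤ) → ℝ) (N s : Fin 2 → ℤ) : ℝ := ∑ t ∈ latticeBox N, b (t - s)

section Smeared

variable {q : ℝ} {A : (Fin 2 → ℝ) → ℝ} {m x : Fin 2 → ℝ}

theorem HomogeneousKernel.ae_integrableOn_smeared (hA : HomogeneousKernel q A)
    (hdom : SmearedDomination q m x) :
    ∀ᵐ σ : Fin 2 → ℝ, IntegrableOn (fun t => A (m * t - σ)) (box x) := by
  obtain ⟨G, -, hG⟩ := hdom
  obtain ⟨C, hC, hCb⟩ := hA.bound
  filter_upwards [hG] with σ hσ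
  refine (hσ.1.const_mul C).mono' ?_ (ae_of_all _ fun t => hCb _)
  exact (hA.measurable.comp (by fun_prop)).aestronglyMeasurable

theorem HomogeneousKernel.aestronglyMeasurable_smearedKernel (hA : HomogeneousKernel q A) :
    AEStronglyMeasurable (smearedKernel A m x) volume := by
  have h1 : StronglyMeasurable fun p : (Fin 2 → ℝ) × (Fin 2 → ℝ) => A (m * p.2 - p.1) :=
    (hA.measurable.comp (by fun_prop)).stronglyMeasurable
  exact (h1.integral_prod_right (ν := volume.restrict (box x))).aestronglyMeasurable

theorem HomogeneousKernel.memLp_smearedKernel (hA : HomogeneousKernel q A)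
    (hdom : SmearedDomination q m x) : MemLp (smearedKernel A m x) 2 volume := by
  obtain ⟨G, hG, hGb⟩ := hdom
  obtain ⟨C, hC, hCb⟩ := hA.bound
  refine (hG.const_mul C).mono' hA.aestronglyMeasurable_smearedKernel ?_
  filter_upwards [hGb] with σ hσ
  calc ‖smearedKernel A m x σ‖ ≤ ∫ t in box x, C * ‖m * t - σ‖ ^ (-q) :=
        norm_integral_le_of_norm_le (hσ.1.const_mul C) (ae_of_all _ fun t => hCb _)
    _ = C * ∫ t in box x, ‖m * t - σ‖ ^ (-q) := integral_const_mul _ _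
    _ ≤ C * G σ := mul_le_mul_of_nonneg_left hσ.2 hC

theorem ae_mul_sub_ne_zero (hm : ∃ k, m k ≠ 0) (σ : Fin 2 → ℝ) :
    ∀ᵐ t : Fin 2 → ℝ, m * t - σ ≠ 0 := by
  obtain ⟨k, hk⟩ := hm
  filter_upwards [ae_mul_apply_ne k (c := σ k) (Or.inl hk)] with t ht h
  exact ht (by simpa [sub_eq_zero] using congrFun h k)

theorem ae_mem_box_iff_tendsto {x' : ℝ → Fin 2 → ℝ}
    (hx' : ∀ k, Tendsto (fun l => x' l k) atTop (𝓝 (x k))) :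
    ∀ᵐ t : Fin 2 → ℝ, ∀ᶠ l in atTop, (t ∈ box (x' l) ↔ t ∈ box x) := by
  filter_upwards [ae_apply_ne 0 (x 0), ae_apply_ne 1 (x 1)] with t h0 h1
  have hk : ∀ k : Fin 2, ∀ᶠ l in atTop, ((0 < t k ∧ t k ≤ x' l k) ↔ (0 < t k ∧ t k ≤ x k)) := by
    intro k
    have hne : t k ≠ x k := by fin_cases k <;> assumption
    rcases lt_or_gt_of_ne hne with h | h
    · filter_upwards [(hx' k).eventually_const_lt h] with l hl
      simp [hl.le, h.le]
    · filter_upwards [(hx' k).eventually_lt_const h] with l hl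
      simp [not_le.2 hl, not_le.2 h]
  filter_upwards [hk 0, hk 1] with l h0 h1
  rw [mem_box, mem_box]
  refine forall_congr' fun k => ?_
  fin_cases k <;> assumption

theorem rpow_mul_one_add_rpow_le {M r y : ℝ} (hq : 0 ≤ q) (hM : 0 < M) (hr : 0 < r)
    (h : M * r ≤ 1 + y) : M ^ q * (1 + y) ^ (-q) ≤ r ^ (-q) := by
  have h1 := rpow_neg_le_of_half_le hq (mul_pos hM hr) one_pos (h.trans_eq (one_mul _).symm)
  rw [Real.one_rpow, one_mul, Real.mul_rpow hM.le hr.le] at h1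
  calc M ^ q * (1 + y) ^ (-q) ≤ M ^ q * (M ^ (-q) * r ^ (-q)) := by gcongr
    _ = r ^ (-q) := by
      rw [← mul_assoc, ← Real.rpow_add hM, add_neg_cancel, Real.rpow_zero, one_mul]

/-- Dominated convergence is used twice: in `t` for fixed `σ`, with majorant `C‖mt - σ‖^{-q}`, and
then in `L²(dσ)` with the smeared majorant. The boxes `x' ≤ x` absorb the rounding of the rectangle.
-/
theorem LatticeApprox.tendsto_smeared {b : (Fin 2 → ℤ) → ℝ} (hb : LatticeApprox q A b)
    (hq : 0 < q) (hm : ∃ k, m k ≠ 0) (hdom : SmearedDomination q m x)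
    {M : ℝ → ℝ} (hM : Tendsto M atTop atTop) {x' : ℝ → Fin 2 → ℝ}
    (hx'x : ∀ᶠ l in atTop, ∀ k, x' l k ≤ x k)
    (hx' : ∀ k, Tendsto (fun l => x' l k) atTop (𝓝 (x k))) :
    Tendsto (fun l => eLpNorm (fun σ => (∫ t in box (x' l), M l ^ q *
      b (ceilMap (fun k => M l * m k) t - ceilMap (fun _ => M l) σ)) - smearedKernel A m x σ)
        2 volume) atTop (𝓝 0) := by
  obtain ⟨G, hG, hGb⟩ := hdom
  obtain ⟨C, hC, hCb⟩ := hb.bound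
  have hmeas : ∀ l, Measurable fun p : (Fin 2 → ℝ) × (Fin 2 → ℝ) => M l ^ q *
      b (ceilMap (fun k => M l * m k) p.2 - ceilMap (fun _ => M l) p.1) := fun l => by
    refine Measurable.const_mul ((measurable_of_countable b).comp ?_) _
    exact ((measurable_ceilMap _).comp measurable_snd).sub
      ((measurable_ceilMap _).comp measurable_fst)
  have hbound : ∀ l, 0 < M l → ∀ σ t : Fin 2 → ℝ, m * t - σ ≠ 0 →
      |M l ^ q * b (ceilMap (fun k => M l * m k) t - ceilMap (fun _ => M l) σ)|
        ≤ C * ‖m * t - σ‖ ^ (-q) := by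
    intro l hl σ t ht
    have hz := norm_le_one_add_norm_ceilMap_sub (fun k => M l * m k) (fun _ => M l) t σ
    have e : (fun i => M l * m i * t i - M l * σ i) = M l • (m * t - σ) := by
      ext i; simp; ring
    rw [e, norm_smul, Real.norm_of_nonneg hl.le] at hz
    rw [abs_mul, abs_of_nonneg (by positivity)]
    calc _ ≤ M l ^ q * (C * (1 + ‖ceilMap (fun k => M l * m k) t - ceilMap (fun _ => M l) σ‖)
          ^ (-q)) := by
          gcongr
          exact hCb _
      _ = C * (M l ^ q * (1 + ‖ceilMap (fun k => M l * m k) t - ceilMap (fun _ => M l) σ‖)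
          ^ (-q)) := by ring
      _ ≤ _ := by
        gcongr
        exact rpow_mul_one_add_rpow_le hq.le hl (norm_pos_iff.2 ht) hz
  refine (memLp_and_tendsto_eLpNorm_of_dominated (G := fun σ => C * G σ) ?_ (hG.const_mul C) ?_
    ?_).2
  · intro l
    exact ((hmeas l).stronglyMeasurable.integral_prod_right
      (ν := volume.restrict (box (x' l)))).aestronglyMeasurable
  · filter_upwards [hM.eventually_gt_atTop 0, hx'x] with l hl hxl
    have hsub : box (x' l) ⊆ box x := fun t ht => mem_box.2 fun k =>
      ⟨(mem_box.1 ht k).1, (mem_box.1 ht k).2.trans (hxl k)⟩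
    filter_upwards [hGb] with σ hσ
    have hint : IntegrableOn (fun t => C * ‖m * t - σ‖ ^ (-q)) (box x) := hσ.1.const_mul C
    rw [← Real.norm_eq_abs]
    calc _ ≤ ∫ t in box (x' l), C * ‖m * t - σ‖ ^ (-q) := by
          refine norm_integral_le_of_norm_le (hint.mono_set hsub) (ae_restrict_of_ae ?_)
          filter_upwards [ae_mul_sub_ne_zero hm σ] with t ht
          exact hbound l hl σ t ht
      _ ≤ ∫ t in box x, C * ‖m * t - σ‖ ^ (-q) :=
          setIntegral_mono_set hint (ae_of_all _ fun t => by positivity)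
            (LE.le.eventuallyLE hsub)
      _ = C * ∫ t in box x, ‖m * t - σ‖ ^ (-q) := integral_const_mul _ _
      _ ≤ C * G σ := mul_le_mul_of_nonneg_left hσ.2 hC
  · filter_upwards [hGb] with σ hσ
    have hint : IntegrableOn (fun t => C * ‖m * t - σ‖ ^ (-q)) (box x) := hσ.1.const_mul C
    have : Tendsto (fun l => ∫ t in box x, (box (x' l)).indicator (fun t => M l ^ q *
        b (ceilMap (fun k => M l * m k) t - ceilMap (fun _ => M l) σ)) t) atTop
          (𝓝 (smearedKernel A m x σ)) := by
      refine tendsto_integral_filter_of_dominated_convergence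
        (fun t => C * ‖m * t - σ‖ ^ (-q)) ?_ ?_ hint ?_
      · refine Eventually.of_forall fun l => Measurable.aestronglyMeasurable ?_
        exact ((hmeas l).comp (measurable_const.prodMk measurable_id)).indicator
          (measurableSet_box _)
      · filter_upwards [hM.eventually_gt_atTop 0] with l hl
        refine ae_restrict_of_ae ?_
        filter_upwards [ae_mul_sub_ne_zero hm σ] with t ht
        refine (norm_indicator_le_norm_self _ _).trans ?_
        exact hbound l hl σ t ht
      · rw [ae_restrict_iff' (measurableSet_box x)]
        filter_upwards [ae_mem_box_iff_tendsto hx', ae_mul_sub_ne_zero hm σ] with t h1 h2 htx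
        have hlim := hb.tendsto M
          (fun l => ceilMap (fun k => M l * m k) t - ceilMap (fun _ => M l) σ) (m * t - σ) h2 hM
          (fun i => by
            have := (tendsto_ceil_mul_div hM (m i * t i)).sub (tendsto_ceil_mul_div hM (σ i))
            refine this.congr fun l => ?_
            simp only [ceilMap, Pi.sub_apply]
            push_cast
            rw [mul_assoc, sub_div])
        refine hlim.congr' ?_
        filter_upwards [h1] with l hl
        rw [Set.indicator_of_mem (hl.2 htx)]
    refine this.congr' ?_
    filter_upwards [hx'x] with l hxl
    have hsub : box (x' l) ⊆ box x := fun t ht => mem_box.2 fun k =>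
      ⟨(mem_box.1 ht k).1, (mem_box.1 ht k).2.trans (hxl k)⟩
    rw [setIntegral_indicator (measurableSet_box _), Set.inter_eq_right.2 hsub]

/-- Isotropic scaling of the partial sums. -/
theorem LatticeApprox.tendsto_boxSum_isotropic {b : (Fin 2 → ℤ) → ℝ} (hb : LatticeApprox q A b)
    (h1 : 1 < q) (h2 : q < 2) (hx : ∀ i, 0 < x i)
    {M : ℝ → ℝ} (hM : Tendsto M atTop atTop) :
    Tendsto (fun l => eLpNorm (fun σ => M l ^ (q - 2) *
      boxSum b (fun k => ⌊M l * x k⌋) (ceilMap (fun _ => M l) σ) - smearedKernel A 1 x σ)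
        2 volume) atTop (𝓝 0) := by
  have := hb.tendsto_smeared (by linarith) (m := 1) ⟨0, by simp⟩ (smearedDomination_one h1 h2 hx)
    hM (x' := fun l k => ⌊M l * x k⌋ / M l) ?_ fun k => tendsto_floor_mul_div hM (x k)
  · refine this.congr' ?_
    filter_upwards [hM.eventually_gt_atTop 0] with l hl
    congr with σ
    congr 1
    -- The sum is `M²` times an integral over cells, which turns the prefactor `M^{q-2}` into the
    -- `M^q` demanded by homogeneity.
    have e := sum_eq_setIntegral_ceilMap (n := fun _ => M l) (fun _ => hl)
      (latticeBox fun k => ⌊M l * x k⌋) (fun t => b (t - ceilMap (fun _ => M l) σ))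
    rw [ceilMap_preimage_latticeBox fun _ => hl] at e
    rw [boxSum, e, integral_const_mul, ← mul_assoc]
    simp only [Pi.one_apply, mul_one]
    congr 1
    rw [Real.rpow_sub hl, Real.rpow_two]
    field_simp
  · filter_upwards [hM.eventually_gt_atTop 0] with l hl k
    rw [div_le_iff₀ hl, mul_comm]
    exact Int.floor_le _

end Smeared

/-! ### Averages of translates -/

theorem tendsto_eLpNorm_translate {h : (Fin 2 → ℝ) → ℝ} (hh : MemLp h 2 volume) :
    Tendsto (fun v : Fin 2 → ℝ => eLpNorm (fun σ => h (σ - v) - h σ) 2 volume) (𝓝 0) (𝓝 0) := by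
  have : Fact ((2 : ENNReal) ≠ ⊤) := ⟨by simp⟩
  have hc : Continuous fun v : Fin 2 → ℝ => DomAddAct.mk (-v) +ᵥ hh.toLp h := by
    have h1 : Continuous fun v : Fin 2 → ℝ => DomAddAct.mk (-v) := by
      exact DomAddAct.mkHomeomorph.continuous.comp continuous_neg
    exact h1.vadd continuous_const
  have h0 := hc.tendsto 0
  have e0 : DomAddAct.mk (-(0 : Fin 2 → ℝ)) +ᵥ hh.toLp h = hh.toLp h := by
    rw [neg_zero]
    exact zero_vadd _ _
  rw [e0, Lp.tendsto_Lp_iff_tendsto_eLpNorm _ h hh] at h0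
  refine h0.congr fun v => eLpNorm_congr_ae ?_
  have h2 : (DomAddAct.mk (-v) +ᵥ hh.toLp h : Lp ℝ 2 volume) =ᵐ[volume] fun σ => h (-v +ᵥ σ) := by
    rw [DomAddAct.mk_vadd_toLp]
    exact MemLp.coeFn_toLp _
  filter_upwards [h2] with σ hσ
  rw [Pi.sub_apply, hσ, vadd_eq_add, neg_add_eq_sub]

/-- Averages over vanishing translations do not affect an `L²` limit: the error splits into `F - h`
translated, `h` translated minus `h` (continuity of translations), and the defect `w |K| - 1` of the
weights. -/
theorem tendsto_eLpNorm_average {F : ℝ → (Fin 2 → ℝ) → ℝ} {h : (Fin 2 → ℝ) → ℝ}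
    (hF : ∀ l, AEStronglyMeasurable (F l) volume) (hh : MemLp h 2 volume)
    (hFh : Tendsto (fun l => eLpNorm (fun σ => F l σ - h σ) 2 volume) atTop (𝓝 0))
    {K : ℝ → Finset ℤ} {v : ℝ → ℤ → Fin 2 → ℝ} {w : ℝ → ℝ} (hw : ∀ᶠ l in atTop, 0 ≤ w l)
    (hwK : Tendsto (fun l => w l * (K l).card) atTop (𝓝 1))
    (hv : ∀ η > 0, ∀ᶠ l in atTop, ∀ k ∈ K l, ‖v l k‖ ≤ η) :
    Tendsto (fun l => eLpNorm (fun σ => w l * ∑ k ∈ K l, F l (σ - v l k) - h σ) 2 volume) atTop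
      (𝓝 0) := by
  have hmp : ∀ u : Fin 2 → ℝ, MeasurePreserving (fun σ : Fin 2 → ℝ => σ - u) volume volume :=
    fun u => measurePreserving_sub_right volume u
  have hFT : ∀ l u, AEStronglyMeasurable (fun σ => F l (σ - u)) volume := fun l u =>
    (hF l).comp_measurePreserving (hmp u)
  have hhT : ∀ u, AEStronglyMeasurable (fun σ => h (σ - u)) volume := fun u =>
    hh.aestronglyMeasurable.comp_measurePreserving (hmp u)
  have hlast : Tendsto (fun l => ‖w l * (K l).card - 1‖ₑ * eLpNorm h 2 volume) atTop (𝓝 0) := by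
    have : Tendsto (fun l => ‖w l * (K l).card - 1‖ₑ) atTop (𝓝 0) := by
      have := (hwK.sub_const 1).enorm
      simpa using this
    have := ENNReal.Tendsto.mul_const this (Or.inr hh.eLpNorm_ne_top)
    simpa using this
  rw [ENNReal.tendsto_nhds_zero]
  intro η hη
  rcases eq_or_ne η ⊤ with rfl | hηt
  · simp
  -- The total weight is eventually below `2`, so the errors add up to `2 (η/5 + η/5) + η/5 = η`.
  have hη5 : 0 < η / 5 := ENNReal.div_pos hη.ne' (by simp)
  obtain ⟨δ, hδ, hδt⟩ := Metric.eventually_nhds_iff.1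
    ((ENNReal.tendsto_nhds_zero.1 (tendsto_eLpNorm_translate hh)) (η / 5) hη5)
  filter_upwards [hw, hv (δ / 2) (by positivity), ENNReal.tendsto_nhds_zero.1 hFh (η / 5) hη5,
    ENNReal.tendsto_nhds_zero.1 hlast (η / 5) hη5,
    hwK.eventually_lt_const (show (1 : ℝ) < 2 by norm_num)] with l hwl hvl hFl hll hKl
  have hdec : (fun σ => w l * ∑ k ∈ K l, F l (σ - v l k) - h σ)
      = w l • (∑ k ∈ K l, ((fun σ => F l (σ - v l k) - h (σ - v l k))
          + fun σ => h (σ - v l k) - h σ)) + (w l * (K l).card - 1) • h := by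
    ext σ
    simp only [Pi.add_apply, Pi.smul_apply, Finset.sum_apply, smul_eq_mul, sub_add_sub_cancel,
      Finset.sum_sub_distrib, Finset.sum_const, nsmul_eq_mul]
    ring
  have hterm : ∀ k ∈ K l, eLpNorm ((fun σ => F l (σ - v l k) - h (σ - v l k))
      + fun σ => h (σ - v l k) - h σ) 2 volume ≤ η / 5 + η / 5 := by
    intro k hk
    refine (eLpNorm_add_le ((hFT l _).sub (hhT _)) ((hhT _).sub hh.aestronglyMeasurable)
      (by norm_num)).trans (add_le_add ?_ ?_)
    · have := eLpNorm_comp_measurePreserving (p := 2) ((hF l).sub hh.aestronglyMeasurable)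
        (hmp (v l k))
      exact (le_of_eq this).trans hFl
    · refine hδt ?_
      rw [dist_zero_right]
      exact (hvl k hk).trans_lt (by linarith)
  have hm : ∀ k ∈ K l, AEStronglyMeasurable ((fun σ => F l (σ - v l k) - h (σ - v l k))
      + fun σ => h (σ - v l k) - h σ) volume := fun k _ =>
    ((hFT l _).sub (hhT _)).add ((hhT _).sub hh.aestronglyMeasurable)
  rw [hdec]
  refine (eLpNorm_add_le ((Finset.aestronglyMeasurable_sum _ hm).const_smul _)
    (hh.aestronglyMeasurable.const_smul _) (by norm_num)).trans ?_
  rw [eLpNorm_const_smul, eLpNorm_const_smul]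
  have hs : eLpNorm (∑ k ∈ K l, ((fun σ => F l (σ - v l k) - h (σ - v l k))
      + fun σ => h (σ - v l k) - h σ)) 2 volume ≤ (K l).card * (η / 5 + η / 5) := by
    refine (eLpNorm_sum_le hm (by norm_num)).trans ((Finset.sum_le_sum hterm).trans ?_)
    rw [Finset.sum_const, nsmul_eq_mul]
  calc _ ≤ ‖w l‖ₑ * ((K l).card * (η / 5 + η / 5)) + η / 5 := by gcongr
    _ = ‖w l * (K l).card‖ₑ * (η / 5 + η / 5) + η / 5 := by
      rw [enorm_mul, mul_assoc]
      congr 3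
      simp
    _ ≤ 2 * (η / 5 + η / 5) + η / 5 := by
      gcongr
      rw [Real.enorm_eq_ofReal (by positivity)]
      calc ENNReal.ofReal (w l * (K l).card) ≤ ENNReal.ofReal 2 := ENNReal.ofReal_le_ofReal hKl.le
        _ = 2 := by simp
    _ = 5 * (η / 5) := by ring
    _ = η := ENNReal.mul_div_cancel (by simp) (by simp)

/-! ### Degenerate smearing -/

section Degenerate

/-- The rectangle is fibred over its `i`-th coordinate `k`. Replacing side `i` of the box by `1`
leaves a single row there, and `k` is moved into the shift of `s`; all rows thus become translates
of one. -/
theorem boxSum_eq_sum_sum (b : (Fin 2 → ℤ) → ℝ) (N s : Fin 2 → ℤ) (i : Fin 2) :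
    boxSum b N s = ∑ k ∈ Finset.Ioc 0 (N i), ∑ t ∈ latticeBox (Function.update N i 1),
      b (Function.update t i 0 - (s - Pi.single i k)) := by
  rw [← Finset.sum_product', boxSum]
  refine Finset.sum_bij' (fun t _ => (t i, Function.update t i 1))
    (fun p _ => Function.update p.2 i p.1) ?_ ?_ ?_ ?_ ?_
  · intro t ht
    rw [mem_latticeBox] at ht
    rw [Finset.mem_product, mem_latticeBox]
    refine ⟨Finset.mem_Ioc.2 (ht i), fun k => ?_⟩
    by_cases hk : k = i
    · subst hk; simp
    · simpa [hk] using ht k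
  · intro p hp
    rw [Finset.mem_product, mem_latticeBox, Finset.mem_Ioc] at hp
    rw [mem_latticeBox]
    intro k
    by_cases hk : k = i
    · subst hk; simpa using hp.1
    · simpa [hk] using hp.2 k
  · intro t _; simp
  · intro p hp
    rw [Finset.mem_product, mem_latticeBox] at hp
    have h1 := hp.2 i
    simp only [Function.update_self] at h1
    have : p.2 i = 1 := by omega
    ext
    · simp
    · simp [← this]
  · intro t _
    congr 1
    ext k
    by_cases hk : k = i
    · subst hk; simp
    · simp [hk]

theorem ceilMap_sub_single {M : ℝ} (hM : 0 < M) (σ : Fin 2 → ℝ) (i : Fin 2) (k : ℤ) :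
    ceilMap (fun _ => M) (σ - Pi.single i (k / M)) = ceilMap (fun _ => M) σ - Pi.single i k := by
  ext j
  by_cases hj : j = i
  · subst hj
    simp only [ceilMap, Pi.sub_apply, Pi.single_eq_same, mul_sub, mul_div_cancel₀ _ hM.ne',
      Int.ceil_sub_intCast]
  · simp [ceilMap, hj]

variable {q : ℝ} {A : (Fin 2 → ℝ) → ℝ} {x : Fin 2 → ℝ}

theorem smeared_integral_eq_sum {b : (Fin 2 → ℤ) → ℝ} {M : ℝ} (hM : 0 < M) {i j : Fin 2}
    (hij : j ≠ i) {y : ℝ} (hy : 0 < y) (N s : Fin 2 → ℤ) :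
    ∫ t in box (Function.update (fun k => N k / M) i y), M ^ q *
      b (ceilMap (fun k => M * Function.update (1 : Fin 2 → ℝ) i 0 k) t - s)
      = M ^ q * (y / M) * ∑ t ∈ latticeBox (Function.update N i 1),
          b (Function.update t i 0 - s) := by
  -- With scale `1 / y` in direction `i`, the single row of lattice points with coordinate `1`
  -- corresponds to the whole interval `(0, y]`.
  set n' : Fin 2 → ℝ := Function.update (fun _ => M) i (1 / y) with hn'
  have hn'p : ∀ k, 0 < n' k := by
    intro k
    by_cases hk : k = i
    · subst hk; simp [hn', hy]
    · simp [hn', hk, hM]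
  have hprod : n' 0 * n' 1 = M / y := by
    have h2 : n' 0 * n' 1 = n' i * n' j := by
      fin_cases i <;> fin_cases j <;> simp_all [mul_comm]
    rw [h2]
    simp only [hn', Function.update_self, Function.update_of_ne hij]
    field_simp
  have e := sum_eq_setIntegral_ceilMap hn'p (latticeBox (Function.update N i 1))
    (fun t => b (Function.update t i 0 - s))
  rw [ceilMap_preimage_latticeBox hn'p, hprod] at e
  rw [e, integral_const_mul, mul_assoc]
  congr 1
  have hb : (fun k => ((Function.update N i 1 k : ℤ) : ℝ) / n' k)
      = Function.update (fun k => (N k : ℝ) / M) i y := by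
    ext k
    by_cases hk : k = i
    · subst hk; simp [hn']
    · simp [hn', hk]
  have hc : ∀ τ, Function.update (ceilMap n' τ) i 0
      = ceilMap (fun k => M * Function.update (1 : Fin 2 → ℝ) i 0 k) τ := by
    intro τ
    ext k
    by_cases hk : k = i
    · subst hk; simp [ceilMap]
    · simp [ceilMap, hn', hk]
  rw [hb, ← mul_assoc, div_mul_div_cancel₀ hM.ne', div_self hy.ne', one_mul]
  simp only [hc]

/-- Scaling of the partial sums over rectangles which are asymptotically thin in direction `i`. -/
theorem LatticeApprox.tendsto_boxSum_degenerate {b : (Fin 2 → ℤ) → ℝ} (hb : LatticeApprox q A b)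
    (hA : HomogeneousKernel q A) (h1 : 1 < q) (h2 : q < 3 / 2) (hx : ∀ i, 0 < x i)
    {i j : Fin 2} (hij : j ≠ i) {n : ℝ → Fin 2 → ℝ}
    (hn : ∀ k, Tendsto (fun l => n l k) atTop atTop)
    (hratio : Tendsto (fun l => n l i / n l j) atTop (𝓝 0)) :
    Tendsto (fun l => eLpNorm (fun σ => n l j ^ q / (n l i * n l j) *
      boxSum b (fun k => ⌊n l k * x k⌋) (ceilMap (fun _ => n l j) σ)
        - smearedKernel A (Function.update 1 i 0) x σ) 2 volume) atTop (𝓝 0) := by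
  set m : Fin 2 → ℝ := Function.update 1 i 0 with hm
  have hmj : m j ≠ 0 := by simp [hm, hij]
  have hdom : SmearedDomination q m x := smearedDomination_degenerate h1 h2 hx (i := i)
    (by simp [hm]) (fun k hk => by simp [hm, hk])
  -- Side `i` is kept at its limit value `x i`: the integrand does not depend on that variable, so
  -- no rounding is needed.
  let x' : ℝ → Fin 2 → ℝ := fun l => Function.update (fun k => ⌊n l k * x k⌋ / n l j) i (x i)
  have hother : ∀ k, k ≠ i → k = j := fun k hk => by
    fin_cases i <;> fin_cases j <;> fin_cases k <;> simp_all
  have hF := hb.tendsto_smeared (by linarith) ⟨j, hmj⟩ hdom (hn j) (x' := x') ?_ ?_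
  · set F : ℝ → (Fin 2 → ℝ) → ℝ := fun l σ => ∫ t in box (x' l), n l j ^ q *
      b (ceilMap (fun k => n l j * m k) t - ceilMap (fun _ => n l j) σ) with hFdef
    have hFm : ∀ l, AEStronglyMeasurable (F l) volume := fun l => by
      have : Measurable fun p : (Fin 2 → ℝ) × (Fin 2 → ℝ) => n l j ^ q *
          b (ceilMap (fun k => n l j * m k) p.2 - ceilMap (fun _ => n l j) p.1) := by
        refine Measurable.const_mul ((measurable_of_countable b).comp ?_) _
        exact ((measurable_ceilMap _).comp measurable_snd).sub
          ((measurable_ceilMap _).comp measurable_fst)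
      exact (this.stronglyMeasurable.integral_prod_right
        (ν := volume.restrict (box (x' l)))).aestronglyMeasurable
    -- There are `⌊nᵢ xᵢ⌋` rows, each of weight `(nᵢ xᵢ)⁻¹`, and at scale `nⱼ` the shifts are at
    -- most `xᵢ nᵢ / nⱼ`, which tends to zero.
    have := tendsto_eLpNorm_average hFm (hA.memLp_smearedKernel hdom) hF
      (K := fun l => Finset.Ioc 0 ⌊n l i * x i⌋)
      (v := fun l k => Pi.single i (k / n l j)) (w := fun l => (n l i * x i)⁻¹) ?_ ?_ ?_
    · refine this.congr' ?_
      filter_upwards [(hn i).eventually_gt_atTop 0, (hn j).eventually_gt_atTop 0] with l hi hj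
      congr with σ
      congr 1
      rw [boxSum_eq_sum_sum _ _ _ i, Finset.mul_sum, Finset.mul_sum]
      refine Finset.sum_congr rfl fun k _ => ?_
      have := smeared_integral_eq_sum (q := q) (b := b) hj hij (hx i) (fun k => ⌊n l k * x k⌋)
        (ceilMap (fun _ => n l j) (σ - Pi.single i (k / n l j)))
      simp only [hFdef, x', hm]
      rw [this, ceilMap_sub_single hj, ← mul_assoc]
      congr 1
      have := (hx i).ne'
      field_simp
    · filter_upwards [(hn i).eventually_gt_atTop 0] with l hi
      have := hx i
      positivity
    · have := (tendsto_floor_mul_div (hn i) (x i)).div_const (x i)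
      rw [div_self (hx i).ne'] at this
      refine this.congr' ?_
      filter_upwards [(hn i).eventually_gt_atTop 0] with l hi
      have h0 : 0 ≤ ⌊n l i * x i⌋ := Int.floor_nonneg.2 (mul_pos hi (hx i)).le
      rw [Int.card_Ioc, sub_zero, ← Int.cast_natCast (R := ℝ), Int.toNat_of_nonneg h0]
      have := (hx i).ne'
      field_simp
    · intro η hη
      have hr : Tendsto (fun l => x i * (n l i / n l j)) atTop (𝓝 (x i * 0)) :=
        hratio.const_mul _
      rw [mul_zero] at hr
      filter_upwards [hr.eventually_lt_const hη, (hn i).eventually_gt_atTop 0,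
        (hn j).eventually_gt_atTop 0] with l hl hi hj k hk
      rw [Finset.mem_Ioc] at hk
      have hk0 : (0 : ℝ) < k := by exact_mod_cast hk.1
      have hk1 : (k : ℝ) ≤ n l i * x i :=
        (Int.cast_le.2 hk.2).trans (Int.floor_le _)
      rw [Pi.norm_single, Real.norm_of_nonneg (by positivity)]
      refine le_trans ?_ hl.le
      rw [div_le_iff₀ hj]
      calc (k : ℝ) ≤ n l i * x i := hk1
        _ = _ := by field_simp
  · filter_upwards [(hn j).eventually_gt_atTop 0] with l hj k
    by_cases hk : k = i
    · subst hk; simp [x']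
    · have := hother k hk
      subst this
      simp only [x', Function.update_of_ne hk]
      rw [div_le_iff₀ hj, mul_comm]
      exact Int.floor_le _
  · intro k
    by_cases hk : k = i
    · subst hk; simp [x']
    · have := hother k hk
      subst this
      simp only [x', Function.update_of_ne hk]
      exact tendsto_floor_mul_div (hn k) (x k)

end Degenerate

/-! ### Power kernels on strips -/

section Strip

theorem integrable_indicator_abs_rpow_near {β : ℝ} (hβ : β < 1) :
    Integrable ((Set.Icc (-1 : ℝ) 1).indicator fun t => |t| ^ (-β)) :=
  (integrable_indicator_iff measurableSet_Icc).2
    ((locallyIntegrable_abs_rpow hβ).integrableOn_isCompact isCompact_Icc)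

theorem integrable_indicator_abs_rpow_far {β : ℝ} (hβ : 1 < β) :
    Integrable ((Set.Icc (-1 : ℝ) 1)ᶜ.indicator fun t => |t| ^ (-β)) := by
  have := (integrable_one_add_norm (E := ℝ) (μ := volume) (r := β) (by simpa using hβ)).const_mul
    (2 ^ β)
  refine this.mono' ((Measurable.aestronglyMeasurable (by fun_prop)).indicator
    measurableSet_Icc.compl) (ae_of_all _ fun t => ?_)
  rw [Real.norm_of_nonneg (Set.indicator_nonneg (fun _ _ => by positivity) _), Real.norm_eq_abs]
  by_cases ht : t ∈ (Set.Icc (-1 : ℝ) 1)ᶜ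
  · rw [Set.indicator_of_mem ht]
    rw [Set.mem_compl_iff, Set.mem_Icc, ← abs_le, not_le] at ht
    exact rpow_neg_le_of_half_le (by linarith) (by positivity) (by norm_num) (by linarith)
  · rw [Set.indicator_of_notMem ht]
    positivity

/-- The bound is uniform in the dilation `K`. For bounded `s` the total mass of `φ` suffices;
otherwise the window has length `K(x + 2)` and distance at least `K(1 + |s|)/4` from zero, so `φ(t)
≤ 1/|t|` makes `K` cancel. The `-2` leaves room for two rounding errors. -/
theorem exists_setIntegral_window_le {φ : ℝ → ℝ} (hφ : Integrable φ) (h0 : ∀ t, 0 ≤ φ t)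
    (h1 : ∀ t, 1 ≤ |t| → φ t ≤ |t|⁻¹) {x : ℝ} (hx : 0 < x) :
    ∃ C : ℝ, 0 ≤ C ∧ ∀ K : ℝ, 1 ≤ K → ∀ s,
      ∫ t in Set.Ioc (K * (-2 - s)) (K * (x - s)), φ t ≤ C * (1 + |s|) ^ (-1 : ℝ) := by
  have hI : 0 ≤ ∫ t, φ t := integral_nonneg h0
  refine ⟨(∫ t, φ t) * (2 * x + 5) + (x + 2) * 4, by positivity, fun K hK s => ?_⟩
  have hK0 : 0 < K := by linarith
  have hs0 : 0 ≤ |s| := abs_nonneg s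
  rw [Real.rpow_neg_one]
  rcases le_or_gt |s| (2 * x + 4) with hs | hs
  · have : 1 ≤ (2 * x + 5) * (1 + |s|)⁻¹ := by
      rw [← div_eq_mul_inv, one_le_div (by positivity)]
      linarith
    calc _ ≤ ∫ t, φ t := setIntegral_le_integral hφ (ae_of_all _ h0)
      _ ≤ (∫ t, φ t) * ((2 * x + 5) * (1 + |s|)⁻¹) := le_mul_of_one_le_right hI this
      _ ≤ _ := by
        have : 0 ≤ (x + 2) * 4 * (1 + |s|)⁻¹ := by positivity
        linarith
  · have e1 : ∫ t in Set.Ioc (K * (-2 - s)) (K * (x - s)), φ t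
        ≤ ∫ t in Set.Ioc (K * (-2 - s)) (K * (x - s)), 4 / (K * (1 + |s|)) := by
      refine setIntegral_mono_on hφ.integrableOn (integrableOn_const (by simp)) measurableSet_Ioc
        fun t ht => ?_
      have hts : K * (1 + |s|) / 4 ≤ |t| := by
        have ha : K * |s| ≤ |t| + K * (x + 2) := by
          have : |t + K * s| ≤ K * (x + 2) := by
            rw [abs_le]
            constructor
            · nlinarith [ht.1]
            · nlinarith [ht.2]
          have h3 : |K * s| ≤ |t| + |t + K * s| := by
            have := abs_sub (t + K * s) t
            rw [add_sub_cancel_left] at this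
            linarith
          rw [abs_mul, abs_of_pos hK0] at h3
          linarith
        nlinarith
      have ht1 : 1 ≤ |t| := by
        refine le_trans ?_ hts
        rw [le_div_iff₀ (by norm_num)]
        nlinarith
      refine (h1 t ht1).trans ?_
      rw [inv_eq_one_div, div_le_div_iff₀ (by positivity) (by positivity)]
      linarith
    rw [setIntegral_const] at e1
    simp only [measureReal_def, Real.volume_Ioc, smul_eq_mul] at e1
    rw [ENNReal.toReal_ofReal (by nlinarith)] at e1
    refine e1.trans ?_
    have : (K * (x - s) - K * (-2 - s)) * (4 / (K * (1 + |s|))) = (x + 2) * 4 * (1 + |s|)⁻¹ := by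
      field_simp
      ring
    rw [this]
    have : 0 ≤ (∫ t, φ t) * (2 * x + 5) * (1 + |s|)⁻¹ := by positivity
    linarith

variable {q : ℝ} {i j : Fin 2}

/-- The part of the power kernel close to the axis. -/
def nearPower (q t : ℝ) : ℝ := (Set.Icc (-1 : ℝ) 1).indicator (fun t => |t| ^ (-(q / 2))) t

/-- The part of the power kernel far from the axis. -/
def farPower (q t : ℝ) : ℝ := (Set.Icc (-1 : ℝ) 1)ᶜ.indicator (fun t => |t| ^ (-(q / 2 + 1 / 4))) t

theorem nearPower_nonneg (t : ℝ) : 0 ≤ nearPower q t :=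
  Set.indicator_nonneg (fun _ _ => by positivity) _

theorem farPower_nonneg (t : ℝ) : 0 ≤ farPower q t :=
  Set.indicator_nonneg (fun _ _ => by positivity) _

theorem integrable_nearPower (h2 : q < 2) : Integrable (nearPower q) :=
  integrable_indicator_abs_rpow_near (by linarith)

theorem integrable_farPower (h1 : 3 / 2 < q) : Integrable (farPower q) :=
  integrable_indicator_abs_rpow_far (by linarith)

theorem nearPower_le (t : ℝ) (ht : 1 ≤ |t|) : nearPower q t ≤ |t|⁻¹ := by
  by_cases h : t ∈ Set.Icc (-1 : ℝ) 1
  · rw [nearPower, Set.indicator_of_mem h]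
    have : |t| = 1 := le_antisymm (abs_le.2 h) ht
    simp [this]
  · rw [nearPower, Set.indicator_of_notMem h]
    positivity

theorem farPower_le (h1 : 3 / 2 < q) (t : ℝ) (ht : 1 ≤ |t|) : farPower q t ≤ |t|⁻¹ := by
  have h : farPower q t ≤ |t| ^ (-(q / 2 + 1 / 4)) :=
    Set.indicator_le_self' (fun _ _ => by positivity) t
  refine h.trans ?_
  rw [← Real.rpow_neg_one]
  exact Real.rpow_le_rpow_of_exponent_le ht (by linarith)

theorem prod_ite_eq (hij : j ≠ i) (a c : Fin 2 → ℝ) :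
    ∏ k, (if k = i then a k else c k) = a i * c j := by
  fin_cases i <;> fin_cases j <;> simp_all [Fin.prod_univ_two, mul_comm]

theorem memLp_mul_apply (hij : j ≠ i) {f g : ℝ → ℝ} (hf : MemLp f 2 volume)
    (hg : MemLp g 2 volume) : MemLp (fun σ : Fin 2 → ℝ => f (σ i) * g (σ j)) 2 volume := by
  have := memLp_prod_apply (g := fun k => if k = i then f else g) fun k => by
    split_ifs <;> assumption
  refine this.ae_eq (ae_of_all _ fun σ => ?_)
  have e := prod_ite_eq hij (fun k => f (σ k)) (fun k => g (σ k))
  refine Eq.trans (Finset.prod_congr rfl fun k _ => ?_) e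
  split_ifs <;> rfl

/-- The exponent on `ρⱼ` must be below `1` near zero and above `1` far away, hence the two splits.
Since `q > 3/2`, the far exponent `q/2 + 1/4` exceeds `1`, and the `q/2 - 1/4` left for `ρᵢ` still
exceeds `1/2`. -/
theorem norm_rpow_le_near_add_far (hij : j ≠ i) (h1 : 3 / 2 < q) {ρ : Fin 2 → ℝ}
    (hρ : ∀ k, ρ k ≠ 0) : ‖ρ‖ ^ (-q) ≤ |ρ i| ^ (-(q / 2)) * nearPower q (ρ j)
      + |ρ i| ^ (-(q / 2 - 1 / 4)) * farPower q (ρ j) := by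
  have key : ∀ a b : ℝ, 0 ≤ a → 0 ≤ b → a + b = q →
      ‖ρ‖ ^ (-q) ≤ |ρ i| ^ (-a) * |ρ j| ^ (-b) := by
    intro a b ha hb hab
    have h := norm_rpow_neg_le_prod (q := q) (α := fun k => if k = i then a else b)
      (fun k => by split_ifs <;> assumption)
      (by fin_cases i <;> simp [Fin.sum_univ_two, ← hab, add_comm]) hρ
    refine h.trans (le_of_eq ?_)
    rw [← prod_ite_eq hij (fun k => |ρ k| ^ (-a)) (fun k => |ρ k| ^ (-b))]
    refine Finset.prod_congr rfl fun k _ => ?_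
    split_ifs <;> rfl
  by_cases h : ρ j ∈ Set.Icc (-1 : ℝ) 1
  · have e1 : nearPower q (ρ j) = |ρ j| ^ (-(q / 2)) := Set.indicator_of_mem h _
    have e2 : farPower q (ρ j) = 0 := Set.indicator_of_notMem (by simpa using h) _
    rw [e1, e2, mul_zero, add_zero]
    exact key _ _ (by linarith) (by linarith) (by ring)
  · have e1 : nearPower q (ρ j) = 0 := Set.indicator_of_notMem h _
    have e2 : farPower q (ρ j) = |ρ j| ^ (-(q / 2 + 1 / 4)) := Set.indicator_of_mem h _
    rw [e1, e2, mul_zero, zero_add]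
    exact key _ _ (by linarith) (by linarith) (by ring)

theorem integrable_and_integral_window (hij : j ≠ i) {f g : ℝ → ℝ} {I J : Set ℝ}
    (hI : MeasurableSet I) (hJ : MeasurableSet J) (hf : IntegrableOn f I) (hg : IntegrableOn g J) :
    IntegrableOn (fun ρ : Fin 2 → ℝ => f (ρ i) * g (ρ j)) {ρ | ρ i ∈ I ∧ ρ j ∈ J} ∧
      ∫ ρ in {ρ : Fin 2 → ℝ | ρ i ∈ I ∧ ρ j ∈ J}, f (ρ i) * g (ρ j)
        = (∫ t in I, f t) * ∫ t in J, g t := by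
  set F : Fin 2 → ℝ → ℝ := fun k => if k = i then I.indicator f else J.indicator g with hF
  have hS : MeasurableSet {ρ : Fin 2 → ℝ | ρ i ∈ I ∧ ρ j ∈ J} :=
    (measurable_pi_apply i hI).inter (measurable_pi_apply j hJ)
  have hFi : ∀ k, Integrable (F k) := by
    intro k
    by_cases h : k = i
    · simp only [hF, h, if_true]
      exact (integrable_indicator_iff hI).2 hf
    · simp only [hF, h, if_false]
      exact (integrable_indicator_iff hJ).2 hg
  have hprod : ∀ ρ : Fin 2 → ℝ, ∏ k, F k (ρ k)
      = {ρ : Fin 2 → ℝ | ρ i ∈ I ∧ ρ j ∈ J}.indicator (fun ρ => f (ρ i) * g (ρ j)) ρ := by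
    intro ρ
    have : ∏ k, F k (ρ k) = ∏ k, if k = i then I.indicator f (ρ k) else J.indicator g (ρ k) := by
      refine Finset.prod_congr rfl fun k _ => ?_
      simp only [hF]
      split_ifs <;> rfl
    rw [this, prod_ite_eq hij (fun k => I.indicator f (ρ k)) (fun k => J.indicator g (ρ k))]
    by_cases h1 : ρ i ∈ I <;> by_cases h2 : ρ j ∈ J <;> simp [Set.indicator, h1, h2]
  constructor
  · rw [← integrable_indicator_iff hS]
    refine (Integrable.fintype_prod (f := F) hFi).congr (ae_of_all _ hprod)
  · rw [← integral_indicator hS, ← integral_congr_ae (ae_of_all _ hprod),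
      integral_fintype_prod_volume_eq_prod F, ← integral_indicator hI, ← integral_indicator hJ]
    have : ∏ k, ∫ t, F k t = ∏ k, if k = i then ∫ t, I.indicator f t else ∫ t, J.indicator g t := by
      refine Finset.prod_congr rfl fun k _ => ?_
      simp only [hF]
      split_ifs <;> rfl
    rw [this]
    exact prod_ite_eq hij (fun _ => ∫ t, I.indicator f t) (fun _ => ∫ t, J.indicator g t)

theorem integrableOn_window_and_le (hij : j ≠ i) (h1 : 3 / 2 < q) (h2 : q < 2) (a c : ℝ)
    {J : Set ℝ} (hJ : MeasurableSet J) :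
    IntegrableOn (fun ρ : Fin 2 → ℝ => ‖ρ‖ ^ (-q)) {ρ | ρ i ∈ Set.Ioc a c ∧ ρ j ∈ J} ∧
      ∫ ρ in {ρ : Fin 2 → ℝ | ρ i ∈ Set.Ioc a c ∧ ρ j ∈ J}, ‖ρ‖ ^ (-q)
        ≤ (∫ t in Set.Ioc a c, |t| ^ (-(q / 2))) * (∫ t in J, nearPower q t)
          + (∫ t in Set.Ioc a c, |t| ^ (-(q / 2 - 1 / 4))) * ∫ t in J, farPower q t := by
  have hloc : ∀ β : ℝ, β < 1 → IntegrableOn (fun t : ℝ => |t| ^ (-β)) (Set.Ioc a c) := fun β hβ =>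
    ((locallyIntegrable_abs_rpow hβ).integrableOn_isCompact isCompact_Icc).mono_set
      Set.Ioc_subset_Icc_self
  obtain ⟨n1, n2⟩ := integrable_and_integral_window hij measurableSet_Ioc hJ
    (hloc (q / 2) (by linarith)) (integrable_nearPower h2).integrableOn
  obtain ⟨f1, f2⟩ := integrable_and_integral_window hij measurableSet_Ioc hJ
    (hloc (q / 2 - 1 / 4) (by linarith)) (integrable_farPower h1).integrableOn
  have hle : ∀ᵐ ρ : Fin 2 → ℝ, ‖ρ‖ ^ (-q) ≤ |ρ i| ^ (-(q / 2)) * nearPower q (ρ j)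
      + |ρ i| ^ (-(q / 2 - 1 / 4)) * farPower q (ρ j) := by
    filter_upwards [ae_apply_ne 0 0, ae_apply_ne 1 0] with ρ e0 e1
    exact norm_rpow_le_near_add_far hij h1 fun k => by fin_cases k <;> assumption
  have hint : IntegrableOn (fun ρ : Fin 2 → ℝ => ‖ρ‖ ^ (-q))
      {ρ | ρ i ∈ Set.Ioc a c ∧ ρ j ∈ J} := by
    refine (n1.add f1).mono' (Measurable.aestronglyMeasurable (by fun_prop)) ?_
    filter_upwards [ae_restrict_of_ae hle] with ρ hρ
    rwa [Real.norm_of_nonneg (by positivity)]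
  refine ⟨hint, (integral_mono_ae hint (n1.add f1) (ae_restrict_of_ae hle)).trans (le_of_eq ?_)⟩
  rw [← n2, ← f2]
  exact integral_add n1 f1

theorem exists_setIntegral_shift_le {β x : ℝ} (h0 : 0 ≤ β) (h1 : β < 1) (hx : 0 < x) :
    ∃ C : ℝ, 0 ≤ C ∧ ∀ s, ∫ t in Set.Ioc (-2 - s) (x - s), |t| ^ (-β) ≤ C * (1 + |s|) ^ (-β) := by
  obtain ⟨C, hC, h⟩ := exists_setIntegral_abs_sub_rpow_le h0 h1 (show 0 < x + 2 by linarith)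
  refine ⟨C * 3 ^ β, by positivity, fun s => ?_⟩
  have e : ∫ t in Set.Ioc (-2 - s) (x - s), |t| ^ (-β)
      = ∫ t in Set.Ioc 0 (x + 2), |t - (s + 2)| ^ (-β) := by
    rw [← (measurePreserving_sub_right volume (s + 2)).setIntegral_preimage_emb
      (measurableEmbedding_subRight (s + 2))]
    congr 2
    ext t
    simp only [Set.mem_preimage, Set.mem_Ioc]
    constructor <;> rintro ⟨h1, h2⟩ <;> constructor <;> linarith
  rw [e, mul_assoc]
  refine (h _).trans (mul_le_mul_of_nonneg_left ?_ hC)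
  refine rpow_neg_le_of_half_le h0 (by positivity) (by norm_num) ?_
  have : |s| ≤ |s + 2| + 2 := by
    have := abs_sub (s + 2) 2
    rw [add_sub_cancel_right] at this
    simpa using this
  have := abs_nonneg (s + 2)
  linarith

/-- Square integrable domination of the power kernel on moving windows. -/
theorem exists_window_domination (hij : j ≠ i) (h1 : 3 / 2 < q) (h2 : q < 2) {x : Fin 2 → ℝ}
    (hx : ∀ k, 0 < x k) : ∃ G : (Fin 2 → ℝ) → ℝ, MemLp G 2 volume ∧ ∀ K : ℝ, 1 ≤ K →
      ∀ σ : Fin 2 → ℝ, ∫ ρ in {ρ : Fin 2 → ℝ | ρ i ∈ Set.Ioc (-2 - σ i) (x i - σ i) ∧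
        ρ j ∈ Set.Ioc (K * (-2 - σ j)) (K * (x j - σ j))}, ‖ρ‖ ^ (-q) ≤ G σ := by
  obtain ⟨C1, c1, b1⟩ := exists_setIntegral_shift_le (β := q / 2) (by linarith) (by linarith) (hx i)
  obtain ⟨C2, c2, b2⟩ := exists_setIntegral_shift_le (β := q / 2 - 1 / 4) (by linarith)
    (by linarith) (hx i)
  obtain ⟨D1, d1, e1⟩ := exists_setIntegral_window_le (integrable_nearPower h2) nearPower_nonneg
    nearPower_le (hx j)
  obtain ⟨D2, d2, e2⟩ := exists_setIntegral_window_le (integrable_farPower h1) farPower_nonneg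
    (farPower_le h1) (hx j)
  have hmem : ∀ (β C D : ℝ), 1 / 2 < β → MemLp (fun σ : Fin 2 → ℝ =>
      (C * (1 + |σ i|) ^ (-β)) * (D * (1 + |σ j|) ^ (-1 : ℝ))) 2 volume := by
    intro β C D hβ
    exact memLp_mul_apply hij ((memLp_one_add_abs_rpow hβ).const_mul C)
      ((memLp_one_add_abs_rpow (by norm_num)).const_mul D)
  refine ⟨_, (hmem (q / 2) C1 D1 (by linarith)).add (hmem (q / 2 - 1 / 4) C2 D2 (by linarith)),
    fun K hK σ => (integrableOn_window_and_le hij h1 h2 _ _ measurableSet_Ioc).2.trans ?_⟩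
  refine add_le_add ?_ ?_
  · exact mul_le_mul (b1 _) (e1 K hK _) (integral_nonneg fun t => nearPower_nonneg t)
      (by positivity)
  · exact mul_le_mul (b2 _) (e2 K hK _) (integral_nonneg fun t => farPower_nonneg t)
      (by positivity)

end Strip

/-! ### Strip kernels -/

/-- The kernel `σ ↦ ∫ A(ρ) 1(ρᵢ eᵢ + σ ∈ (0,x]) dρ`. -/
def stripKernel (A : (Fin 2 → ℝ) → ℝ) (i : Fin 2) (x σ : Fin 2 → ℝ) : ℝ :=
  ∫ ρ in {ρ : Fin 2 → ℝ | Pi.single i 1 * ρ + σ ∈ box x}, A ρ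

section StripKernel

variable {q : ℝ} {A : (Fin 2 → ℝ) → ℝ} {b : (Fin 2 → ℤ) → ℝ} {x : Fin 2 → ℝ} {i j : Fin 2}

theorem forall_fin_two_iff (hij : j ≠ i) {p : Fin 2 → Prop} : (∀ k, p k) ↔ p i ∧ p j := by
  fin_cases i <;> fin_cases j <;> simp_all [Fin.forall_fin_two, and_comm]

theorem mem_strip_iff (hij : j ≠ i) {ρ σ : Fin 2 → ℝ} :
    Pi.single i 1 * ρ + σ ∈ box x ↔
      (0 < ρ i + σ i ∧ ρ i + σ i ≤ x i) ∧ (0 < σ j ∧ σ j ≤ x j) := by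
  rw [mem_box, forall_fin_two_iff hij]
  simp [hij]

theorem measurableSet_strip (σ : Fin 2 → ℝ) :
    MeasurableSet {ρ : Fin 2 → ℝ | Pi.single i 1 * ρ + σ ∈ box x} := by
  have : Measurable fun ρ : Fin 2 → ℝ => Pi.single i 1 * ρ + σ := by fun_prop
  exact this (measurableSet_box x)

theorem integrableOn_norm_rpow_wideStrip (hij : j ≠ i) (h1 : 3 / 2 < q) (h2 : q < 2)
    (a c : ℝ) :
    IntegrableOn (fun ρ : Fin 2 → ℝ => ‖ρ‖ ^ (-q)) {ρ | ρ i ∈ Set.Ioc a c} := by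
  have := (integrableOn_window_and_le hij h1 h2 a c MeasurableSet.univ).1
  simpa using this

theorem HomogeneousKernel.integrableOn_strip (hA : HomogeneousKernel q A) (hij : j ≠ i)
    (h1 : 3 / 2 < q) (h2 : q < 2) (σ : Fin 2 → ℝ) :
    IntegrableOn A {ρ : Fin 2 → ℝ | Pi.single i 1 * ρ + σ ∈ box x} := by
  obtain ⟨C, hC, hCb⟩ := hA.bound
  have hsub : {ρ : Fin 2 → ℝ | Pi.single i 1 * ρ + σ ∈ box x}
      ⊆ {ρ | ρ i ∈ Set.Ioc (-σ i) (x i - σ i)} := by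
    intro ρ hρ
    rw [Set.mem_ofPred_eq, mem_strip_iff hij] at hρ
    exact ⟨by linarith [hρ.1.1], by linarith [hρ.1.2]⟩
  refine (((integrableOn_norm_rpow_wideStrip hij h1 h2 _ _).mono_set hsub).const_mul C).mono' ?_
    (ae_of_all _ fun ρ => hCb ρ)
  exact hA.measurable.aestronglyMeasurable

/-- The lattice window `{ρ : ⌈Mρ⌉ + ⌈nσ⌉ ∈ (0, ⌊nx⌋]}`. -/
def latticeWindow (M : ℝ) (n x σ : Fin 2 → ℝ) : Set (Fin 2 → ℝ) :=
  {ρ | ceilMap (fun _ => M) ρ + ceilMap n σ ∈ latticeBox fun k => ⌊n k * x k⌋}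

theorem measurableSet_latticeWindow (M : ℝ) (n x σ : Fin 2 → ℝ) :
    MeasurableSet (latticeWindow M n x σ) :=
  ((measurable_ceilMap _).add_const _) (Set.to_countable _).measurableSet

/-- The summation variable becomes `r = t - s`, discretized isotropically at scale `M` even though
`s` lives on the grid `n`. -/
theorem boxSum_eq_setIntegral_latticeWindow {M : ℝ} (hM : 0 < M) (n σ : Fin 2 → ℝ) :
    M ^ (q - 2) * boxSum b (fun k => ⌊n k * x k⌋) (ceilMap n σ)
      = ∫ ρ in latticeWindow M n x σ, M ^ q * b (ceilMap (fun _ => M) ρ) := by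
  classical
  set F := latticeBox fun k => ⌊n k * x k⌋
  have h1 : boxSum b (fun k => ⌊n k * x k⌋) (ceilMap n σ)
      = ∑ r ∈ F.image (fun t => t - ceilMap n σ), b r := by
    rw [Finset.sum_image fun s _ t _ h => sub_left_injective h, boxSum]
  have h2 : ceilMap (fun _ => M) ⁻¹' (F.image fun t => t - ceilMap n σ : Finset (Fin 2 → ℤ))
      = latticeWindow M n x σ := by
    ext ρ
    simp only [Set.mem_preimage, Finset.mem_coe, Finset.mem_image, latticeWindow, Set.mem_ofPred_eq]
    constructor
    · rintro ⟨t, ht, h⟩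
      rw [← h, sub_add_cancel]
      exact ht
    · intro h
      exact ⟨_, h, add_sub_cancel_right _ _⟩
  rw [h1, sum_eq_setIntegral_ceilMap (n := fun _ => M) (fun _ => hM), h2, integral_const_mul,
    ← mul_assoc]
  congr 1
  rw [Real.rpow_sub hM, Real.rpow_two]
  field_simp

/-- The two ceilings together overshoot by less than `2`; since `1 ≤ n i ≤ n j`, this becomes a
margin of at most `2` after rescaling in either direction. -/
theorem latticeWindow_subset {n σ : Fin 2 → ℝ} (hi : 1 ≤ n i) (hj : n i ≤ n j) :
    latticeWindow (n i) n x σ ⊆ {ρ : Fin 2 → ℝ | ρ i ∈ Set.Ioc (-2 - σ i) (x i - σ i) ∧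
        ρ j ∈ Set.Ioc (n j / n i * (-2 - σ j)) (n j / n i * (x j - σ j))} := by
  intro ρ hρ
  have hi0 : 0 < n i := by linarith
  have hj0 : 0 < n j := by linarith
  rw [latticeWindow, Set.mem_ofPred_eq, mem_latticeBox] at hρ
  have key : ∀ k, -2 < n i * ρ k + n k * σ k ∧ n i * ρ k + n k * σ k ≤ n k * x k := by
    intro k
    obtain ⟨e1, e2⟩ := hρ k
    simp only [Pi.add_apply, ceilMap] at e1 e2
    have f1 := Int.le_ceil (n i * ρ k)
    have f2 := Int.ceil_lt_add_one (n i * ρ k)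
    have f3 := Int.le_ceil (n k * σ k)
    have f4 := Int.ceil_lt_add_one (n k * σ k)
    have f5 := Int.floor_le (n k * x k)
    have g1 : (0 : ℝ) < ⌈n i * ρ k⌉ + ⌈n k * σ k⌉ := by exact_mod_cast e1
    have g2 : (⌈n i * ρ k⌉ : ℝ) + ⌈n k * σ k⌉ ≤ ⌊n k * x k⌋ := by exact_mod_cast e2
    constructor <;> linarith
  refine ⟨⟨?_, ?_⟩, ?_, ?_⟩
  · have := (key i).1
    nlinarith
  · have := (key i).2
    nlinarith
  · have := (key j).1
    rw [div_mul_eq_mul_div, div_lt_iff₀ hi0]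
    nlinarith
  · have := (key j).2
    rw [div_mul_eq_mul_div, le_div_iff₀ hi0]
    nlinarith

theorem eventually_window_iff {y z : ℝ → ℝ} {y₀ x₀ : ℝ} (hy : Tendsto y atTop (𝓝 y₀))
    (hz : Tendsto z atTop (𝓝 x₀)) (h0 : y₀ ≠ 0) (hx : y₀ ≠ x₀) :
    ∀ᶠ l in atTop, ((0 < y l ∧ y l ≤ z l) ↔ (0 < y₀ ∧ y₀ ≤ x₀)) := by
  have h1 : ∀ᶠ l in atTop, (0 < y l ↔ 0 < y₀) := by
    rcases lt_or_gt_of_ne h0 with h | h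
    · filter_upwards [hy.eventually_lt_const h] with l hl
      simp [hl.not_gt, h.not_gt]
    · filter_upwards [hy.eventually_const_lt h] with l hl
      simp [hl, h]
  have h2 : ∀ᶠ l in atTop, (y l ≤ z l ↔ y₀ ≤ x₀) := by
    rcases lt_or_gt_of_ne hx with h | h
    · filter_upwards [hy.eventually_lt hz h] with l hl
      simp [hl.le, h.le]
    · filter_upwards [hz.eventually_lt hy h] with l hl
      simp [hl.not_ge, h.not_ge]
  filter_upwards [h1, h2] with l e1 e2
  rw [e1, e2]

/-- At scale `nⱼ` the contribution of `ρⱼ` is of order `nᵢ / nⱼ` and disappears, so direction `j`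
constrains only `σⱼ`. The exclusions keep the limit points off the boundary. -/
theorem eventually_mem_latticeWindow_iff (hij : j ≠ i) {n : ℝ → Fin 2 → ℝ}
    (hn : ∀ k, Tendsto (fun l => n l k) atTop atTop)
    (hratio : Tendsto (fun l => n l i / n l j) atTop (𝓝 0)) {σ ρ : Fin 2 → ℝ}
    (h1 : ρ i + σ i ≠ 0) (h2 : ρ i + σ i ≠ x i) (h3 : σ j ≠ 0) (h4 : σ j ≠ x j) :
    ∀ᶠ l in atTop, (ρ ∈ latticeWindow (n l i) (n l) x σ ↔ Pi.single i 1 * ρ + σ ∈ box x) := by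
  have yi : Tendsto (fun l => (⌈n l i * ρ i⌉ + ⌈n l i * σ i⌉ : ℝ) / n l i) atTop
      (𝓝 (ρ i + σ i)) := by
    refine ((tendsto_ceil_mul_div (hn i) (ρ i)).add (tendsto_ceil_mul_div (hn i) (σ i))).congr
      fun l => ?_
    rw [add_div]
  have yj : Tendsto (fun l => (⌈n l i * ρ j⌉ + ⌈n l j * σ j⌉ : ℝ) / n l j) atTop (𝓝 (σ j)) := by
    have := ((tendsto_ceil_mul_div (hn i) (ρ j)).mul hratio).add
      (tendsto_ceil_mul_div (hn j) (σ j))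
    rw [mul_zero, zero_add] at this
    refine this.congr' ?_
    filter_upwards [(hn i).eventually_gt_atTop 0] with l hl
    rw [add_div, div_mul_div_cancel₀ hl.ne']
  filter_upwards [eventually_window_iff yi (tendsto_floor_mul_div (hn i) (x i)) h1 h2,
    eventually_window_iff yj (tendsto_floor_mul_div (hn j) (x j)) h3 h4,
    (hn i).eventually_gt_atTop 0, (hn j).eventually_gt_atTop 0] with l e1 e2 p1 p2
  rw [mem_strip_iff hij, ← e1, ← e2, latticeWindow, Set.mem_ofPred_eq, mem_latticeBox,
    forall_fin_two_iff hij]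
  simp only [Pi.add_apply, ceilMap]
  rw [div_le_div_iff_of_pos_right p1, div_le_div_iff_of_pos_right p2, div_pos_iff_of_pos_right p1,
    div_pos_iff_of_pos_right p2]
  norm_cast

/-- Scaling of the partial sums when the kernel is summable along direction `j`. -/
theorem LatticeApprox.memLp_and_tendsto_boxSum_strip (hb : LatticeApprox q A b)
    (h1 : 3 / 2 < q) (h2 : q < 2) (hx : ∀ k, 0 < x k) (hij : j ≠ i) {n : ℝ → Fin 2 → ℝ}
    (hn : ∀ k, Tendsto (fun l => n l k) atTop atTop)
    (hratio : Tendsto (fun l => n l i / n l j) atTop (𝓝 0)) :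
    MemLp (stripKernel A i x) 2 volume ∧ Tendsto (fun l => eLpNorm (fun σ => n l i ^ (q - 2) *
      boxSum b (fun k => ⌊n l k * x k⌋) (ceilMap (n l) σ) - stripKernel A i x σ) 2 volume)
        atTop (𝓝 0) := by
  obtain ⟨G, hG, hGb⟩ := exists_window_domination hij h1 h2 hx
  obtain ⟨C, hC, hCb⟩ := hb.bound
  have hbound : ∀ M : ℝ, 0 < M → ∀ ρ : Fin 2 → ℝ, ρ ≠ 0 →
      ‖M ^ q * b (ceilMap (fun _ => M) ρ)‖ ≤ C * ‖ρ‖ ^ (-q) := by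
    intro M hM ρ hρ
    have hz := norm_le_one_add_norm_ceilMap (fun _ => M) ρ
    have e : (fun k => M * ρ k) = M • ρ := rfl
    rw [e, norm_smul, Real.norm_of_nonneg hM.le] at hz
    rw [Real.norm_eq_abs, abs_mul, abs_of_nonneg (by positivity)]
    calc _ ≤ M ^ q * (C * (1 + ‖ceilMap (fun _ => M) ρ‖) ^ (-q)) := by
          gcongr
          exact hCb _
      _ = C * (M ^ q * (1 + ‖ceilMap (fun _ => M) ρ‖) ^ (-q)) := by ring
      _ ≤ _ := by
        gcongr
        exact rpow_mul_one_add_rpow_le (by linarith) hM (norm_pos_iff.2 hρ) hz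
  have hne : ∀ᵐ ρ : Fin 2 → ℝ, ρ ≠ 0 := by
    filter_upwards [ae_apply_ne 0 0] with ρ hρ h
    exact hρ (by simp [h])
  have hev : ∀ᶠ l in atTop, 1 ≤ n l i ∧ n l i ≤ n l j := by
    filter_upwards [(hn i).eventually_ge_atTop 1, (hn j).eventually_gt_atTop 0,
      hratio.eventually_lt_const one_pos] with l e1 e2 e3
    exact ⟨e1, ((div_lt_one e2).1 e3).le⟩
  refine memLp_and_tendsto_eLpNorm_of_dominated (G := fun σ => C * G σ) ?_ (hG.const_mul C) ?_ ?_
  · intro l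
    exact (((measurable_of_countable (boxSum b fun k => ⌊n l k * x k⌋)).comp
      (measurable_ceilMap _)).const_mul _).aestronglyMeasurable
  · filter_upwards [hev] with l hl
    refine ae_of_all _ fun σ => ?_
    have hi0 : 0 < n l i := by linarith [hl.1]
    have hK : 1 ≤ n l j / n l i := (one_le_div hi0).2 hl.2
    rw [boxSum_eq_setIntegral_latticeWindow hi0, ← Real.norm_eq_abs]
    have hint := (integrableOn_window_and_le hij h1 h2 (-2 - σ i) (x i - σ i)
      (measurableSet_Ioc (a := n l j / n l i * (-2 - σ j)) (b := n l j / n l i * (x j - σ j)))).1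
    calc _ ≤ ∫ ρ in latticeWindow (n l i) (n l) x σ, C * ‖ρ‖ ^ (-q) := by
          refine norm_integral_le_of_norm_le
            ((hint.mono_set (latticeWindow_subset hl.1 hl.2)).const_mul C)
            (ae_restrict_of_ae ?_)
          filter_upwards [hne] with ρ hρ
          exact hbound _ hi0 ρ hρ
      _ = C * ∫ ρ in latticeWindow (n l i) (n l) x σ, ‖ρ‖ ^ (-q) := integral_const_mul _ _
      _ ≤ C * G σ := by
        refine mul_le_mul_of_nonneg_left ((setIntegral_mono_set hint
          (ae_of_all _ fun ρ => by positivity)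
          (LE.le.eventuallyLE (latticeWindow_subset hl.1 hl.2))).trans (hGb _ hK σ)) hC
  · filter_upwards [ae_apply_ne j 0, ae_apply_ne j (x j)] with σ s1 s2
    have hint := (integrableOn_norm_rpow_wideStrip hij h1 h2 (-2 - σ i) (x i - σ i)).const_mul C
    -- This infinite strip eventually contains every window and carries the integrable majorant, so
    -- it is a common domain for dominated convergence.
    set T := {ρ : Fin 2 → ℝ | ρ i ∈ Set.Ioc (-2 - σ i) (x i - σ i)} with hT
    have hTm : MeasurableSet T := measurable_pi_apply i measurableSet_Ioc
    have hsub : {ρ : Fin 2 → ℝ | Pi.single i 1 * ρ + σ ∈ box x} ⊆ T := by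
      intro ρ hρ
      rw [Set.mem_ofPred_eq, mem_strip_iff hij] at hρ
      exact ⟨by linarith [hρ.1.1], by linarith [hρ.1.2]⟩
    have key : Tendsto (fun l => ∫ ρ in T, (latticeWindow (n l i) (n l) x σ).indicator
        (fun ρ => n l i ^ q * b (ceilMap (fun _ => n l i) ρ)) ρ) atTop
        (𝓝 (∫ ρ in T, {ρ : Fin 2 → ℝ | Pi.single i 1 * ρ + σ ∈ box x}.indicator A ρ)) := by
      refine tendsto_integral_filter_of_dominated_convergence (fun ρ => C * ‖ρ‖ ^ (-q)) ?_ ?_ hint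
        ?_
      · refine Eventually.of_forall fun l => Measurable.aestronglyMeasurable ?_
        exact (((measurable_of_countable b).comp (measurable_ceilMap _)).const_mul _).indicator
          (measurableSet_latticeWindow _ _ _ _)
      · filter_upwards [(hn i).eventually_gt_atTop 0] with l hl
        refine ae_restrict_of_ae ?_
        filter_upwards [hne] with ρ hρ
        exact (norm_indicator_le_norm_self _ _).trans (hbound _ hl ρ hρ)
      · refine ae_restrict_of_ae ?_
        filter_upwards [hne, ae_apply_ne i (-σ i), ae_apply_ne i (x i - σ i)] with ρ r0 r1 r2
        have hmem := eventually_mem_latticeWindow_iff hij hn hratio (x := x) (ρ := ρ) (σ := σ)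
          (fun h => r1 (by linarith)) (fun h => r2 (by linarith)) s1 s2
        have hlim := hb.tendsto (fun l => n l i) (fun l => ceilMap (fun _ => n l i) ρ) ρ r0 (hn i)
          fun k => tendsto_ceil_mul_div (hn i) (ρ k)
        by_cases hρ : Pi.single i 1 * ρ + σ ∈ box x
        · rw [Set.indicator_of_mem (by exact hρ)]
          refine hlim.congr' ?_
          filter_upwards [hmem] with l hl
          rw [Set.indicator_of_mem (hl.2 hρ)]
        · rw [Set.indicator_of_notMem (by exact hρ)]
          refine tendsto_const_nhds.congr' ?_
          filter_upwards [hmem] with l hl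
          rw [Set.indicator_of_notMem (fun h => hρ (hl.1 h))]
    rw [setIntegral_indicator (measurableSet_strip σ), Set.inter_eq_right.2 hsub] at key
    refine key.congr' ?_
    filter_upwards [hev] with l hl
    have hi0 : 0 < n l i := by linarith [hl.1]
    rw [boxSum_eq_setIntegral_latticeWindow hi0,
      setIntegral_indicator (measurableSet_latticeWindow _ _ _ _),
      Set.inter_eq_right.2 (show _ ⊆ T from fun ρ hρ => (latticeWindow_subset hl.1 hl.2 hρ).1)]

end StripKernel

/-! ### Partial sums of the linear field -/

section PartialSums

variable {Ω : Type*} [MeasurableSpace Ω] {P : Measure Ω} [IsProbabilityMeasure P]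
  {ε : (Fin 2 → ℤ) → Ω → ℝ} {q : ℝ} {A : (Fin 2 → ℝ) → ℝ} {b : (Fin 2 → ℤ) → ℝ}

/-- The squares decay like `‖r‖^{-2q}`, summable over `ℤ²` because `2q > 2`. -/
theorem LatticeApprox.summable_sq (hb : LatticeApprox q A b) (hq : 1 < q) (t : Fin 2 → ℤ) :
    Summable fun s => b (t - s) ^ 2 := by
  obtain ⟨C, hC, hCb⟩ := hb.bound
  have h1 : Summable fun r => b r ^ 2 := by
    have h2 := (EisensteinSeries.summable_one_div_norm_rpow (k := 2 * q) (by linarith)).mul_left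
      (C ^ 2)
    have h3 : Summable fun r : Fin 2 → ℤ => C ^ 2 * (1 + ‖r‖) ^ (-(2 * q)) := by
      refine h2.of_norm_bounded_eventually ?_
      have h0 : ∀ᶠ r : Fin 2 → ℤ in cofinite, r ≠ 0 := by simp
      filter_upwards [h0] with r hr
      rw [Real.norm_of_nonneg (by positivity)]
      gcongr C ^ 2 * ?_
      exact Real.rpow_le_rpow_of_nonpos (norm_pos_iff.2 hr) (by linarith) (by linarith)
    refine h3.of_nonneg_of_le (fun r => sq_nonneg _) fun r => ?_
    calc b r ^ 2 = |b r| ^ 2 := (sq_abs _).symm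
      _ ≤ (C * (1 + ‖r‖) ^ (-q)) ^ 2 := by gcongr; exact hCb r
      _ = C ^ 2 * (1 + ‖r‖) ^ (-(2 * q)) := by
        rw [mul_pow, ← Real.rpow_natCast ((1 + ‖r‖) ^ (-q)), ← Real.rpow_mul (by positivity)]
        congr 2
        push_cast
        ring
  exact (Equiv.subLeft t).summable_iff.2 h1

theorem LatticeApprox.summable_maTerm (hb : LatticeApprox q A b) (hq : 1 < q)
    (hε : StandardIID ε P) (t : Fin 2 → ℤ) : Summable (maTerm hε b t) :=
  hε.summable_smul (hb.summable_sq hq t)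

/-- The anisotropic scales `(l, l^γ)`. -/
def scales (γ l : ℝ) : Fin 2 → ℝ := ![l, l ^ γ]

theorem tendsto_scales {γ : ℝ} (hγ : 0 < γ) (k : Fin 2) :
    Tendsto (fun l => scales γ l k) atTop atTop := by
  fin_cases k
  · exact tendsto_id
  · exact tendsto_rpow_atTop hγ

theorem LatticeApprox.hasSum_partialSum (hb : LatticeApprox q A b) (hq : 1 < q)
    (hε : StandardIID ε P) (γ l : ℝ) (x : Fin 2 → ℝ) :
    HasSum (fun s => boxSum b (fun k => ⌊scales γ l k * x k⌋) s • hε.toL2 s)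
      (partialSum (linearField hε b) γ l x) := by
  have hbox : Fintype.piFinset ![Finset.Ioc 0 ⌊l * x 0⌋, Finset.Ioc 0 ⌊l ^ γ * x 1⌋]
      = latticeBox fun k => ⌊scales γ l k * x k⌋ := by
    rw [latticeBox]
    congr 1
    ext k : 1
    fin_cases k <;> rfl
  rw [partialSum, hbox]
  have := hasSum_sum (s := latticeBox fun k => ⌊scales γ l k * x k⌋)
    fun t _ => (hb.summable_maTerm hq hε t).hasSum
  refine this.congr_fun fun s => ?_
  rw [boxSum, Finset.sum_smul]
  rfl

/-- The discretization grid `n` is kept separate from the scales `(l, l^γ)` of the rectangle; `w`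
combines the cell factor with the normalization `l^{-H}`. -/
theorem LatticeApprox.tendstoFDD_partialSum {Ω' : Type*} [MeasurableSpace Ω'] {P' : Measure Ω'}
    [IsProbabilityMeasure P'] (hb : LatticeApprox q A b) (hq : 1 < q)
    (hε : StandardIID ε P) {γ H : ℝ} {n : ℝ → Fin 2 → ℝ}
    (hn : ∀ k, Tendsto (fun l => n l k) atTop atTop) {w : ℝ → ℝ}
    (hw : ∀ᶠ l in atTop, √(n l 0 * n l 1) * (l ^ H)⁻¹ = w l)
    {h : (Fin 2 → ℝ) → (Fin 2 → ℝ) → ℝ} (hh : ∀ x, (∀ i, 0 < x i) → MemLp (h x) 2 volume)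
    (hlim : ∀ x, (∀ i, 0 < x i) → Tendsto (fun l => eLpNorm (fun σ => w l *
      boxSum b (fun k => ⌊scales γ l k * x k⌋) (ceilMap (n l) σ) - h x σ) 2 volume) atTop (𝓝 0))
    {Z : (Fin 2 → ℝ) → Ω' → ℝ} (hZ : ∀ x, AEMeasurable (Z x) P')
    (hlaw : ∀ (N : ℕ) (x : Fin N → Fin 2 → ℝ), (∀ k i, 0 < x k i) → ∀ θ : Fin N → ℝ,
      HasLaw (fun ω => ∑ k, θ k * Z (x k) ω)
        (gaussianReal 0 (∫ σ, (∑ k, θ k * h (x k) σ) ^ 2).toNNReal) P') :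
    TendstoFDD (fun l x ω => (l ^ H)⁻¹ * partialSum (linearField hε b) γ l x ω) P Z P' := by
  refine hε.tendstoFDD
    (C := fun l x s => (l ^ H)⁻¹ * boxSum b (fun k => ⌊scales γ l k * x k⌋) s)
    (Y := fun l x => (l ^ H)⁻¹ • partialSum (linearField hε b) γ l x) (fun l x => ?_) hn hh
    (fun x hx => ?_) (fun l x => ?_) hZ hlaw
  · refine ((hb.hasSum_partialSum hq hε γ l x).const_smul _).congr_fun fun s => ?_
    rw [smul_smul]
  · refine (hlim x hx).congr' ?_
    filter_upwards [hw] with l hl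
    congr with σ
    rw [← hl, mul_assoc]
  · filter_upwards [Lp.coeFn_smul (l ^ H)⁻¹ (partialSum (linearField hε b) γ l x)] with ω hω
    rw [hω, Pi.smul_apply, smul_eq_mul]

end PartialSums

/-! ### Stochastic integrals -/

namespace WhiteNoise

variable {Ω : Type*} [MeasurableSpace Ω] {P : Measure Ω} (W : WhiteNoise P)

theorem integral_of_memLp {h : (Fin 2 → ℝ) → ℝ} (hh : MemLp h 2 volume) :
    W.integral h = W.toLinearMap (hh.toLp h) := by
  rw [WhiteNoise.integral, dif_pos hh]

theorem aemeasurable_integral (h : (Fin 2 → ℝ) → ℝ) : AEMeasurable (W.integral h) P := by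
  by_cases hh : MemLp h 2 volume
  · rw [W.integral_of_memLp hh]
    exact (Lp.stronglyMeasurable _).aemeasurable
  · rw [WhiteNoise.integral, dif_neg hh]
    exact aemeasurable_const

theorem norm_toLp_sq {h : (Fin 2 → ℝ) → ℝ} (hh : MemLp h 2 volume) :
    ‖hh.toLp h‖ ^ 2 = ∫ σ, h σ ^ 2 := by
  rw [← real_inner_self_eq_norm_sq, L2.inner_def]
  refine integral_congr_ae ?_
  filter_upwards [hh.coeFn_toLp] with σ hσ
  simp [hσ, sq]

theorem hasLaw_integral {h : (Fin 2 → ℝ) → ℝ} (hh : MemLp h 2 volume) :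
    HasLaw (W.integral h) (gaussianReal 0 (∫ σ, h σ ^ 2).toNNReal) P := by
  have := W.hasLaw (hh.toLp h)
  have e : ‖hh.toLp h‖₊ ^ 2 = (∫ σ, h σ ^ 2).toNNReal := by
    rw [← norm_toLp_sq hh]
    ext
    simp
    rfl
  rw [integral_of_memLp W hh]
  rwa [e] at this

theorem sum_integral_ae_eq {ι : Type*} (s : Finset ι) {h : ι → (Fin 2 → ℝ) → ℝ}
    (hh : ∀ k ∈ s, MemLp (h k) 2 volume) (θ : ι → ℝ) :
    (fun ω => ∑ k ∈ s, θ k * W.integral (h k) ω)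
      =ᵐ[P] W.integral fun σ => ∑ k ∈ s, θ k * h k σ := by
  classical
  induction s using Finset.induction_on with
  | empty =>
    have h0 : MemLp (fun _ : Fin 2 → ℝ => (0 : ℝ)) 2 volume := MemLp.zero
    simp only [Finset.sum_empty]
    rw [integral_of_memLp W h0]
    have : h0.toLp (fun _ => (0 : ℝ)) = 0 := MemLp.toLp_zero h0
    rw [this, map_zero]
    exact (Lp.coeFn_zero _ _ _).symm
  | insert a s ha ih =>
    have hs : MemLp (fun σ => ∑ k ∈ s, θ k * h k σ) 2 volume :=
      memLp_finsetSum _ fun k hk => (hh k (Finset.mem_insert_of_mem hk)).const_mul _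
    have h1 := hh a (Finset.mem_insert_self _ _)
    have hall : MemLp (fun σ => ∑ k ∈ insert a s, θ k * h k σ) 2 volume :=
      memLp_finsetSum _ fun k hk => (hh k hk).const_mul _
    have e : hall.toLp _ = θ a • h1.toLp (h a) + hs.toLp _ := by
      rw [← MemLp.toLp_const_smul, ← MemLp.toLp_add]
      refine MemLp.toLp_congr _ _ (ae_of_all _ fun σ => ?_)
      simp [Finset.sum_insert ha]
    rw [integral_of_memLp W hall, e, map_add, map_smul]
    filter_upwards [ih fun k hk => hh k (Finset.mem_insert_of_mem hk),
      Lp.coeFn_add (θ a • W.toLinearMap (h1.toLp (h a))) (W.toLinearMap (hs.toLp _)),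
      Lp.coeFn_smul (θ a) (W.toLinearMap (h1.toLp (h a)))] with ω e1 e2 e3
    rw [Finset.sum_insert ha, e1, e2, Pi.add_apply, e3, Pi.smul_apply, smul_eq_mul,
      integral_of_memLp W hs, integral_of_memLp W h1]

theorem hasLaw_sum {ι : Type*} (s : Finset ι) {h : ι → (Fin 2 → ℝ) → ℝ}
    (hh : ∀ k ∈ s, MemLp (h k) 2 volume) (θ : ι → ℝ) :
    HasLaw (fun ω => ∑ k ∈ s, θ k * W.integral (h k) ω)
      (gaussianReal 0 (∫ σ, (∑ k ∈ s, θ k * h k σ) ^ 2).toNNReal) P :=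
  (W.hasLaw_integral (memLp_finsetSum _ fun k hk => (hh k hk).const_mul (θ k))).congr
    (W.sum_integral_ae_eq s hh θ)

end WhiteNoise

/-! ### Linear changes of variables -/

section ChangeOfVariables

variable {B : Matrix (Fin 2) (Fin 2) ℝ}

theorem map_mulVec_volume (hB : B.det ≠ 0) :
    (volume : Measure (Fin 2 → ℝ)).map (fun v => B *ᵥ v)
      = ENNReal.ofReal |B.det⁻¹| • volume :=
  Real.map_matrix_volume_pi_eq_smul_volume_pi hB

theorem ae_comp_mulVec (hB : B.det ≠ 0) {p : (Fin 2 → ℝ) → Prop} (h : ∀ᵐ u, p u) :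
    ∀ᵐ v, p (B *ᵥ v) := by
  refine ae_of_ae_map (continuous_mulVec B).aemeasurable ?_
  rw [map_mulVec_volume hB]
  exact Measure.ae_smul_measure h _

theorem det_inv_ne_zero (hB : B.det ≠ 0) : (B⁻¹).det ≠ 0 := by
  rw [Matrix.det_nonsing_inv, Ring.inverse_eq_inv']
  exact inv_ne_zero hB

theorem mulVec_inv_mulVec (hB : B.det ≠ 0) (v : Fin 2 → ℝ) : B *ᵥ (B⁻¹ *ᵥ v) = v := by
  rw [Matrix.mulVec_mulVec, Matrix.mul_nonsing_inv _ (isUnit_iff_ne_zero.2 hB), Matrix.one_mulVec]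

theorem inv_mulVec_mulVec (hB : B.det ≠ 0) (v : Fin 2 → ℝ) : B⁻¹ *ᵥ (B *ᵥ v) = v := by
  rw [Matrix.mulVec_mulVec, Matrix.nonsing_inv_mul _ (isUnit_iff_ne_zero.2 hB), Matrix.one_mulVec]

theorem memLp_comp_mulVec (hB : B.det ≠ 0) {h : (Fin 2 → ℝ) → ℝ} (hh : MemLp h 2 volume) :
    MemLp (fun v => h (B *ᵥ v)) 2 volume := by
  have h1 : MemLp h 2 ((volume : Measure (Fin 2 → ℝ)).map (fun v => B *ᵥ v)) := by
    rw [map_mulVec_volume hB]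
    exact hh.smul_measure ENNReal.ofReal_ne_top
  exact h1.comp_of_map (continuous_mulVec B).aemeasurable

theorem measurableEmbedding_mulVec (hB : B.det ≠ 0) :
    MeasurableEmbedding fun v : Fin 2 → ℝ => B *ᵥ v :=
  (continuous_mulVec B).measurableEmbedding fun v w h => by
    rw [← inv_mulVec_mulVec hB v, ← inv_mulVec_mulVec hB w]
    exact congrArg _ h

theorem integral_comp_mulVec (hB : B.det ≠ 0) (f : (Fin 2 → ℝ) → ℝ) :
    ∫ v, f (B *ᵥ v) = |B.det|⁻¹ * ∫ u, f u := by
  rw [← (measurableEmbedding_mulVec hB).integral_map, map_mulVec_volume hB, integral_smul_measure,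
    ENNReal.toReal_ofReal (abs_nonneg _), abs_inv, smul_eq_mul]

theorem setIntegral_comp_mulVec (hB : B.det ≠ 0) (f : (Fin 2 → ℝ) → ℝ) (s : Set (Fin 2 → ℝ)) :
    ∫ v in (fun v => B *ᵥ v) ⁻¹' s, f (B *ᵥ v) = |B.det|⁻¹ * ∫ u in s, f u := by
  rw [← (measurableEmbedding_mulVec hB).setIntegral_map, map_mulVec_volume hB,
    Measure.restrict_smul, integral_smul_measure, ENNReal.toReal_ofReal (abs_nonneg _), abs_inv,
    smul_eq_mul]

end ChangeOfVariables

/-! ### The kernels of the limit fields -/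

section LimitKernels

variable {q : ℝ} {a : (Fin 2 → ℝ) → ℝ} {B D : Matrix (Fin 2) (Fin 2) ℝ} {m : Fin 2 → ℝ}
  {i j : Fin 2}

theorem Btilde02_mulVec (t : Fin 2 → ℝ) :
    Btilde02 B *ᵥ t = B *ᵥ ((Function.update 1 0 0 : Fin 2 → ℝ) * t) := by
  ext k
  fin_cases k <;> simp [Btilde02, Matrix.mulVec, dotProduct, Fin.sum_univ_two]

theorem Btilde01_mulVec (t : Fin 2 → ℝ) :
    Btilde01 B *ᵥ t = B *ᵥ ((Function.update 1 1 0 : Fin 2 → ℝ) * t) := by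
  ext k
  fin_cases k <;> simp [Btilde01, Matrix.mulVec, dotProduct, Fin.sum_univ_two]

theorem B10_mulVec (hB : B.det ≠ 0) (ρ : Fin 2 → ℝ) : B10 B *ᵥ (B *ᵥ ρ) = Pi.single 0 1 * ρ := by
  have h := hB
  rw [Matrix.det_fin_two] at h
  ext k
  fin_cases k
  · simp only [B10, Matrix.mulVec, dotProduct, Fin.sum_univ_two, Matrix.det_fin_two]
    simp
    field_simp
    ring
  · simp [B10, Matrix.mulVec, dotProduct, Fin.sum_univ_two]

theorem B20_mulVec (hB : B.det ≠ 0) (ρ : Fin 2 → ℝ) : B20 B *ᵥ (B *ᵥ ρ) = Pi.single 1 1 * ρ := by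
  have h := hB
  rw [Matrix.det_fin_two] at h
  ext k
  fin_cases k
  · simp [B20, Matrix.mulVec, dotProduct, Fin.sum_univ_two]
  · simp only [B20, Matrix.mulVec, dotProduct, Fin.sum_univ_two, Matrix.det_fin_two]
    simp
    field_simp
    ring

theorem kernelTilde_mulVec (hD : ∀ t, D *ᵥ t = B *ᵥ (m * t)) (x σ : Fin 2 → ℝ) :
    kernelTilde a B D x (B *ᵥ σ)
      = |B.det| ^ (-(1 / 2) : ℝ) * smearedKernel (fun v => a (B *ᵥ v)) m x σ := by
  simp only [kernelTilde, smearedKernel, hD, Matrix.mulVec_sub]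

theorem vTildeWellDefined (hB : B.det ≠ 0) (hA : HomogeneousKernel q fun v => a (B *ᵥ v))
    (hD : ∀ t, D *ᵥ t = B *ᵥ (m * t))
    (hdom : ∀ x : Fin 2 → ℝ, (∀ k, 0 < x k) → SmearedDomination q m x) :
    VTildeWellDefined a B D := by
  intro x hx
  constructor
  · have h := ae_comp_mulVec (det_inv_ne_zero hB) (hA.ae_integrableOn_smeared (hdom x hx))
    filter_upwards [h] with u hu
    refine hu.congr (ae_of_all _ fun t => ?_)
    simp only [hD, Matrix.mulVec_sub, mulVec_inv_mulVec hB]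
  · have h := memLp_comp_mulVec (det_inv_ne_zero hB)
      ((hA.memLp_smearedKernel (hdom x hx)).const_mul (|B.det| ^ (-(1 / 2) : ℝ)))
    refine h.congr_norm ?_ (ae_of_all _ fun u => ?_)
    · refine h.aestronglyMeasurable.congr (ae_of_all _ fun u => ?_)
      simp only
      rw [← kernelTilde_mulVec hD, mulVec_inv_mulVec hB]
    · rw [← kernelTilde_mulVec hD, mulVec_inv_mulVec hB]

/-- Square integrals of combinations of the kernels `K` and `h` agree if
`K ∘ B = |det B|^{-1/2} h`. -/
theorem integral_mul_eq_of_comp_mulVec (hB : B.det ≠ 0) {K₁ K₂ h₁ h₂ : (Fin 2 → ℝ) → ℝ}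
    (e₁ : ∀ σ, K₁ (B *ᵥ σ) = |B.det| ^ (-(1 / 2) : ℝ) * h₁ σ)
    (e₂ : ∀ σ, K₂ (B *ᵥ σ) = |B.det| ^ (-(1 / 2) : ℝ) * h₂ σ) :
    ∫ u, K₁ u * K₂ u = ∫ σ, h₁ σ * h₂ σ := by
  have hd : 0 < |B.det| := abs_pos.2 hB
  have h1 := integral_comp_mulVec hB fun u => K₁ u * K₂ u
  have h2 : |B.det| ^ (-(1 / 2) : ℝ) * |B.det| ^ (-(1 / 2) : ℝ) = |B.det|⁻¹ := by
    rw [← Real.rpow_add hd, ← Real.rpow_neg_one]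
    norm_num
  simp only [e₁, e₂, mul_mul_mul_comm _ (h₁ _), h2, integral_const_mul] at h1
  exact (mul_left_cancel₀ (inv_ne_zero hd.ne') h1).symm

/-- The substitution `t = Bρ` cancels `|det B|⁻¹`; the noise variable is left unchanged. -/
theorem kernel_eq_stripKernel (hB : B.det ≠ 0) (hD : ∀ ρ, D *ᵥ (B *ᵥ ρ) = Pi.single i 1 * ρ)
    (x : Fin 2 → ℝ) : kernel a B D x = stripKernel (fun v => a (B *ᵥ v)) i x := by
  ext u
  rw [kernel, ← setIntegral_comp_mulVec hB, stripKernel]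
  simp only [Set.preimage_ofPred_eq, hD]

theorem integrableOn_mulVec_iff (hB : B.det ≠ 0) {f : (Fin 2 → ℝ) → ℝ} {s : Set (Fin 2 → ℝ)} :
    IntegrableOn (fun v => f (B *ᵥ v)) ((fun v => B *ᵥ v) ⁻¹' s) ↔ IntegrableOn f s := by
  have h := (measurableEmbedding_mulVec hB).integrableOn_map_iff (μ := volume) (f := f) (s := s)
  rw [map_mulVec_volume hB, IntegrableOn, Measure.restrict_smul, integrable_smul_measure
    (ENNReal.ofReal_pos.2 (abs_pos.2 (inv_ne_zero hB))).ne' ENNReal.ofReal_ne_top] at h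
  exact h.symm

/-- Square integrability of the strip kernel is a by-product of the scaling limit, so some pair of
scales must be exhibited; any will do. -/
theorem exists_scales_ratio (hij : j ≠ i) : ∃ n : ℝ → Fin 2 → ℝ,
    (∀ k, Tendsto (fun l => n l k) atTop atTop) ∧
      Tendsto (fun l => n l i / n l j) atTop (𝓝 0) := by
  refine ⟨fun l => Function.update (fun _ => l ^ 2) i l, fun k => ?_, ?_⟩
  · by_cases hk : k = i
    · subst hk
      simp only [Function.update_self]
      exact tendsto_id
    · simp [hk]
  · simp only [Function.update_self, Function.update_of_ne hij]
    refine tendsto_inv_atTop_zero.congr' ?_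
    filter_upwards [eventually_ne_atTop 0] with l hl
    field_simp

theorem LatticeApprox.memLp_stripKernel {A : (Fin 2 → ℝ) → ℝ} {b : (Fin 2 → ℤ) → ℝ}
    (hb : LatticeApprox q A b) (h1 : 3 / 2 < q) (h2 : q < 2) {x : Fin 2 → ℝ} (hx : ∀ k, 0 < x k)
    (hij : j ≠ i) : MemLp (stripKernel A i x) 2 volume := by
  obtain ⟨n, hn, hratio⟩ := exists_scales_ratio hij
  exact (hb.memLp_and_tendsto_boxSum_strip h1 h2 hx hij hn hratio).1

theorem vWellDefined {b : (Fin 2 → ℤ) → ℝ} (hB : B.det ≠ 0)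
    (hA : HomogeneousKernel q fun v => a (B *ᵥ v)) (hb : LatticeApprox q (fun v => a (B *ᵥ v)) b)
    (h1 : 3 / 2 < q) (h2 : q < 2) (hij : j ≠ i)
    (hD : ∀ ρ, D *ᵥ (B *ᵥ ρ) = Pi.single i 1 * ρ) : VWellDefined a B D := by
  intro x hx
  refine ⟨ae_of_all _ fun u => ?_, ?_⟩
  · rw [← integrableOn_mulVec_iff hB]
    simp only [Set.preimage_ofPred_eq, hD]
    exact hA.integrableOn_strip hij h1 h2 u
  · rw [kernel_eq_stripKernel hB hD]
    exact hb.memLp_stripKernel h1 h2 hx hij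

theorem preimage_inv_mulVec (hB : B.det ≠ 0) (x u : Fin 2 → ℝ) :
    (fun v => B *ᵥ v) ⁻¹' {t | B⁻¹ *ᵥ t + u ∈ box x} = (fun ρ => ρ + u) ⁻¹' box x := by
  ext ρ
  simp only [Set.mem_preimage, Set.mem_ofPred_eq, inv_mulVec_mulVec hB]

theorem kernel_inv_eq_smearedKernel (hB : B.det ≠ 0) (x : Fin 2 → ℝ) :
    kernel a B B⁻¹ x = smearedKernel (fun v => a (B *ᵥ v)) 1 x := by
  ext u
  rw [kernel, ← setIntegral_comp_mulVec hB, preimage_inv_mulVec hB, smearedKernel]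
  have := (measurePreserving_add_right volume u).setIntegral_preimage_emb
    (measurableEmbedding_addRight u) (fun t => a (B *ᵥ (1 * t - u))) (box x)
  simpa using this

theorem vWellDefined_inv (hB : B.det ≠ 0) (hA : HomogeneousKernel q fun v => a (B *ᵥ v))
    (h1 : 1 < q) (h2 : q < 2) : VWellDefined a B B⁻¹ := by
  intro x hx
  constructor
  · filter_upwards [hA.ae_integrableOn_smeared (smearedDomination_one h1 h2 hx)] with u hu
    rw [← integrableOn_mulVec_iff hB, preimage_inv_mulVec hB]
    have := ((measurePreserving_add_right volume u).integrableOn_comp_preimage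
      (measurableEmbedding_addRight u)).2 hu
    refine this.congr (ae_of_all _ fun ρ => ?_)
    simp
  · rw [kernel_inv_eq_smearedKernel hB]
    exact hA.memLp_smearedKernel (smearedDomination_one h1 h2 hx)

end LimitKernels

/-! ### Convergence of the partial sums -/

section Convergence

variable {Ω Ω' : Type*} [MeasurableSpace Ω] [MeasurableSpace Ω'] {P : Measure Ω}
  [IsProbabilityMeasure P] {P' : Measure Ω'} [IsProbabilityMeasure P'] {ε : (Fin 2 → ℤ) → Ω → ℝ}
  {q : ℝ} {b : (Fin 2 → ℤ) → ℝ} {a : (Fin 2 → ℝ) → ℝ} {B D : Matrix (Fin 2) (Fin 2) ℝ}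

theorem LatticeApprox.tendstoFDD_integral {A : (Fin 2 → ℝ) → ℝ}
    (hb : LatticeApprox q A b) (hq : 1 < q) (hε : StandardIID ε P) (W : WhiteNoise P')
    {γ H : ℝ} {n : ℝ → Fin 2 → ℝ} (hn : ∀ k, Tendsto (fun l => n l k) atTop atTop) {w : ℝ → ℝ}
    (hw : ∀ᶠ l in atTop, √(n l 0 * n l 1) * (l ^ H)⁻¹ = w l)
    {h : (Fin 2 → ℝ) → (Fin 2 → ℝ) → ℝ} (hh : ∀ x, (∀ i, 0 < x i) → MemLp (h x) 2 volume)
    (hlim : ∀ x, (∀ i, 0 < x i) → Tendsto (fun l => eLpNorm (fun σ => w l *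
      boxSum b (fun k => ⌊scales γ l k * x k⌋) (ceilMap (n l) σ) - h x σ) 2 volume) atTop (𝓝 0)) :
    TendstoFDD (fun l x ω => (l ^ H)⁻¹ * partialSum (linearField hε b) γ l x ω) P
      (fun x => W.integral (h x)) P' :=
  hb.tendstoFDD_partialSum hq hε hn hw hh hlim (fun _ => W.aemeasurable_integral _)
    fun _ x hx θ => W.hasLaw_sum _ (fun k _ => hh (x k) (hx k)) θ

/-- `Ṽ_D` integrates a kernel in `u = Bσ`, whereas the limit theorem produces one in `σ`. The factor
`|det B|^{-1/2}` makes the substitution unitary, so the variances, and hence the Gaussian laws,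
agree. -/
theorem LatticeApprox.tendstoFDD_vTilde (hB : B.det ≠ 0)
    (hb : LatticeApprox q (fun v => a (B *ᵥ v)) b) (hA : HomogeneousKernel q fun v => a (B *ᵥ v))
    (hq : 1 < q) (hε : StandardIID ε P) (W : WhiteNoise P') {m : Fin 2 → ℝ}
    (hD : ∀ t, D *ᵥ t = B *ᵥ (m * t))
    (hdom : ∀ x : Fin 2 → ℝ, (∀ k, 0 < x k) → SmearedDomination q m x)
    {γ H : ℝ} {n : ℝ → Fin 2 → ℝ} (hn : ∀ k, Tendsto (fun l => n l k) atTop atTop) {w : ℝ → ℝ}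
    (hw : ∀ᶠ l in atTop, √(n l 0 * n l 1) * (l ^ H)⁻¹ = w l)
    (hlim : ∀ x : Fin 2 → ℝ, (∀ i, 0 < x i) → Tendsto (fun l => eLpNorm (fun σ => w l *
      boxSum b (fun k => ⌊scales γ l k * x k⌋) (ceilMap (n l) σ)
        - smearedKernel (fun v => a (B *ᵥ v)) m x σ) 2 volume) atTop (𝓝 0)) :
    TendstoFDD (fun l x ω => (l ^ H)⁻¹ * partialSum (linearField hε b) γ l x ω) P
      (VTilde W a B D) P' := by
  refine hb.tendstoFDD_partialSum hq hε hn hw (fun x hx => hA.memLp_smearedKernel (hdom x hx)) hlim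
    (fun x => W.aemeasurable_integral _) fun N x hx θ => ?_
  have hK := vTildeWellDefined hB hA hD hdom
  have := W.hasLaw_sum Finset.univ (fun k _ => (hK (x k) (hx k)).2) θ
  have hc : ∀ σ, ∑ k, θ k * kernelTilde a B D (x k) (B *ᵥ σ) = |B.det| ^ (-(1 / 2) : ℝ) *
      ∑ k, θ k * smearedKernel (fun v => a (B *ᵥ v)) m (x k) σ := by
    intro σ
    simp only [kernelTilde_mulVec hD, Finset.mul_sum]
    exact Finset.sum_congr rfl fun k _ => by ring
  have e := integral_mul_eq_of_comp_mulVec hB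
    (K₁ := fun u => ∑ k, θ k * kernelTilde a B D (x k) u)
    (K₂ := fun u => ∑ k, θ k * kernelTilde a B D (x k) u) hc hc
  simp only [← sq] at e
  rwa [e] at this

theorem sqrt_mul_inv_rpow_eq {n : Fin 2 → ℝ} {l α β H c : ℝ} (hl : 0 < l) (h0 : n 0 = l ^ α)
    (h1 : n 1 = l ^ β) (hc : c = (α + β) / 2 - H) : √(n 0 * n 1) * (l ^ H)⁻¹ = l ^ c := by
  rw [h0, h1, ← Real.rpow_add hl, Real.sqrt_eq_rpow, ← Real.rpow_mul hl.le, ← Real.rpow_neg hl.le,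
    ← Real.rpow_add hl, hc]
  congr 1
  ring

theorem scales_zero (γ l : ℝ) : scales γ l 0 = l := rfl

theorem scales_one (γ l : ℝ) : scales γ l 1 = l ^ γ := rfl

theorem tendsto_div_rpow_zero {γ : ℝ} (hγ : 1 < γ) :
    Tendsto (fun l : ℝ => l / l ^ γ) atTop (𝓝 0) := by
  refine (tendsto_rpow_neg_atTop (y := γ - 1) (by linarith)).congr' ?_
  filter_upwards [eventually_gt_atTop 0] with l hl
  nth_rw 2 [← Real.rpow_one l]
  rw [← Real.rpow_sub hl]
  congr 1
  ring

theorem tendsto_rpow_div_zero {γ : ℝ} (hγ : γ < 1) :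
    Tendsto (fun l : ℝ => l ^ γ / l) atTop (𝓝 0) := by
  refine (tendsto_rpow_neg_atTop (y := 1 - γ) (by linarith)).congr' ?_
  filter_upwards [eventually_gt_atTop 0] with l hl
  nth_rw 3 [← Real.rpow_one l]
  rw [← Real.rpow_sub hl]
  congr 1
  ring

variable (hB : B.det ≠ 0) (hb : LatticeApprox q (fun v => a (B *ᵥ v)) b)
  (hA : HomogeneousKernel q fun v => a (B *ᵥ v)) (hε : StandardIID ε P) (W : WhiteNoise P')

theorem smearedDomination_update (h1 : 1 < q) (h2 : q < 3 / 2) (i : Fin 2) {x : Fin 2 → ℝ}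
    (hx : ∀ k, 0 < x k) : SmearedDomination q (Function.update 1 i 0) x :=
  smearedDomination_degenerate h1 h2 hx (i := i) (by simp) fun k hk => by simp [hk]

include hB hb hA

/-- For `γ > 1` the first direction is the short one and the grid has mesh `l^{-γ}` both ways; the
exponent balances as `γ - (1 + γ(2 - q)) = γq - (1 + γ)`. -/
theorem tendstoFDD_Btilde02 (h1 : 1 < q) (h2 : q < 3 / 2) {γ : ℝ} (hγ : 1 < γ) :
    TendstoFDD (fun l x ω => (l ^ (1 + γ * (2 - q)))⁻¹ * partialSum (linearField hε b) γ l x ω) P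
      (VTilde W a B (Btilde02 B)) P' := by
  have hs := tendsto_scales (γ := γ) (by linarith)
  refine hb.tendstoFDD_vTilde hB hA h1 hε W Btilde02_mulVec
    (fun x hx => smearedDomination_update h1 h2 0 hx) (γ := γ)
    (n := fun l _ => scales γ l 1) (fun k => hs 1)
    (w := fun l => scales γ l 1 ^ q / (scales γ l 0 * scales γ l 1)) ?_ fun x hx =>
      ?_
  swap
  · exact hb.tendsto_boxSum_degenerate (i := 0) (j := 1) hA h1 h2 hx (by simp) hs
      (tendsto_div_rpow_zero hγ)
  filter_upwards [eventually_gt_atTop 0] with l hl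
  have e : scales γ l 1 ^ q / (scales γ l 0 * scales γ l 1) = l ^ (γ * q - (1 + γ)) := by
    rw [Real.rpow_sub hl, Real.rpow_add hl, Real.rpow_one, Real.rpow_mul hl.le, scales_zero,
      scales_one]
  rw [e]
  exact sqrt_mul_inv_rpow_eq (n := fun _ => scales γ l 1) hl (scales_one γ l)
    (scales_one γ l) (by ring)

theorem tendstoFDD_Btilde01 (h1 : 1 < q) (h2 : q < 3 / 2) {γ : ℝ} (hγ0 : 0 < γ) (hγ : γ < 1) :
    TendstoFDD (fun l x ω => (l ^ ((2 - q) + γ))⁻¹ * partialSum (linearField hε b) γ l x ω) P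
      (VTilde W a B (Btilde01 B)) P' := by
  have hs := tendsto_scales hγ0
  refine hb.tendstoFDD_vTilde hB hA h1 hε W Btilde01_mulVec
    (fun x hx => smearedDomination_update h1 h2 1 hx) (γ := γ)
    (n := fun l _ => scales γ l 0) (fun k => hs 0)
    (w := fun l => scales γ l 0 ^ q / (scales γ l 1 * scales γ l 0)) ?_ fun x hx =>
      ?_
  swap
  · exact hb.tendsto_boxSum_degenerate (i := 1) (j := 0) hA h1 h2 hx (by simp) hs
      (tendsto_rpow_div_zero hγ)
  filter_upwards [eventually_gt_atTop 0] with l hl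
  have e : scales γ l 0 ^ q / (scales γ l 1 * scales γ l 0) = l ^ (q - (γ + 1)) := by
    rw [Real.rpow_sub hl, Real.rpow_add hl, Real.rpow_one, scales_zero, scales_one, mul_comm]
  rw [e]
  exact sqrt_mul_inv_rpow_eq (n := fun _ => scales γ l 0) hl (Real.rpow_one l).symm
    (Real.rpow_one l).symm (by ring)

omit hB hA in
theorem tendsto_boxSum_scales_one (h1 : 1 < q) (h2 : q < 2) {x : Fin 2 → ℝ} (hx : ∀ k, 0 < x k) :
    Tendsto (fun l => eLpNorm (fun σ => l ^ (q - 2) *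
      boxSum b (fun k => ⌊scales 1 l k * x k⌋) (ceilMap (fun _ => l) σ)
        - smearedKernel (fun v => a (B *ᵥ v)) 1 x σ) 2 volume) atTop (𝓝 0) := by
  have e : ∀ (l : ℝ) k, scales 1 l k = l := by
    intro l k
    fin_cases k <;> simp [scales]
  simp only [e]
  exact hb.tendsto_boxSum_isotropic h1 h2 hx tendsto_id

omit hB hb hA in
theorem eventually_weight_isotropic (q : ℝ) :
    ∀ᶠ l : ℝ in atTop, √(l * l) * (l ^ (3 - q))⁻¹ = l ^ (q - 2) := by
  filter_upwards [eventually_gt_atTop 0] with l hl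
  exact sqrt_mul_inv_rpow_eq (n := fun _ => l) hl (Real.rpow_one l).symm (Real.rpow_one l).symm
    (by ring)

theorem tendstoFDD_vTilde_isotropic (h1 : 1 < q) (h2 : q < 2) :
    TendstoFDD (fun l x ω => (l ^ (3 - q))⁻¹ * partialSum (linearField hε b) 1 l x ω) P
      (VTilde W a B B) P' :=
  hb.tendstoFDD_vTilde hB hA h1 hε W (m := 1) (fun t => by rw [one_mul])
    (fun x hx => smearedDomination_one h1 h2 hx) (n := fun l _ => l) (fun _ => tendsto_id)
    (eventually_weight_isotropic q) fun _ hx => tendsto_boxSum_scales_one hb h1 h2 hx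

theorem tendstoFDD_v_isotropic (h1 : 1 < q) (h2 : q < 2) :
    TendstoFDD (fun l x ω => (l ^ (3 - q))⁻¹ * partialSum (linearField hε b) 1 l x ω) P
      (V W a B B⁻¹) P' := by
  have := hb.tendstoFDD_integral h1 hε W (n := fun l _ => l) (fun _ => tendsto_id)
    (eventually_weight_isotropic q)
    (fun _ hx => hA.memLp_smearedKernel (smearedDomination_one h1 h2 hx))
    fun _ hx => tendsto_boxSum_scales_one hb h1 h2 hx
  simp only [← kernel_inv_eq_smearedKernel hB] at this
  exact this

omit hA in
theorem tendstoFDD_v_of_strip (h1 : 3 / 2 < q) (h2 : q < 2) {i j : Fin 2} (hij : j ≠ i)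
    (hD : ∀ ρ, D *ᵥ (B *ᵥ ρ) = Pi.single i 1 * ρ) {γ H : ℝ} (hγ0 : 0 < γ)
    (hratio : Tendsto (fun l => scales γ l i / scales γ l j) atTop (𝓝 0))
    (hw : ∀ᶠ l in atTop, √(scales γ l 0 * scales γ l 1) * (l ^ H)⁻¹ = scales γ l i ^ (q - 2)) :
    TendstoFDD (fun l x ω => (l ^ H)⁻¹ * partialSum (linearField hε b) γ l x ω) P
      (V W a B D) P' := by
  have := hb.tendstoFDD_integral (by linarith) hε W (tendsto_scales hγ0) hw
    (fun x hx => hb.memLp_stripKernel h1 h2 hx hij)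
    fun x hx => (hb.memLp_and_tendsto_boxSum_strip h1 h2 hx hij (tendsto_scales hγ0) hratio).2
  simp only [← kernel_eq_stripKernel hB hD] at this
  exact this

omit hA in
-- The short scale is `l` and the grid is `(l, l^γ)`; the exponent balances as `(1 + γ)/2 - (5/2 -
-- q) - γ/2 = q - 2`.
theorem tendstoFDD_B10 (h1 : 3 / 2 < q) (h2 : q < 2) {γ : ℝ} (hγ : 1 < γ) :
    TendstoFDD (fun l x ω => (l ^ ((5 / 2 - q) + γ / 2))⁻¹ *
      partialSum (linearField hε b) γ l x ω) P (V W a B (B10 B)) P' := by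
  refine tendstoFDD_v_of_strip hB hb hε W h1 h2 (j := 1) (by simp) (B10_mulVec hB) (by linarith)
    (tendsto_div_rpow_zero hγ) ?_
  filter_upwards [eventually_gt_atTop 0] with l hl
  exact sqrt_mul_inv_rpow_eq hl (Real.rpow_one l).symm rfl (by ring)

omit hA in
theorem tendstoFDD_B20 (h1 : 3 / 2 < q) (h2 : q < 2) {γ : ℝ} (hγ0 : 0 < γ) (hγ : γ < 1) :
    TendstoFDD (fun l x ω => (l ^ (1 / 2 + γ * (5 / 2 - q)))⁻¹ *
      partialSum (linearField hε b) γ l x ω) P (V W a B (B20 B)) P' := by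
  refine tendstoFDD_v_of_strip hB hb hε W h1 h2 (j := 0) (by simp) (B20_mulVec hB) hγ0
    (tendsto_rpow_div_zero hγ) ?_
  filter_upwards [eventually_gt_atTop 0] with l hl
  have e : scales γ l 1 ^ (q - 2) = l ^ (γ * (q - 2)) := (Real.rpow_mul hl.le _ _).symm
  rw [e]
  exact sqrt_mul_inv_rpow_eq hl (Real.rpow_one l).symm rfl (by ring)

end Convergence

/-! ### Fractional Brownian sheets as stochastic integrals -/

theorem integral_add_sq {α : Type*} [MeasurableSpace α] {μ : Measure α} {f g : α → ℝ}
    (hf : MemLp f 2 μ) (hg : MemLp g 2 μ) :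
    ∫ z, (f z + g z) ^ 2 ∂μ = ∫ z, f z ^ 2 ∂μ + ∫ z, g z ^ 2 ∂μ + 2 * ∫ z, f z * g z ∂μ := by
  have i1 := hf.integrable_sq
  have i2 := hg.integrable_sq
  have i3 : Integrable (fun z => f z * g z) μ := hf.integrable_mul hg
  have i12 : Integrable (fun z => f z ^ 2 + g z ^ 2) μ := i1.add i2
  rw [← integral_add i1 i2, ← integral_const_mul, ← integral_add i12 (i3.const_mul 2)]
  exact integral_congr_ae (ae_of_all _ fun z => by ring)

/-- The covariance function of the fractional Brownian sheet with Hurst parameters `H`. -/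
def sheetCov (H x y : Fin 2 → ℝ) : ℝ :=
  1 / 4 * ∏ k, (x k ^ (2 * H k) + y k ^ (2 * H k) - |x k - y k| ^ (2 * H k))

/-- The stochastic integrals of the kernels `K` form a multiple of a fractional Brownian sheet. -/
structure IsSheetKernel (H : Fin 2 → ℝ) (s : ℝ) (K : (Fin 2 → ℝ) → (Fin 2 → ℝ) → ℝ) : Prop where
  memLp : ∀ x, (∀ k, 0 < x k) → MemLp (K x) 2 volume
  integral_mul : ∀ x y, (∀ k, 0 < x k) → (∀ k, 0 < y k) →
    ∫ σ, K x σ * K y σ = s * sheetCov H x y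

theorem sheetCov_self {H x : Fin 2 → ℝ} (hH : ∀ k, 0 < H k) :
    sheetCov H x x = ∏ k, x k ^ (2 * H k) := by
  have h : ∀ k, (0 : ℝ) ^ (2 * H k) = 0 := fun k => Real.zero_rpow (by linarith [hH k])
  simp only [sheetCov, sub_self, abs_zero, h, Fin.prod_univ_two]
  ring

section Sheet

variable {Ω : Type*} [MeasurableSpace Ω] {P : Measure Ω} (W : WhiteNoise P)
  {H H' : Fin 2 → ℝ} {s s' : ℝ} {K K' : (Fin 2 → ℝ) → (Fin 2 → ℝ) → ℝ}

theorem WhiteNoise.integral_integral {h : (Fin 2 → ℝ) → ℝ} (hh : MemLp h 2 volume) :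
    ∫ ω, W.integral h ω ∂P = 0 := by
  rw [(W.hasLaw_integral hh).integral_eq]
  simp

theorem WhiteNoise.memLp_integral (h : (Fin 2 → ℝ) → ℝ) : MemLp (W.integral h) 2 P := by
  by_cases hh : MemLp h 2 volume
  · rw [W.integral_of_memLp hh]
    exact Lp.memLp _
  · rw [WhiteNoise.integral, dif_neg hh]
    exact MemLp.zero

theorem WhiteNoise.integral_sq_integral {h : (Fin 2 → ℝ) → ℝ} (hh : MemLp h 2 volume) :
    ∫ ω, W.integral h ω ^ 2 ∂P = ∫ σ, h σ ^ 2 := by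
  have h1 := (W.hasLaw_integral hh).variance_eq
  rw [variance_of_integral_eq_zero (W.aemeasurable_integral h) (W.integral_integral hh),
    variance_id_gaussianReal] at h1
  rw [h1, Real.coe_toNNReal _ (integral_nonneg fun σ => sq_nonneg _)]

/-- Polarization: the structure prescribes only the variances, and covariances follow by linearity.
-/
theorem WhiteNoise.integral_mul_integral {h g : (Fin 2 → ℝ) → ℝ} (hh : MemLp h 2 volume)
    (hg : MemLp g 2 volume) :
    ∫ ω, W.integral h ω * W.integral g ω ∂P = ∫ σ, h σ * g σ := by
  have hadd : ∀ᵐ ω ∂P, W.integral (fun σ => h σ + g σ) ω = W.integral h ω + W.integral g ω := by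
    have := W.sum_integral_ae_eq Finset.univ (h := ![h, g])
      (fun k _ => by fin_cases k <;> assumption) 1
    filter_upwards [this] with ω hω
    simpa [Fin.sum_univ_two] using hω.symm
  have hsum : MemLp (fun σ => h σ + g σ) 2 volume := hh.add hg
  have e1 := W.integral_sq_integral hsum
  have e2 : ∫ ω, W.integral (fun σ => h σ + g σ) ω ^ 2 ∂P
      = ∫ ω, (W.integral h ω + W.integral g ω) ^ 2 ∂P :=
    integral_congr_ae (by filter_upwards [hadd] with ω hω; rw [hω])
  rw [e2, integral_add_sq (W.memLp_integral h) (W.memLp_integral g), integral_add_sq hh hg,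
    W.integral_sq_integral hh, W.integral_sq_integral hg] at e1
  linarith

theorem WhiteNoise.gaussian_integrals [IsProbabilityMeasure P] {T : Type*}
    {h : T → (Fin 2 → ℝ) → ℝ} (hh : ∀ t, MemLp (h t) 2 volume) :
    IsGaussianProcess (fun t => W.integral (h t)) P := by
  classical
  refine ⟨fun I => ?_⟩
  have hm : AEMeasurable (fun ω => I.restrict fun t => W.integral (h t) ω) P :=
    aemeasurable_pi_lambda _ fun t => W.aemeasurable_integral _
  refine ⟨isGaussian_of_map_eq_gaussianReal fun L => ?_⟩
  have hL : ∀ z : I → ℝ, L z = ∑ t : I, L (Pi.single t 1) * z t := by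
    intro z
    have e : z = ∑ t : I, z t • Pi.single t (1 : ℝ) := by
      ext t
      simp [Finset.sum_apply, Pi.single_apply]
    conv_lhs => rw [e]
    rw [map_sum]
    exact Finset.sum_congr rfl fun t _ => by rw [map_smul, smul_eq_mul, mul_comm]
  have h1 := W.hasLaw_sum (Finset.univ : Finset I) (h := fun t => h t) (fun t _ => hh t)
    fun t => L (Pi.single t 1)
  refine ⟨0, (∫ σ, (∑ t : I, L (Pi.single t 1) * h t σ) ^ 2).toNNReal, ?_⟩
  rw [AEMeasurable.map_map_of_aemeasurable L.continuous.aemeasurable hm, ← h1.map_eq]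
  congr 1
  ext ω
  simp only [Function.comp_apply]
  rw [hL]
  rfl

namespace IsSheetKernel

theorem eq_integral_sq (hK : IsSheetKernel H s K) (hH : ∀ k, 0 < H k) : s = ∫ σ, K 1 σ ^ 2 := by
  have h1 := hK.integral_mul 1 1 (fun _ => one_pos) fun _ => one_pos
  rw [sheetCov_self hH] at h1
  simp only [← sq] at h1
  simp [h1]

theorem nonneg (hK : IsSheetKernel H s K) (hH : ∀ k, 0 < H k) : 0 ≤ s := by
  rw [hK.eq_integral_sq hH]
  exact integral_nonneg fun σ => sq_nonneg _

theorem sd_eq (hK : IsSheetKernel H s K) (hH : ∀ k, 0 < H k) :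
    sd (fun x => W.integral (K x)) P = √s := by
  rw [sd, W.integral_sq_integral (hK.memLp 1 fun _ => one_pos), hK.eq_integral_sq hH]

theorem isFBS [IsProbabilityMeasure P] (hK : IsSheetKernel H s K) (hs : 0 < s) :
    IsFBS (H 0) (H 1) (fun x ω => (√s)⁻¹ * W.integral (K x) ω) P where
  gaussian := (W.gaussian_integrals (T := {x : Fin 2 → ℝ // ∀ i, 0 < x i}) (h := fun x => K x)
    fun x => hK.memLp x x.2).smul fun _ => (√s)⁻¹
  mean x hx := by rw [integral_const_mul, W.integral_integral (hK.memLp x hx), mul_zero]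
  cov x y hx hy := by
    have e : ∀ ω, (√s)⁻¹ * W.integral (K x) ω * ((√s)⁻¹ * W.integral (K y) ω)
        = s⁻¹ * (W.integral (K x) ω * W.integral (K y) ω) := by
      intro ω
      rw [mul_mul_mul_comm, ← mul_inv, Real.mul_self_sqrt hs.le]
    simp only [e]
    rw [integral_const_mul, W.integral_mul_integral (hK.memLp x hx) (hK.memLp y hy),
      hK.integral_mul x y hx hy, inv_mul_cancel_left₀ hs.ne', sheetCov, Fin.prod_univ_two]

/-- For `s > 0` the sheet is the normalized field. For `s = 0` the field vanishes almost surely, but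
a sheet on the same probability space must still be produced; the nondegenerate kernel `K'` supplies
it. -/
theorem eqScaledFBS [IsProbabilityMeasure P] (hK : IsSheetKernel H s K) (hH : ∀ k, 0 < H k)
    (hK' : IsSheetKernel H s' K') (hs' : 0 < s') :
    EqScaledFBS (H 0) (H 1) (fun x => W.integral (K x)) P := by
  have hm : ∀ (n : ℕ) (x : Fin n → Fin 2 → ℝ),
      AEMeasurable (fun ω k => W.integral (K (x k)) ω) P :=
    fun n x => aemeasurable_pi_lambda _ fun k => W.aemeasurable_integral _
  rcases (hK.nonneg hH).eq_or_lt with hs | hs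
  · refine ⟨_, hK'.isFBS W hs', fun n x hx => IdentDistrib.of_ae_eq (hm n x) ?_⟩
    have h0 : ∀ k, ∀ᵐ ω ∂P, W.integral (K (x k)) ω = 0 := by
      intro k
      have h1 := W.integral_sq_integral (hK.memLp (x k) (hx k))
      have h2 := hK.integral_mul _ _ (hx k) (hx k)
      rw [← hs, zero_mul] at h2
      simp only [← sq] at h2
      rw [h2, integral_eq_zero_iff_of_nonneg (fun ω => sq_nonneg _)
        (W.memLp_integral _).integrable_sq] at h1
      filter_upwards [h1] with ω hω
      simpa using hω
    filter_upwards [ae_all_iff.2 h0] with ω hω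
    ext k
    rw [hω k, hK.sd_eq W hH, ← hs]
    simp
  · refine ⟨_, hK.isFBS W hs, fun n x hx => ?_⟩
    have e : ∀ z, sd (fun x => W.integral (K x)) P * ((√s)⁻¹ * z) = z := by
      intro z
      rw [hK.sd_eq W hH, mul_inv_cancel_left₀ (Real.sqrt_pos.2 hs).ne']
    simp only [e]
    exact IdentDistrib.refl (hm n x)

/-- Comparing the variances at `(1, 1)` and `(2, 1)` gives `2^{2 H₀} = 2^{2 H'₀}` unless both fields
vanish. -/
theorem notProportional (hK : IsSheetKernel H s K) (hK' : IsSheetKernel H' s' K')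
    (hH : ∀ k, 0 < H k) (hH' : ∀ k, 0 < H' k) (hne : H 0 ≠ H' 0) :
    NotProportional (fun x => W.integral (K x)) (fun x => W.integral (K' x)) P := by
  intro hsd c hc heq
  have key : ∀ x : Fin 2 → ℝ, (∀ k, 0 < x k) →
      s * sheetCov H x x = c ^ 2 * (s' * sheetCov H' x x) := by
    intro x hx
    have h1 := ((heq 1 (fun _ => x) fun _ => hx).comp (u := fun z : Fin 1 → ℝ => z 0 ^ 2)
      (by fun_prop)).integral_eq
    simp only [Function.comp_def, mul_pow] at h1
    rw [integral_const_mul, W.integral_sq_integral (hK.memLp x hx),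
      W.integral_sq_integral (hK'.memLp x hx)] at h1
    rw [← hK.integral_mul x x hx hx, ← hK'.integral_mul x x hx hx]
    simpa only [← sq] using h1
  have h1 := key 1 fun _ => one_pos
  have h2 := key ![2, 1] fun k => by fin_cases k <;> simp
  rw [sheetCov_self hH, sheetCov_self hH'] at h1 h2
  simp [Fin.prod_univ_two] at h1 h2
  rw [h1] at h2
  by_cases hs' : s' = 0
  · rw [hs', mul_zero] at h1
    exact hsd ⟨by rw [hK.sd_eq W hH, h1, Real.sqrt_zero],
      by rw [hK'.sd_eq W hH', hs', Real.sqrt_zero]⟩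
  · rw [mul_assoc] at h2
    have h3 := mul_left_cancel₀ hs' (mul_left_cancel₀ (pow_ne_zero 2 hc.ne') h2)
    have h4 := (Real.strictMono_rpow_of_base_gt_one one_lt_two).injective h3
    exact hne (by linarith)

/-- Kernels with stationary increments and power law variance in the direction `k`. -/
theorem integral_mul_of_increments (hK : ∀ x, (∀ k, 0 < x k) → MemLp (K x) 2 volume) {k : Fin 2}
    {h : ℝ} (hh : 0 < h) {r : ℝ → ℝ}
    (hvar : ∀ x, (∀ k, 0 < x k) → ∀ i ≠ k, ∫ σ, K x σ ^ 2 = r (x i) * x k ^ (2 * h))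
    (hinc : ∀ x y, (∀ k, 0 < x k) → (∀ k, 0 < y k) → (∀ i ≠ k, x i = y i) → x k < y k →
      ∫ σ, (K y σ - K x σ) ^ 2 = ∫ σ, K (Function.update y k (y k - x k)) σ ^ 2)
    {x y : Fin 2 → ℝ} (hx : ∀ k, 0 < x k) (hy : ∀ k, 0 < y k) {i : Fin 2} (hik : i ≠ k)
    (hxy : x i = y i) :
    ∫ σ, K x σ * K y σ
      = r (x i) * (1 / 2 * (x k ^ (2 * h) + y k ^ (2 * h) - |x k - y k| ^ (2 * h))) := by
  have hik' : ∀ i' ≠ k, i' = i := fun i' hi' => by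
    fin_cases i <;> fin_cases i' <;> fin_cases k <;> simp_all
  wlog hlt : x k ≤ y k generalizing x y
  · have := this hy hx hxy.symm (le_of_not_ge hlt)
    rw [abs_sub_comm, hxy, add_comm (x k ^ (2 * h)), ← this]
    simp only [mul_comm]
  rcases hlt.eq_or_lt with he | hlt
  · have : x = y := by
      ext i'
      by_cases hi' : i' = k
      · rw [hi', he]
      · rw [hik' i' hi', hxy]
    subst this
    simp only [← sq, hvar x hx i hik, sub_self, abs_zero, Real.zero_rpow (by linarith : 2 * h ≠ 0)]
    ring
  · have h1 := hinc x y hx hy (fun i' hi' => by rw [hik' i' hi', hxy]) hlt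
    have hpos : ∀ k', 0 < Function.update y k (y k - x k) k' := by
      intro k'
      by_cases hk' : k' = k
      · subst hk'; simpa using hlt
      · simpa [hk'] using hy k'
    rw [hvar _ hpos i hik, Function.update_self, Function.update_of_ne hik] at h1
    have hneg : MemLp (fun σ => -K x σ) 2 volume := (hK x hx).neg
    -- Polarization: the covariance is half of the two variances minus the variance of the
    -- increment, which is again of power form.
    have h2 := integral_add_sq (hK y hy) hneg
    simp only [← sub_eq_add_neg, neg_sq, mul_neg, integral_neg] at h2
    rw [h1, hvar x hx i hik, hvar y hy i hik, hxy] at h2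
    rw [abs_sub_comm, abs_of_pos (sub_pos.2 hlt), hxy]
    simp only [mul_comm (K x _)]
    linarith

end IsSheetKernel

end Sheet

/-! ### Self-similarity and increments of the kernels -/

theorem prod_fin_two_eq {i j : Fin 2} (hij : j ≠ i) (f : Fin 2 → ℝ) : ∏ k, f k = f i * f j := by
  fin_cases i <;> fin_cases j <;> simp_all [Fin.prod_univ_two, mul_comm]

theorem diagonal_mulVec_eq_mul (d v : Fin 2 → ℝ) : Matrix.diagonal d *ᵥ v = d * v := by
  ext k
  rw [Matrix.mulVec_diagonal, Pi.mul_apply]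

theorem det_diagonal_ne_zero {d : Fin 2 → ℝ} (hd : ∀ k, 0 < d k) :
    (Matrix.diagonal d).det ≠ 0 := by
  rw [Matrix.det_diagonal]
  exact (Finset.prod_pos fun k _ => hd k).ne'

theorem setIntegral_comp_mul {d : Fin 2 → ℝ} (hd : ∀ k, 0 < d k) (f : (Fin 2 → ℝ) → ℝ)
    (s : Set (Fin 2 → ℝ)) :
    ∫ v in (fun v => d * v) ⁻¹' s, f (d * v) = (∏ k, d k)⁻¹ * ∫ u in s, f u := by
  have h := setIntegral_comp_mulVec (det_diagonal_ne_zero hd) f s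
  simp only [diagonal_mulVec_eq_mul] at h
  rw [h, Matrix.det_diagonal, abs_of_pos (Finset.prod_pos fun k _ => hd k)]

theorem integral_comp_inv_mul {d : Fin 2 → ℝ} (hd : ∀ k, 0 < d k) (f : (Fin 2 → ℝ) → ℝ) :
    ∫ v, f (d⁻¹ * v) = (∏ k, d k) * ∫ u, f u := by
  have hd' : ∀ k, 0 < d⁻¹ k := fun k => inv_pos.2 (hd k)
  have h := setIntegral_comp_mul hd' f Set.univ
  simp only [Set.preimage_univ, Measure.restrict_univ, Pi.inv_apply, Finset.prod_inv_distrib,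
    inv_inv] at h
  exact h

theorem mul_mem_box_iff {d x t : Fin 2 → ℝ} (hd : ∀ k, 0 < d k) :
    d * t ∈ box (d * x) ↔ t ∈ box x := by
  simp only [mem_box, Pi.mul_apply]
  exact forall_congr' fun k => and_congr (mul_pos_iff_of_pos_left (hd k))
    (mul_le_mul_iff_right₀ (hd k))

theorem box_diff_box {k : Fin 2} {x y : Fin 2 → ℝ} (hx : 0 < x k) (hxy : ∀ i ≠ k, x i = y i)
    (t : Fin 2 → ℝ) :
    t ∈ box y \ box x ↔ t - Pi.single k (x k) ∈ box (Function.update y k (y k - x k)) := by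
  obtain ⟨i, hik⟩ : ∃ i : Fin 2, i ≠ k := exists_ne k
  rw [Set.mem_sdiff, mem_box, mem_box, mem_box, forall_fin_two_iff hik, forall_fin_two_iff hik,
    forall_fin_two_iff hik]
  simp only [Pi.sub_apply, Pi.single_eq_same, Pi.single_eq_of_ne hik, Function.update_self,
    Function.update_of_ne hik, hxy i hik, sub_zero]
  constructor
  · rintro ⟨⟨⟨h1, h2⟩, h3⟩, h4⟩
    refine ⟨⟨?_, by linarith⟩, h3⟩
    by_contra h
    exact h4 ⟨⟨h1, by linarith⟩, h3⟩
  · rintro ⟨⟨h1, h2⟩, h3⟩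
    exact ⟨⟨⟨by linarith, by linarith⟩, h3⟩, fun h => by linarith [h.1.2]⟩

theorem box_subset_box {x y : Fin 2 → ℝ} (h : ∀ k, x k ≤ y k) : box x ⊆ box y := by
  intro t ht
  rw [mem_box] at ht ⊢
  exact fun k => ⟨(ht k).1, (ht k).2.trans (h k)⟩

theorem le_of_increment {k : Fin 2} {x y : Fin 2 → ℝ} (hxy : ∀ i ≠ k, x i = y i)
    (hlt : x k < y k) (i : Fin 2) : x i ≤ y i := by
  by_cases hi : i = k
  · rw [hi]; exact hlt.le
  · exact (hxy i hi).le

/-! ### Scaling and covariance of smeared kernels -/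

section Smeared

variable {q : ℝ} {A : (Fin 2 → ℝ) → ℝ} {i j : Fin 2}

/-- The substitution `t ↦ d t` gives the Jacobian `dᵢ dⱼ`, and homogeneity gives `dⱼ^{-q}` because
only direction `j` enters the integrand. The linearity in `dᵢ` is the origin of the Hurst index 1.
-/
theorem HomogeneousKernel.smearedKernel_mul (hA : HomogeneousKernel q A) (hij : j ≠ i)
    {d : Fin 2 → ℝ} (hd : ∀ k, 0 < d k) (x σ : Fin 2 → ℝ) :
    smearedKernel A (Function.update 1 i 0) (d * x) σ
      = d i * d j ^ (1 - q) * smearedKernel A (Function.update 1 i 0) x ((d j)⁻¹ • σ) := by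
  have h := setIntegral_comp_mul hd (fun t => A ((Function.update 1 i 0 : Fin 2 → ℝ) * t - σ))
    (box (d * x))
  have e1 : (fun t => d * t) ⁻¹' box (d * x) = box x := Set.ext fun t => mul_mem_box_iff hd
  have e2 : ∀ t : Fin 2 → ℝ, (Function.update 1 i 0 : Fin 2 → ℝ) * (d * t) - σ
      = d j • ((Function.update 1 i 0 : Fin 2 → ℝ) * t - (d j)⁻¹ • σ) := by
    intro t
    refine funext ((forall_fin_two_iff hij).2 ⟨?_, ?_⟩)
    · simp [(hd j).ne']
    · simp [hij, mul_sub, (hd j).ne']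
  rw [e1] at h
  simp only [e2, hA.homogeneous _ (hd j), integral_const_mul] at h
  rw [eq_inv_mul_iff_mul_eq₀ (Finset.prod_pos fun k _ => hd k).ne'] at h
  rw [smearedKernel, ← h, prod_fin_two_eq hij, smearedKernel, Real.rpow_sub (hd j), Real.rpow_one,
    Real.rpow_neg (hd j).le]
  ring

theorem HomogeneousKernel.smearedKernel_increment (hA : HomogeneousKernel q A) (hij : j ≠ i)
    (hdom : ∀ x : Fin 2 → ℝ, (∀ k, 0 < x k) → SmearedDomination q (Function.update 1 i 0) x)
    {x y : Fin 2 → ℝ} (hx : ∀ k, 0 < x k) (hy : ∀ k, 0 < y k) (hxy : ∀ k ≠ j, x k = y k)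
    (hlt : x j < y j) : ∀ᵐ σ : Fin 2 → ℝ, smearedKernel A (Function.update 1 i 0) y σ
      - smearedKernel A (Function.update 1 i 0) x σ
        = smearedKernel A (Function.update 1 i 0) (Function.update y j (y j - x j))
          (σ - Pi.single j (x j)) := by
  filter_upwards [hA.ae_integrableOn_smeared (hdom y hy)] with σ hσ
  rw [smearedKernel, smearedKernel, ← setIntegral_sdiff (measurableSet_box x) hσ
    (box_subset_box (le_of_increment hxy hlt)), smearedKernel]
  have e1 : box y \ box x = (fun t => t - Pi.single j (x j)) ⁻¹'
      box (Function.update y j (y j - x j)) := Set.ext (box_diff_box (hx j) hxy)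
  have h := (measurePreserving_sub_right volume
    (Pi.single j (x j) : Fin 2 → ℝ)).setIntegral_preimage_emb (measurableEmbedding_subRight _) (fun t => A ((Function.update 1 i 0 : Fin 2 → ℝ) * t
      - (σ - Pi.single j (x j)))) (box (Function.update y j (y j - x j)))
  rw [← h, e1]
  congr with t
  congr 1
  refine funext ((forall_fin_two_iff hij).2 ⟨?_, ?_⟩)
  · simp [hij.symm]
  · simp [hij]

theorem HomogeneousKernel.isSheetKernel_smearedKernel (hA : HomogeneousKernel q A) (hij : j ≠ i)
    (h1 : 1 < q) (h2 : q < 3 / 2) :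
    IsSheetKernel (Function.update (fun _ => 2 - q) i 1)
      (∫ σ, smearedKernel A (Function.update 1 i 0) 1 σ ^ 2)
      (smearedKernel A (Function.update 1 i 0)) := by
  have hdom : ∀ x : Fin 2 → ℝ, (∀ k, 0 < x k) →
      SmearedDomination q (Function.update 1 i 0) x :=
    fun x hx => smearedDomination_update h1 h2 i hx
  set K := smearedKernel A (Function.update 1 i 0) with hKdef
  set s := ∫ σ, K 1 σ ^ 2 with hs
  have hmem : ∀ x : Fin 2 → ℝ, (∀ k, 0 < x k) → MemLp (K x) 2 volume :=
    fun x hx => hA.memLp_smearedKernel (hdom x hx)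
  have hother : ∀ k ≠ j, k = i := fun k hk => by
    fin_cases i <;> fin_cases j <;> fin_cases k <;> simp_all
  have hvar : ∀ x : Fin 2 → ℝ, (∀ k, 0 < x k) → ∀ k ≠ j,
      ∫ σ, K x σ ^ 2 = s * x k ^ 2 * x j ^ (2 * (2 - q)) := by
    intro x hx k hk
    obtain rfl := hother k hk
    have e : ∀ σ, K x σ ^ 2
        = (x k * x j ^ (1 - q)) ^ 2 * K 1 ((fun _ => x j)⁻¹ * σ) ^ 2 := by
      intro σ
      have := hA.smearedKernel_mul hij hx 1 σ
      rw [mul_one] at this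
      rw [hKdef, this, mul_pow]
      rfl
    simp only [e]
    rw [integral_const_mul, integral_comp_inv_mul (d := fun _ => x j) (fun _ => hx j)
      fun σ => K 1 σ ^ 2, ← hs, Fin.prod_univ_two]
    -- The variance exponent is `2(1 - q)` from the squared kernel plus `2` from the isotropic
    -- rescaling of `σ`.
    have e2 : x j ^ (2 * (2 - q)) = (x j ^ (1 - q)) ^ 2 * (x j * x j) := by
      rw [← sq, ← mul_pow, ← Real.rpow_add_one (hx j).ne', ← Real.rpow_mul_natCast (hx j).le]
      congr 1
      push_cast
      ring
    rw [e2]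
    ring
  refine ⟨hmem, fun x y hx hy => ?_⟩
  -- Linearity in `xᵢ` reduces the covariance to side `1` in direction `i`, where only the
  -- increments along `j` matter.
  have hred : ∀ x : Fin 2 → ℝ, (∀ k, 0 < x k) → ∀ σ, K x σ = x i * K (Function.update x i 1) σ := by
    intro x hx σ
    have hd : ∀ k, 0 < (Function.update 1 i (x i) : Fin 2 → ℝ) k :=
      (forall_fin_two_iff hij).2 ⟨by simpa using hx i, by simp [hij]⟩
    have := hA.smearedKernel_mul hij hd (Function.update x i 1) σ
    have e : (Function.update 1 i (x i) : Fin 2 → ℝ) * Function.update x i 1 = x :=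
      funext ((forall_fin_two_iff hij).2 ⟨by simp, by simp [hij]⟩)
    rw [e] at this
    simpa [hij] using this
  have hpos : ∀ x : Fin 2 → ℝ, (∀ k, 0 < x k) → ∀ k, 0 < Function.update x i 1 k := fun x hx =>
    (forall_fin_two_iff hij).2 ⟨by simp, by simpa [hij] using hx j⟩
  have hcov := IsSheetKernel.integral_mul_of_increments hmem (k := j) (h := 2 - q)
    (r := fun u => s * u ^ 2) (by linarith) hvar
    (fun x y hx hy hxy hlt => by
      rw [integral_congr_ae (g := fun σ => K (Function.update y j (y j - x j))
        (σ - Pi.single j (x j)) ^ 2)]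
      · exact integral_sub_right_eq_self (fun σ => K (Function.update y j (y j - x j)) σ ^ 2) _
      · filter_upwards [hA.smearedKernel_increment hij hdom hx hy hxy hlt] with σ hσ
        rw [hσ])
    (hpos x hx) (hpos y hy) hij.symm (by simp)
  have e : ∀ σ, K x σ * K y σ
      = x i * y i * (K (Function.update x i 1) σ * K (Function.update y i 1) σ) := by
    intro σ
    rw [hred x hx, hred y hy]
    ring
  simp only [e]
  rw [integral_const_mul, hcov, sheetCov, prod_fin_two_eq hij]
  simp only [Function.update_self, Function.update_of_ne hij, mul_one, Real.rpow_two, sq_abs]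
  ring

end Smeared

/-! ### Scaling and covariance of strip kernels -/

section Strip

variable {q : ℝ} {A : (Fin 2 → ℝ) → ℝ} {b : (Fin 2 → ℤ) → ℝ} {i j : Fin 2}

/-- Both coordinates of `ρ` are rescaled by `dᵢ`, giving `dᵢ² dᵢ^{-q}`; the length in direction `j`
enters only through the cut-off on `σⱼ` and may be rescaled independently. -/
theorem HomogeneousKernel.stripKernel_mul (hA : HomogeneousKernel q A) (hij : j ≠ i)
    {d : Fin 2 → ℝ} (hd : ∀ k, 0 < d k) (x σ : Fin 2 → ℝ) :
    stripKernel A i (d * x) σ = d i ^ (2 - q) * stripKernel A i x (d⁻¹ * σ) := by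
  have h := setIntegral_comp_mul (d := fun _ => d i) (fun _ => hd i) A
    {ρ | Pi.single i 1 * ρ + σ ∈ box (d * x)}
  have e1 : (fun ρ => (fun _ => d i) * ρ) ⁻¹' {ρ | Pi.single i 1 * ρ + σ ∈ box (d * x)}
      = {ρ | Pi.single i 1 * ρ + d⁻¹ * σ ∈ box x} := by
    ext ρ
    have e : Pi.single i 1 * ((fun _ => d i) * ρ) + σ
        = d * (Pi.single i 1 * ρ + d⁻¹ * σ) := by
      refine funext ((forall_fin_two_iff hij).2 ⟨?_, ?_⟩)
      · simp [mul_add, (hd i).ne']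
      · simp [hij, (hd j).ne']
    rw [Set.mem_preimage, Set.mem_ofPred_eq, Set.mem_ofPred_eq, e, mul_mem_box_iff hd]
  have e2 : ∀ ρ : Fin 2 → ℝ, A ((fun _ => d i) * ρ) = d i ^ (-q) * A ρ := fun ρ =>
    hA.homogeneous _ (hd i) ρ
  rw [e1] at h
  simp only [e2, integral_const_mul, Fin.prod_univ_two] at h
  rw [eq_inv_mul_iff_mul_eq₀ (mul_pos (hd i) (hd i)).ne'] at h
  rw [stripKernel, ← h, stripKernel, Real.rpow_sub (hd i), Real.rpow_two, Real.rpow_neg (hd i).le]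
  ring

theorem HomogeneousKernel.stripKernel_increment (hA : HomogeneousKernel q A) (hij : j ≠ i)
    (h1 : 3 / 2 < q) (h2 : q < 2) {x y : Fin 2 → ℝ} (hx : ∀ k, 0 < x k)
    (hxy : ∀ k ≠ i, x k = y k) (hlt : x i < y i) (σ : Fin 2 → ℝ) :
    stripKernel A i y σ - stripKernel A i x σ
      = stripKernel A i (Function.update y i (y i - x i)) (σ - Pi.single i (x i)) := by
  rw [stripKernel, stripKernel, ← setIntegral_sdiff (measurableSet_strip σ)
    (hA.integrableOn_strip hij h1 h2 σ)
    fun ρ hρ => box_subset_box (le_of_increment hxy hlt) hρ, stripKernel]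
  congr 2
  ext ρ
  have := box_diff_box (hx i) hxy (Pi.single i 1 * ρ + σ)
  rw [add_sub_assoc] at this
  exact this

/-- Kernels vanish unless `0 < σⱼ ≤ xⱼ`, so a product sees only the smaller of the two sides. This
yields the covariance `min(xⱼ, yⱼ)`, that is, Hurst index 1/2. -/
theorem stripKernel_mul_stripKernel (hij : j ≠ i) {x y : Fin 2 → ℝ} (hxy : x j ≤ y j)
    (σ : Fin 2 → ℝ) : stripKernel A i x σ * stripKernel A i y σ
      = stripKernel A i x σ * stripKernel A i (Function.update y j (x j)) σ := by
  by_cases hσ : 0 < σ j ∧ σ j ≤ x j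
  · congr 1
    rw [stripKernel, stripKernel]
    congr 2
    ext ρ
    simp only [Set.mem_ofPred_eq, mem_strip_iff hij, Function.update_self,
      Function.update_of_ne hij.symm]
    exact and_congr_right fun _ => ⟨fun _ => hσ, fun _ => ⟨hσ.1, hσ.2.trans hxy⟩⟩
  · have h0 : stripKernel A i x σ = 0 := by
      have : {ρ : Fin 2 → ℝ | Pi.single i 1 * ρ + σ ∈ box x} = ∅ := by
        ext ρ
        simp only [Set.mem_ofPred_eq, mem_strip_iff hij, Set.mem_empty_iff_false, iff_false]
        exact fun h => hσ h.2
      rw [stripKernel, this, setIntegral_empty]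
    rw [h0, zero_mul, zero_mul]

theorem HomogeneousKernel.isSheetKernel_stripKernel (hA : HomogeneousKernel q A)
    (hb : LatticeApprox q A b) (hij : j ≠ i) (h1 : 3 / 2 < q) (h2 : q < 2) :
    IsSheetKernel (Function.update (fun _ => 5 / 2 - q) j (1 / 2))
      (∫ σ, stripKernel A i 1 σ ^ 2) (stripKernel A i) := by
  set s := ∫ σ, stripKernel A i 1 σ ^ 2 with hs
  have hmem : ∀ x : Fin 2 → ℝ, (∀ k, 0 < x k) → MemLp (stripKernel A i x) 2 volume :=
    fun x hx => hb.memLp_stripKernel h1 h2 hx hij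
  have hother : ∀ k ≠ i, k = j := fun k hk => by
    fin_cases i <;> fin_cases j <;> fin_cases k <;> simp_all
  have hvar : ∀ x : Fin 2 → ℝ, (∀ k, 0 < x k) → ∀ k ≠ i,
      ∫ σ, stripKernel A i x σ ^ 2 = s * x k * x i ^ (2 * (5 / 2 - q)) := by
    intro x hx k hk
    obtain rfl := hother k hk
    have e : ∀ σ, stripKernel A i x σ ^ 2
        = (x i ^ (2 - q)) ^ 2 * stripKernel A i 1 (x⁻¹ * σ) ^ 2 := by
      intro σ
      have := hA.stripKernel_mul hij hx 1 σ
      rw [mul_one] at this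
      rw [this, mul_pow]
    simp only [e]
    rw [integral_const_mul, integral_comp_inv_mul hx fun σ => stripKernel A i 1 σ ^ 2, ← hs,
      prod_fin_two_eq hij]
    -- The variance exponent is `2(2 - q)` from the squared kernel plus `1` from rescaling `σᵢ`.
    have e2 : x i ^ (2 * (5 / 2 - q)) = (x i ^ (2 - q)) ^ 2 * x i := by
      rw [← Real.rpow_mul_natCast (hx i).le, ← Real.rpow_add_one (hx i).ne']
      congr 1
      push_cast
      ring
    rw [e2]
    ring
  have hcov := fun x y hx hy hxy => IsSheetKernel.integral_mul_of_increments hmem (k := i)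
    (h := 5 / 2 - q) (r := fun u => s * u) (by linarith) hvar
    (fun x y hx hy hxy hlt => by
      simp only [hA.stripKernel_increment hij h1 h2 hx hxy hlt]
      exact integral_sub_right_eq_self
        (fun σ => stripKernel A i (Function.update y i (y i - x i)) σ ^ 2) _)
    (x := x) (y := y) hx hy hij hxy
  refine ⟨hmem, fun x y hx hy => ?_⟩
  wlog hle : x j ≤ y j generalizing x y
  · have := this y x hy hx (le_of_not_ge hle)
    simp only [mul_comm (stripKernel A i x _)]
    rw [this, sheetCov, sheetCov]
    congr! 3 with k
    rw [abs_sub_comm, add_comm]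
  have hpos : ∀ k, 0 < Function.update y j (x j) k :=
    (forall_fin_two_iff hij).2 ⟨by simpa [hij.symm] using hy i, by simpa using hx j⟩
  simp only [stripKernel_mul_stripKernel hij hle]
  rw [hcov x _ hx hpos (by simp), sheetCov, prod_fin_two_eq hij]
  simp only [Function.update_self, Function.update_of_ne hij.symm]
  norm_num
  rw [abs_sub_comm (x j), abs_of_nonneg (sub_nonneg.2 hle)]
  ring

end Strip

/-! ### The limit fields as fractional Brownian sheets -/

theorem CoeffAssumption.homogeneousKernel {q : ℝ} {B : Matrix (Fin 2) (Fin 2) ℝ}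
    {Lplus Lminus : ℝ → ℝ} {b : (Fin 2 → ℤ) → ℝ} (hb : CoeffAssumption q q B Lplus Lminus b) :
    HomogeneousKernel q fun v => aInfty q q Lplus Lminus (B *ᵥ v) :=
  (homogeneousKernel_aInfty hb.q₁_pos hb.continuousOn_Lplus hb.continuousOn_Lminus hb.L_one
    hb.L_neg_one).comp_mulVec hb.q₁_pos hb.det_ne_zero

/-- With `L = 1` the kernel is positive, so its limit field is nondegenerate. It provides the sheet
needed when the limit for the given `L±` has variance zero. -/
theorem CoeffAssumption.radial {q : ℝ} {B : Matrix (Fin 2) (Fin 2) ℝ}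
    {Lplus Lminus : ℝ → ℝ} {b : (Fin 2 → ℤ) → ℝ} (hb : CoeffAssumption q q B Lplus Lminus b) :
    CoeffAssumption q q B (fun _ => 1) (fun _ => 1)
      fun t => aInfty q q (fun _ => 1) (fun _ => 1) (B *ᵥ fun i => (t i : ℝ)) where
  q₁_pos := hb.q₁_pos
  q₂_pos := hb.q₂_pos
  one_lt_Q := hb.one_lt_Q
  Q_lt_two := hb.Q_lt_two
  det_ne_zero := hb.det_ne_zero
  continuousOn_Lplus := continuousOn_const
  continuousOn_Lminus := continuousOn_const
  L_one := rfl
  L_neg_one := rfl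
  asymp := ⟨0, tendsto_const_nhds, Eventually.of_forall fun t => by simp [aInfty]⟩

theorem aInfty_radial_pos {q : ℝ} {u : Fin 2 → ℝ} (hu : u ≠ 0) :
    0 < aInfty q q (fun _ => 1) (fun _ => 1) u := by
  have := rho_pos (q := q) hu
  simp only [aInfty, angular, ite_self, mul_one]
  positivity

theorem volume_box_one : volume (box 1) = 1 := by
  simp [box, volume_pi_pi]

theorem setIntegral_pos_of_ae_pos {f : (Fin 2 → ℝ) → ℝ} {s : Set (Fin 2 → ℝ)}
    (hs : volume s ≠ 0) (hf : IntegrableOn f s) (hpos : ∀ᵐ t, 0 < f t) : 0 < ∫ t in s, f t := by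
  rw [setIntegral_pos_iff_support_of_nonneg_ae
    ((ae_restrict_of_ae hpos).mono fun t ht => ht.le) hf]
  have : (Function.support f ∩ s : Set _) =ᵐ[volume] s := by
    filter_upwards [hpos] with t ht
    exact propext (and_iff_right ht.ne')
  rw [measure_congr this]
  exact pos_iff_ne_zero.2 hs

theorem integral_sq_pos {h : (Fin 2 → ℝ) → ℝ} (hh : MemLp h 2 volume)
    (hpos : ∀ᵐ σ, σ ∈ box 1 → 0 < h σ) : 0 < ∫ σ, h σ ^ 2 := by
  refine (integral_nonneg fun σ => sq_nonneg _).lt_of_ne' fun h0 => ?_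
  rw [integral_eq_zero_iff_of_nonneg (fun σ => sq_nonneg _) hh.integrable_sq] at h0
  have : volume (box 1) = 0 := by
    rw [measure_eq_zero_iff_ae_notMem]
    filter_upwards [hpos, h0] with σ h1 h2 h3
    have : h σ ^ 2 = 0 := h2
    exact (h1 h3).ne' (pow_eq_zero_iff two_ne_zero |>.1 this)
  rw [volume_box_one] at this
  exact one_ne_zero this

/-! ### Nondegeneracy for positive kernels -/

section PositiveKernel

variable {q : ℝ} {A : (Fin 2 → ℝ) → ℝ} {i j : Fin 2}

theorem HomogeneousKernel.integral_smearedKernel_sq_pos (hA : HomogeneousKernel q A)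
    (hpos : ∀ v, v ≠ 0 → 0 < A v) {m : Fin 2 → ℝ} (hm : ∃ k, m k ≠ 0)
    (hdom : SmearedDomination q m 1) : 0 < ∫ σ, smearedKernel A m 1 σ ^ 2 := by
  refine integral_sq_pos (hA.memLp_smearedKernel hdom) ?_
  filter_upwards [hA.ae_integrableOn_smeared hdom] with σ hσ _
  refine setIntegral_pos_of_ae_pos (by rw [volume_box_one]; exact one_ne_zero) hσ ?_
  filter_upwards [ae_mul_sub_ne_zero hm σ] with t ht
  exact hpos _ ht

theorem HomogeneousKernel.integral_stripKernel_sq_pos {b : (Fin 2 → ℤ) → ℝ}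
    (hA : HomogeneousKernel q A) (hb : LatticeApprox q A b) (hij : j ≠ i) (h1 : 3 / 2 < q)
    (h2 : q < 2) (hpos : ∀ v, v ≠ 0 → 0 < A v) : 0 < ∫ σ, stripKernel A i 1 σ ^ 2 := by
  refine integral_sq_pos (hb.memLp_stripKernel h1 h2 (fun _ => one_pos) hij)
    (ae_of_all _ fun σ hσ => ?_)
  refine setIntegral_pos_of_ae_pos (fun h0 => ?_) (hA.integrableOn_strip hij h1 h2 σ) ?_
  · have hsub : (fun ρ => ρ + σ) ⁻¹' box 1 ⊆ {ρ | Pi.single i 1 * ρ + σ ∈ box 1} := by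
      intro ρ hρ
      rw [Set.mem_preimage, mem_box] at hρ
      rw [mem_box] at hσ
      exact (mem_strip_iff hij).2 ⟨hρ i, hσ j⟩
    have h := measure_mono_null hsub h0
    rw [measure_preimage_add_right, volume_box_one] at h
    exact one_ne_zero h
  · filter_upwards [ae_apply_ne 0 0] with v hv
    exact hpos v fun h => hv (by rw [h]; rfl)

end PositiveKernel

theorem IsSheetKernel.of_comp_mulVec {B : Matrix (Fin 2) (Fin 2) ℝ} (hB : B.det ≠ 0)
    {H : Fin 2 → ℝ} {s : ℝ} {K h : (Fin 2 → ℝ) → (Fin 2 → ℝ) → ℝ} (hh : IsSheetKernel H s h)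
    (hK : ∀ x, (∀ k, 0 < x k) → MemLp (K x) 2 volume)
    (e : ∀ x σ, K x (B *ᵥ σ) = |B.det| ^ (-(1 / 2) : ℝ) * h x σ) : IsSheetKernel H s K where
  memLp := hK
  integral_mul x y hx hy := by
    rw [integral_mul_eq_of_comp_mulVec hB (e x) (e y), hh.integral_mul x y hx hy]

section LimitSheets

variable {q : ℝ} {B D : Matrix (Fin 2) (Fin 2) ℝ} {Lplus Lminus : ℝ → ℝ} {b : (Fin 2 → ℤ) → ℝ}
  {i j : Fin 2}

theorem CoeffAssumption.isSheetKernel_kernelTilde (hb : CoeffAssumption q q B Lplus Lminus b)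
    (hij : j ≠ i) (hD : ∀ t, D *ᵥ t = B *ᵥ ((Function.update 1 i 0 : Fin 2 → ℝ) * t))
    (h1 : 1 < q) (h2 : q < 3 / 2) :
    IsSheetKernel (Function.update (fun _ => 2 - q) i 1)
      (∫ σ, smearedKernel (fun v => aInfty q q Lplus Lminus (B *ᵥ v))
        (Function.update 1 i 0) 1 σ ^ 2)
      (kernelTilde (aInfty q q Lplus Lminus) B D) :=
  (hb.homogeneousKernel.isSheetKernel_smearedKernel hij h1 h2).of_comp_mulVec hb.det_ne_zero
    (fun x hx => (vTildeWellDefined hb.det_ne_zero hb.homogeneousKernel hD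
      (fun _ hx => smearedDomination_update h1 h2 i hx) x hx).2) (kernelTilde_mulVec hD)

theorem CoeffAssumption.isSheetKernel_kernel (hb : CoeffAssumption q q B Lplus Lminus b)
    (hij : j ≠ i) (hD : ∀ ρ, D *ᵥ (B *ᵥ ρ) = Pi.single i 1 * ρ) (h1 : 3 / 2 < q) (h2 : q < 2) :
    IsSheetKernel (Function.update (fun _ => 5 / 2 - q) j (1 / 2))
      (∫ σ, stripKernel (fun v => aInfty q q Lplus Lminus (B *ᵥ v)) i 1 σ ^ 2)
      (kernel (aInfty q q Lplus Lminus) B D) := by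
  have e : kernel (aInfty q q Lplus Lminus) B D
      = stripKernel (fun v => aInfty q q Lplus Lminus (B *ᵥ v)) i :=
    funext fun x => kernel_eq_stripKernel hb.det_ne_zero hD x
  rw [e]
  exact hb.homogeneousKernel.isSheetKernel_stripKernel hb.latticeApprox hij h1 h2

variable {Ω : Type*} [MeasurableSpace Ω] {P : Measure Ω} [IsProbabilityMeasure P]
  (W : WhiteNoise P)

theorem update_pos {c d : ℝ} (hc : 0 < c) (hd : 0 < d) (i k : Fin 2) :
    0 < Function.update (fun _ => c) i d k := by
  by_cases hk : k = i
  · simpa [hk] using hd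
  · simpa [hk] using hc

theorem CoeffAssumption.eqScaledFBS_vTilde (hb : CoeffAssumption q q B Lplus Lminus b)
    (hij : j ≠ i) (hD : ∀ t, D *ᵥ t = B *ᵥ ((Function.update 1 i 0 : Fin 2 → ℝ) * t))
    (h1 : 1 < q) (h2 : q < 3 / 2) :
    EqScaledFBS (Function.update (fun _ => 2 - q) i 1 0) (Function.update (fun _ => 2 - q) i 1 1)
      (VTilde W (aInfty q q Lplus Lminus) B D) P :=
  (hb.isSheetKernel_kernelTilde hij hD h1 h2).eqScaledFBS W
    (update_pos (by linarith) one_pos i) (hb.radial.isSheetKernel_kernelTilde hij hD h1 h2)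
    (hb.radial.homogeneousKernel.integral_smearedKernel_sq_pos
      (fun _ hv => aInfty_radial_pos (mulVec_ne_zero hb.det_ne_zero hv)) ⟨j, by simp [hij]⟩
      (smearedDomination_update h1 h2 i fun _ => one_pos))

theorem CoeffAssumption.eqScaledFBS_v (hb : CoeffAssumption q q B Lplus Lminus b)
    (hij : j ≠ i) (hD : ∀ ρ, D *ᵥ (B *ᵥ ρ) = Pi.single i 1 * ρ) (h1 : 3 / 2 < q) (h2 : q < 2) :
    EqScaledFBS (Function.update (fun _ => 5 / 2 - q) j (1 / 2) 0)
      (Function.update (fun _ => 5 / 2 - q) j (1 / 2) 1)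
      (V W (aInfty q q Lplus Lminus) B D) P :=
  (hb.isSheetKernel_kernel hij hD h1 h2).eqScaledFBS W
    (update_pos (by linarith) (by norm_num) j) (hb.radial.isSheetKernel_kernel hij hD h1 h2)
    (hb.radial.homogeneousKernel.integral_stripKernel_sq_pos hb.radial.latticeApprox hij h1 h2
      fun _ hv => aInfty_radial_pos (mulVec_ne_zero hb.det_ne_zero hv))

end LimitSheets

end ScalingLimits

end

theorem theorem4 {Ω Ω' : Type*} [MeasurableSpace Ω] [MeasurableSpace Ω']
    (P : MeasureTheory.Measure Ω) [MeasureTheory.IsProbabilityMeasure P]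
    (P' : MeasureTheory.Measure Ω') [MeasureTheory.IsProbabilityMeasure P']
    (ε : (Fin 2 → ℤ) → Ω → ℝ) (hε : StandardIID ε P)
    (q : ℝ) (B : Matrix (Fin 2) (Fin 2) ℝ) (Lplus Lminus : ℝ → ℝ) (b : (Fin 2 → ℤ) → ℝ)
    (hb : CoeffAssumption q q B Lplus Lminus b)
    (W : WhiteNoise P') (a : (Fin 2 → ℝ) → ℝ) (ha : a = aInfty q q Lplus Lminus)
    (S : ℝ → ℝ → (Fin 2 → ℝ) → Ω → ℝ)
    (hS : S = fun γ l x => ⇑(partialSum (linearField hε b) γ l x)) :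
    -- the series defining the linear field converges in mean square
    (∀ t, Summable (maTerm hε b t)) ∧
    -- case (i)
    (1 < q → q < 3 / 2 →
      (VTildeWellDefined a B (Btilde02 B) ∧ VTildeWellDefined a B (Btilde01 B) ∧
        VTildeWellDefined a B B) ∧
      (∀ γ : ℝ, 1 < γ → TendstoFDD (fun l x ω => (l ^ (1 + γ * (2 - q)))⁻¹ * S γ l x ω) P
        (VTilde W a B (Btilde02 B)) P') ∧
      (∀ γ : ℝ, 0 < γ → γ < 1 → TendstoFDD (fun l x ω => (l ^ ((2 - q) + γ))⁻¹ * S γ l x ω) P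
        (VTilde W a B (Btilde01 B)) P') ∧
      TendstoFDD (fun l x ω => (l ^ (3 - q))⁻¹ * S 1 l x ω) P (VTilde W a B B) P' ∧
      EqScaledFBS 1 (2 - q) (VTilde W a B (Btilde02 B)) P' ∧
      EqScaledFBS (2 - q) 1 (VTilde W a B (Btilde01 B)) P' ∧
      NotProportional (VTilde W a B (Btilde02 B)) (VTilde W a B (Btilde01 B)) P') ∧
    -- case (ii)
    (3 / 2 < q → q < 2 →
      (VWellDefined a B (B10 B) ∧ VWellDefined a B (B20 B) ∧ VWellDefined a B B⁻¹) ∧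
      (∀ γ : ℝ, 1 < γ → TendstoFDD (fun l x ω => (l ^ ((5 / 2 - q) + γ / 2))⁻¹ * S γ l x ω) P
        (V W a B (B10 B)) P') ∧
      (∀ γ : ℝ, 0 < γ → γ < 1 →
        TendstoFDD (fun l x ω => (l ^ (1 / 2 + γ * (5 / 2 - q)))⁻¹ * S γ l x ω) P
          (V W a B (B20 B)) P') ∧
      TendstoFDD (fun l x ω => (l ^ (3 - q))⁻¹ * S 1 l x ω) P (V W a B B⁻¹) P' ∧
      EqScaledFBS (5 / 2 - q) (1 / 2) (V W a B (B10 B)) P' ∧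
      EqScaledFBS (1 / 2) (5 / 2 - q) (V W a B (B20 B)) P' ∧
      NotProportional (V W a B (B10 B)) (V W a B (B20 B)) P') := by
  subst ha hS
  have hB := hb.det_ne_zero
  have hA := hb.homogeneousKernel
  have hL := hb.latticeApprox
  -- Here `1/q₁ + 1/q₂ = 2/q`, so the upper bound `2` says exactly that `q > 1`.
  have hq : 1 < q := by
    have h := hb.Q_lt_two
    rw [← two_mul, mul_one_div, div_lt_iff₀ hb.q₁_pos] at h
    linarith
  refine ⟨fun t => hL.summable_maTerm hq hε t, fun h1 h2 => ?_, fun h1 h2 => ?_⟩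
  · have h2' : q < 2 := by linarith
    refine ⟨⟨vTildeWellDefined hB hA Btilde02_mulVec
        fun _ hx => smearedDomination_update h1 h2 0 hx,
      vTildeWellDefined hB hA Btilde01_mulVec fun _ hx => smearedDomination_update h1 h2 1 hx,
      vTildeWellDefined hB hA (m := 1) (fun t => by rw [one_mul])
        fun _ hx => smearedDomination_one h1 h2' hx⟩,
      fun γ hγ => tendstoFDD_Btilde02 hB hL hA hε W h1 h2 hγ,
      fun γ hγ0 hγ => tendstoFDD_Btilde01 hB hL hA hε W h1 h2 hγ0 hγ,
      tendstoFDD_vTilde_isotropic hB hL hA hε W h1 h2', ?_, ?_, ?_⟩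
    · exact hb.eqScaledFBS_vTilde (i := 0) (j := 1) W (by simp) Btilde02_mulVec h1 h2
    · exact hb.eqScaledFBS_vTilde (i := 1) (j := 0) W (by simp) Btilde01_mulVec h1 h2
    -- The Hurst indices in the first direction are `1` and `2 - q`, distinct because `q > 1`.
    · refine (hb.isSheetKernel_kernelTilde (i := 0) (j := 1) (by simp) Btilde02_mulVec h1
        h2).notProportional W (hb.isSheetKernel_kernelTilde (i := 1) (j := 0) (by simp)
        Btilde01_mulVec h1 h2) (update_pos (by linarith) one_pos 0)
        (update_pos (by linarith) one_pos 1) fun h => ?_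
      simp at h
      linarith
  · refine ⟨⟨vWellDefined (i := 0) (j := 1) hB hA hL h1 h2 (by simp) (B10_mulVec hB),
      vWellDefined (i := 1) (j := 0) hB hA hL h1 h2 (by simp) (B20_mulVec hB),
      vWellDefined_inv hB hA hq h2⟩,
      fun γ hγ => tendstoFDD_B10 hB hL hε W h1 h2 hγ,
      fun γ hγ0 hγ => tendstoFDD_B20 hB hL hε W h1 h2 hγ0 hγ,
      tendstoFDD_v_isotropic hB hL hA hε W hq h2, ?_, ?_, ?_⟩
    · exact hb.eqScaledFBS_v (i := 0) (j := 1) W (by simp) (B10_mulVec hB) h1 h2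
    · exact hb.eqScaledFBS_v (i := 1) (j := 0) W (by simp) (B20_mulVec hB) h1 h2
    -- The Hurst indices in the first direction are `5/2 - q` and `1/2`, distinct because `q < 2`.
    · refine (hb.isSheetKernel_kernel (i := 0) (j := 1) (by simp) (B10_mulVec hB) h1
        h2).notProportional W (hb.isSheetKernel_kernel (i := 1) (j := 0) (by simp)
        (B20_mulVec hB) h1 h2) (update_pos (by linarith) (by norm_num) 1)
        (update_pos (by linarith) (by norm_num) 0) fun h => ?_
      simp at h
      linarith
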